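/- Let $1\le d\le 4$, $\alpha>\frac d2$, $s=3\alpha$, $\mathbb T=\mathbb R/2\pi\mathbb Z$, and fix a cutoff $\mathcal X\in C_c^\infty(\mathbb R)$, real-valued, with $\mathcal X(\xi)=1$ for $|\xi|\le1$ and $\mathcal X(\xi)=0$ for $|\xi|\ge2$. For a function $f(v,y)$ on $\mathbb R\times\mathbb T^d$ let $P_{\le N}f$ be the Fourier multiplier in the variable $v\in\mathbb R$ with symbol $\mathcal X(\xi/N)$. Write $L_x=x+it\partial_x$ and $D_y=(1-\Delta_y)^{1/2}$, so that $\|D_y^su\|_{L^2_{x,y}}=\|u\|_{L^2_xH^s_y}$, and $$\|u(t)\|_{X^+}^2=\|L_xu(t)\|_{L^2_{x,y}}^2+\|D_y^su(t)\|_{L^2_{x,y}}^2 .$$ There is a constant $C>0$, depending only on $d$, $\alpha$ and $\mathcal X$, such that the following holds. Let $J\subset(0,\infty)$ be an interval and let $u$ with $u\in C(J;L^2_xH^s_y)$ and $L_xu\in C(J;L^2_{x,y})$ be a solution (in the sense of distributions) of $$\Big(i\partial_t+\tfrac12\partial_x^2+\tfrac12\Delta_y\Big)u=|u|^2u\qquad\text{on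 } J\times\mathbb R\times\mathbb T^d .$$ Put $$w(t,v,y)=t^{1/2}e^{-itv^2/2}\,u(t,tv,y),\qquad \gamma(t,\cdot,\cdot)=P_{\le\sqrt t}\,w(t,\cdot,\cdot).$$ Then there is a function $I(t,v,y)$ on $J\times\mathbb R\times\mathbb T^d$, with $I(t)\in L^2_{v,y}$ for every $t\in J$ and $I(t,v,\cdot)\in L^2(\mathbb T^d)$ for every $t\in J$ and $v\in\mathbb R$, such that for every $v\in\mathbb R$ $$i\partial_t\gamma+\tfrac12\Delta_y\gamma=\tfrac1t|\gamma|^2\gamma+I\qquad\text{on } J\times\mathbb T^d$$ in the sense of distributions in $y$ (each Fourier coefficient of $\gamma(t,v,\cdot)$ in $y$ is differentiable in $t\in J$, with one-sided derivatives at endpoints of $J$, and the Fourier coefficients of both sides agree), and for every $t\in J$ $$\|I(t)\|_{L^2_{v,y}}\le C\,t^{-\frac32}\Big(\|u(t)\|_{L^2_{x,y}}^{\frac13}\|u(t)\|_{X^+}^{\frac53}+1\Big)\|u(t)\|_{X^+},$$ $$\|I(t)\|_{L^\infty_vH^\alpha_y}\le C\,t^{-\frac{13}{12}}\Big(\|u(t)\|_{L^2_{x,y}}^{\frac13}\|u(t)\|_{X^+}^{\frac53}+1\Big)\|u(t)\|_{X^+}.$$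 -/

import Mathlib

open MeasureTheory Filter Topology
open scoped ENNReal

noncomputable section

namespace NLSCylinder

instance instFactTwoPiPos : Fact ((0 : ℝ) < 2 * Real.pi) := ⟨Real.two_pi_pos⟩

/-- The torus `𝕋^d`, with `𝕋 = ℝ / 2πℤ`; its volume is `(2π)^d`. -/
abbrev Torus (d : ℕ) : Type := Fin d → AddCircle (2 * Real.pi)

/-- The squared length `|k|²` of a frequency `k ∈ ℤ^d`. -/
def freqSq {d : ℕ} (k : Fin d → ℤ) : ℝ := ∑ j, (k j : ℝ) ^ 2

/-- The function `y ↦ e^{i ⟨k, y⟩}` on the torus. -/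
def torusChar {d : ℕ} (k : Fin d → ℤ) (y : Torus d) : ℂ := ∏ j, fourier (k j) (y j)

/-- The Fourier coefficient `(2π)^{-d/2} ∫_{𝕋^d} g(y) e^{-i ⟨k, y⟩} dy`. -/
def torusCoeff {d : ℕ} (g : Torus d → ℂ) (k : Fin d → ℤ) : ℂ :=
  (((2 * Real.pi) ^ (-(d : ℝ) / 2) : ℝ) : ℂ) * ∫ y, g y * torusChar (-k) y

/-- The norm of `H^s(𝕋^d)`, that is `(∑_k (1 + |k|²)^s |g_k|²)^{1/2}`, in `[0, ∞]`. -/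
def hsNorm {d : ℕ} (s : ℝ) (g : Torus d → ℂ) : ℝ≥0∞ :=
  (∑' k : Fin d → ℤ, ENNReal.ofReal ((1 + freqSq k) ^ s * ‖torusCoeff g k‖ ^ 2)) ^ (1 / 2 : ℝ)

/-- The norm of `L²(ℝ × 𝕋^d)`, in `[0, ∞]`. -/
def l2Norm {d : ℕ} (f : ℝ → Torus d → ℂ) : ℝ≥0∞ :=
  eLpNorm (fun p : ℝ × Torus d => f p.1 p.2) 2 volume

/-- `f ∈ L²(ℝ × 𝕋^d)`. -/
def InL2 {d : ℕ} (f : ℝ → Torus d → ℂ) : Prop :=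
  MemLp (fun p : ℝ × Torus d => f p.1 p.2) 2 volume

/-- The norm of `L²_x H^s_y`, that is `‖D_y^s f‖_{L²_{x,y}}` with `D_y = (1 - Δ_y)^{1/2}`,
in `[0, ∞]`. -/
def l2HsNorm {d : ℕ} (s : ℝ) (f : ℝ → Torus d → ℂ) : ℝ≥0∞ :=
  (∫⁻ x, hsNorm s (f x) ^ (2 : ℝ)) ^ (1 / 2 : ℝ)

/-- The norm of `L^∞_x H^s_y`, in `[0, ∞]`. -/
def lInftyHsNorm {d : ℕ} (s : ℝ) (f : ℝ → Torus d → ℂ) : ℝ≥0∞ :=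
  essSup (fun x => hsNorm s (f x)) volume

/-- The test functions in `C_c^∞(ℝ; ℂ)`. -/
def IsTest (φ : ℝ → ℂ) : Prop := ContDiff ℝ (⊤ : ℕ∞) φ ∧ HasCompactSupport φ

/-- The pairing of `f` with `φ(x) e^{-i ⟨k, y⟩}`. The functions `φ(x) e^{-i ⟨k, y⟩}`, with `φ` a
test function and `k ∈ ℤ^d`, span a dense subspace of `C_c^∞(ℝ × 𝕋^d)`, so that they are enough
to test an identity between distributions on `ℝ × 𝕋^d`. -/
def pairing {d : ℕ} (f : ℝ → Torus d → ℂ) (φ : ℝ → ℂ) (k : Fin d → ℤ) : ℂ :=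
  ∫ p : ℝ × Torus d, f p.1 p.2 * (φ p.1 * torusChar (-k) p.2)

/-- `g ∈ L²` is `L_x f = x f + i t ∂_x f`, with `∂_x` in the sense of distributions. -/
def IsLx {d : ℕ} (t : ℝ) (f g : ℝ → Torus d → ℂ) : Prop :=
  InL2 g ∧ ∀ φ : ℝ → ℂ, IsTest φ → ∀ k : Fin d → ℤ,
    pairing g φ k = pairing f (fun x => (x : ℂ) * φ x - Complex.I * (t : ℂ) * deriv φ x) k

/-- `‖L_x f‖_{L²}` at time `t`. There is at most one `L_x f` in `L²` up to null sets, and the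
value is `∞` if there is none. -/
def lxNorm {d : ℕ} (t : ℝ) (f : ℝ → Torus d → ℂ) : ℝ≥0∞ :=
  ⨅ (g : ℝ → Torus d → ℂ) (_ : IsLx t f g), l2Norm g

/-- The norm `(‖L_x f‖_{L²}² + ‖D_y^s f‖_{L²}²)^{1/2}` of `X⁺` at time `t`, in `[0, ∞]`. -/
def xPlusNorm {d : ℕ} (s t : ℝ) (f : ℝ → Torus d → ℂ) : ℝ≥0∞ :=
  (lxNorm t f ^ (2 : ℝ) + l2HsNorm s f ^ (2 : ℝ)) ^ (1 / 2 : ℝ)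

/-- The cubic nonlinearity `|z|² z`. -/
def cubic (z : ℂ) : ℂ := ((‖z‖ ^ 2 : ℝ) : ℂ) * z

/-- `u` solves `(i ∂_t + ½ ∂_x² + ½ Δ_y) u = |u|² u` on the set `J` of times, in the sense of
distributions on `ℝ × 𝕋^d`, in the class `u ∈ C(J; L²_x H^s_y)`, `L_x u ∈ C(J; L²_{x,y})`. -/
structure IsSolution {d : ℕ} (s : ℝ) (J : Set ℝ) (u : ℝ → ℝ → Torus d → ℂ) : Prop where
  memL2 : ∀ t ∈ J, InL2 (u t)
  memL2Hs : ∀ t ∈ J, l2HsNorm s (u t) < ⊤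
  continuousL2Hs : ∀ t ∈ J,
    Tendsto (fun τ => l2HsNorm s (fun x y => u τ x y - u t x y)) (𝓝[J] t) (𝓝 0)
  continuousLx : ∃ Lu : ℝ → ℝ → Torus d → ℂ, (∀ t ∈ J, IsLx t (u t) (Lu t)) ∧
    ∀ t ∈ J, Tendsto (fun τ => l2Norm (fun x y => Lu τ x y - Lu t x y)) (𝓝[J] t) (𝓝 0)
  equation : ∀ φ : ℝ → ℂ, IsTest φ → ∀ k : Fin d → ℤ, ∀ t ∈ J, ∃ D : ℂ,
    HasDerivWithinAt (fun τ => pairing (u τ) φ k) D J t ∧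
      Complex.I * D + 1 / 2 * pairing (u t) (deriv (deriv φ)) k
          - (freqSq k : ℂ) / 2 * pairing (u t) φ k
        = pairing (fun x y => cubic (u t x y)) φ k

/-- `f` solves `i ∂_t f + ½ Δ_y f = F` on `J × 𝕋^d` for the set `J` of times, in the sense of
distributions on `𝕋^d`: every Fourier coefficient of `f` is differentiable in time, and both sides
have the same Fourier coefficients. -/
def SolvesOnTorus {d : ℕ} (J : Set ℝ) (f F : ℝ → Torus d → ℂ) : Prop :=
  ∀ t ∈ J, Integrable (f t) volume ∧ Integrable (F t) volume ∧ ∀ k : Fin d → ℤ, ∃ D : ℂ,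
    HasDerivWithinAt (fun τ => torusCoeff (f τ) k) D J t ∧
      Complex.I * D - (freqSq k : ℂ) / 2 * torusCoeff (f t) k = torusCoeff (F t) k

/-- The cutoffs: `χ ∈ C_c^∞(ℝ)`, `χ = 1` on `|ξ| ≤ 1` and `χ = 0` on `|ξ| ≥ 2`. -/
structure IsCutoff (χ : ℝ → ℝ) : Prop where
  smooth : ContDiff ℝ (⊤ : ℕ∞) χ
  eq_one : ∀ ξ : ℝ, |ξ| ≤ 1 → χ ξ = 1
  eq_zero : ∀ ξ : ℝ, 2 ≤ |ξ| → χ ξ = 0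

/-- The convolution kernel `(2π)^{-1} ∫ χ(ξ / N) e^{i z ξ} dξ` of the multiplier `χ(ξ / N)`. -/
def lpKernel (χ : ℝ → ℝ) (N z : ℝ) : ℂ :=
  1 / (2 * (Real.pi : ℂ)) * ∫ ξ : ℝ, (χ (ξ / N) : ℂ) * Complex.exp (Complex.I * (z : ℂ) * (ξ : ℂ))

/-- The Littlewood-Paley projection `P_{≤ N}` in the first variable: the Fourier multiplier with
symbol `χ(ξ / N)`, written as the convolution with its (Schwartz) kernel. -/
def lpProj {d : ℕ} (χ : ℝ → ℝ) (N : ℝ) (f : ℝ → Torus d → ℂ) (v : ℝ) (y : Torus d) : ℂ :=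
  ∫ v' : ℝ, lpKernel χ N (v - v') * f v' y

/-- The profile `w(t, v, y) = t^{1/2} e^{-i t v² / 2} u(t, t v, y)`. -/
def profile {d : ℕ} (u : ℝ → ℝ → Torus d → ℂ) (t v : ℝ) (y : Torus d) : ℂ :=
  (Real.sqrt t : ℂ) * Complex.exp (-Complex.I * (t : ℂ) * (v : ℂ) ^ 2 / 2) * u t (t * v) y

/-- The low-frequency profile `γ(t) = P_{≤ √t} w(t)`. -/
def lowProfile {d : ℕ} (χ : ℝ → ℝ) (u : ℝ → ℝ → Torus d → ℂ) (t : ℝ) : ℝ → Torus d → ℂ :=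
  lpProj χ (Real.sqrt t) (profile u t)

end NLSCylinder

end

/-! ### Fourier series on the torus and Parseval's identity. -/

noncomputable section

namespace NLSCylinder

open scoped ComplexConjugate
open Submodule Set

variable {d : ℕ}

/-! The function `γ` is a wave packet test of the solution. After the change of variables `x = t v`,
the `k`-th coefficient of `γ(t, v, ·)` is, up to `(2π)^{-d/2}`, the pairing of `u(t)` with `e^{-i x²
/ (2t)} K(√t (v - x / t))` times `e^{-i ⟨k, y⟩}`, where `K` is the Schwartz kernel of `P_{≤ 1}`.
This packet almost solves the adjoint free Schrödinger equation: `i ∂_t - ½ ∂_x²` sends it to `t⁻¹`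
times the packet of `B = -½ K'' + (i/2) (z K)'` (`wavePacket_identity`). Since `|w|² w` is `t` times
the profile of `|u|² u` (`cubic_profileAt`), the equation holds with `I = t⁻¹ (P(|w|² w) - |γ|² γ +
B * w)`, where `P` and `B *` are convolutions at scale `t^{-1/2}` in `v`.

The decay of `I` beyond `t⁻¹` comes from two means: `∫ K = χ(0) = 1`, and `∫ B = 0` because `B` is a
derivative. Write `P F - |γ|² γ = (P F - F) + (F - |γ|² γ)` with `F = |w|² w`. The terms `P F - F`,
`w - P w` and `B * w` are then averages of increments in `v` of size about `t^{-1/2}`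
(`mean_mul_sub_convolve`), and the cubic differences reduce to differences of `w`. Conjugation by
the phase turns `L_x` into `i ∂_v`, so `‖∂_v w‖ = ‖L_x u‖`. Translations by `z` therefore cost `|z|`
in `L²`, which gives `t^{-1} t^{-1/2}`; in `H^α_y` the increments are Hölder of exponent `1/6`,
which gives `t^{-1} t^{-1/12}`.

The `H^α_y` bounds are proved mode by mode (`exists_profileBounds`). For one coefficient with `L²`
norm squared `a` and derivative norm squared `b`, the supremum squared is at most `4 (a b)^{1/2}`
and the increments satisfy `|F(v) - F(v')|⁶ ≤ 256 |v - v'| a b²`. The weight of `H^α` is the cube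
root of the weight of `H^{3α}`, so Hölder's inequality in `k` bounds the supremum squared by
`U^{1/3} X^{5/3}` and the increments squared by `|v - v'|^{1/3} X²`, with `U`, `X` the `L²` and `X⁺`
norms. As `α > d/2`, `H^α(𝕋^d)` is an algebra of bounded functions, which handles the cubic term
(`hsSq_cubic_sub_le`).

The equation for `u` is known only against compactly supported test functions fixed in time. It is
extended to decaying functions by truncation, with an estimate uniform in the truncation
(`hasDerivWithinAt_pairing`), and then to moving packets by a product rule. Both use that `u` is
bounded locally uniformly in time, so that `|u|² u` is continuous in time with values in `L²`. -/

theorem continuous_torusChar (k : Fin d → ℤ) : Continuous (torusChar k) := by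
  unfold torusChar
  fun_prop

theorem norm_torusChar (k : Fin d → ℤ) (y : Torus d) : ‖torusChar k y‖ = 1 := by
  unfold torusChar
  rw [norm_prod]
  refine Finset.prod_eq_one fun j _ => ?_
  rw [fourier_apply, Circle.norm_coe]

theorem conj_torusChar (k : Fin d → ℤ) (y : Torus d) : conj (torusChar k y) = torusChar (-k) y := by
  simp [torusChar]

theorem torusChar_add (k l : Fin d → ℤ) (y : Torus d) :
    torusChar (k + l) y = torusChar k y * torusChar l y := by
  simp [torusChar, Finset.prod_mul_distrib]

theorem torusChar_zero (y : Torus d) : torusChar (0 : Fin d → ℤ) y = 1 := by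
  simp [torusChar]

instance isFiniteMeasure_addCircle : IsFiniteMeasure (volume : Measure (AddCircle (2 * Real.pi))) :=
  CompactSpace.isFiniteMeasure

theorem integral_torusChar (k : Fin d → ℤ) :
    ∫ y : Torus d, torusChar k y = if k = 0 then (((2 * Real.pi) ^ d : ℝ) : ℂ) else 0 := by
  unfold torusChar
  rw [MeasureTheory.integral_fintype_prod_volume_eq_prod]
  have key : ∀ n : ℤ, ∫ y : AddCircle (2 * Real.pi), fourier n y
      = if n = 0 then ((2 * Real.pi : ℝ) : ℂ) else 0 := by
    intro n
    rw [AddCircle.volume_eq_smul_haarAddCircle, integral_smul_measure]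
    have h := (orthonormal_iff_ite.mp (orthonormal_fourier (T := 2 * Real.pi))) 0 n
    rw [ContinuousMap.inner_toLp] at h
    simp only [fourier_zero] at h
    simp only [map_one, mul_one] at h
    rw [h, ENNReal.toReal_ofReal Real.two_pi_pos.le]
    by_cases hn : n = 0
    · simp [hn]
    · simp [hn, Ne.symm hn]
  simp_rw [key]
  split_ifs with h
  · subst h
    simp
  · obtain ⟨i, hi⟩ := Function.ne_iff.mp h
    exact Finset.prod_eq_zero (Finset.mem_univ i) (by simpa using hi)

/-- The normalization constant `(2π)^{-d/2}` of the Fourier coefficients. -/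
def torusConst (d : ℕ) : ℝ := (2 * Real.pi) ^ (-(d : ℝ) / 2)

theorem torusConst_pos (d : ℕ) : 0 < torusConst d := Real.rpow_pos_of_pos Real.two_pi_pos _

theorem torusConst_sq (d : ℕ) : torusConst d * torusConst d * (2 * Real.pi) ^ d = 1 := by
  unfold torusConst
  rw [← Real.rpow_natCast, ← Real.rpow_add Real.two_pi_pos, ← Real.rpow_add Real.two_pi_pos]
  norm_num

theorem torusCoeff_eq (g : Torus d → ℂ) (k : Fin d → ℤ) :
    torusCoeff g k = (torusConst d : ℂ) * ∫ y, g y * torusChar (-k) y := rfl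

/-- The character `e^{i ⟨k, y⟩}`, as a continuous map. -/
def torusCharC (k : Fin d → ℤ) : C(Torus d, ℂ) := ⟨torusChar k, continuous_torusChar k⟩

/-- The normalized characters `(2π)^{-d/2} e^{i ⟨k, y⟩}`, as continuous maps. -/
def torusUnit (k : Fin d → ℤ) : C(Torus d, ℂ) := (torusConst d : ℂ) • torusCharC k

theorem torusUnit_apply (k : Fin d → ℤ) (y : Torus d) :
    torusUnit k y = (torusConst d : ℂ) * torusChar k y := rfl

/-- The star subalgebra of `C(𝕋^d, ℂ)` generated by the characters. -/
def torusSubalgebra (d : ℕ) : StarSubalgebra ℂ C(Torus d, ℂ) where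
  toSubalgebra := Algebra.adjoin ℂ (range torusCharC)
  star_mem' := by
    change Algebra.adjoin ℂ (range torusCharC) ≤ star (Algebra.adjoin ℂ (range torusCharC))
    refine Algebra.adjoin_le ?_
    rintro _ ⟨n, rfl⟩
    refine Algebra.subset_adjoin ⟨-n, ?_⟩
    ext1 x
    exact (conj_torusChar n x).symm

/-- The characters contain `1` and are stable under products, so the algebra they generate is no
larger than their span. -/
theorem torusSubalgebra_coe :
    (torusSubalgebra d).toSubalgebra.toSubmodule = span ℂ (range torusCharC) := by
  apply Algebra.adjoin_eq_span_of_subset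
  refine .trans (fun x ↦ Submonoid.closure_induction (fun _ ↦ id) ⟨0, ?_⟩ ?_) subset_span
  · ext z
    exact torusChar_zero z
  · rintro _ _ _ _ ⟨m, rfl⟩ ⟨n, rfl⟩
    refine ⟨m + n, ?_⟩
    ext z
    exact torusChar_add m n z

theorem torusChar_single (z : Torus d) (i : Fin d) :
    torusChar (Pi.single i 1) z = fourier 1 (z i) := by
  unfold torusChar
  rw [Finset.prod_eq_single i]
  · simp
  · intro j _ hj
    simp [hj]
  · simp

theorem torusSubalgebra_separatesPoints : (torusSubalgebra d).SeparatesPoints := by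
  intro x y hxy
  rw [Ne, funext_iff, not_forall] at hxy
  obtain ⟨i, hi⟩ := hxy
  -- The basic character of a coordinate in which the two points differ already separates them.
  refine ⟨_, ⟨torusCharC (Pi.single i 1), Algebra.subset_adjoin ⟨Pi.single i 1, rfl⟩, rfl⟩, ?_⟩
  change torusChar _ x ≠ torusChar _ y
  rw [torusChar_single, torusChar_single, fourier_one, fourier_one, Ne, Circle.coe_inj]
  contrapose hi
  exact AddCircle.injective_toCircle Real.two_pi_pos.ne' hi

/-- Stone–Weierstrass; the normalization does not change the span. -/
theorem span_torusUnit_closure_eq_top :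
    (span ℂ (range (torusUnit (d := d)))).topologicalClosure = ⊤ := by
  have h1 : span ℂ (range (torusUnit (d := d))) = span ℂ (range (torusCharC (d := d))) := by
    have hc : (torusConst d : ℂ) ≠ 0 := by exact_mod_cast (torusConst_pos d).ne'
    apply le_antisymm
    · refine span_le.mpr ?_
      rintro _ ⟨k, rfl⟩
      exact smul_mem _ _ (subset_span ⟨k, rfl⟩)
    · refine span_le.mpr ?_
      rintro _ ⟨k, rfl⟩
      have : torusCharC k = (torusConst d : ℂ)⁻¹ • torusUnit k := by
        rw [torusUnit, smul_smul, inv_mul_cancel₀ hc, one_smul]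
      rw [this]
      exact smul_mem _ _ (subset_span ⟨k, rfl⟩)
  rw [h1, ← torusSubalgebra_coe]
  exact congr_arg (Subalgebra.toSubmodule <| StarSubalgebra.toSubalgebra ·)
    (ContinuousMap.starSubalgebra_topologicalClosure_eq_top_of_separatesPoints _
      torusSubalgebra_separatesPoints)

/-- The normalized characters as elements of `L²`. -/
abbrev torusUnitLp (k : Fin d → ℤ) : Lp ℂ 2 (volume : Measure (Torus d)) :=
  ContinuousMap.toLp (E := ℂ) 2 volume ℂ (torusUnit k)

theorem span_torusUnitLp_closure_eq_top :
    (span ℂ (range (torusUnitLp (d := d)))).topologicalClosure = ⊤ := by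
  simpa only [map_span, ContinuousLinearMap.coe_coe, ← range_comp, Function.comp_def] using
    (ContinuousMap.toLp_denseRange ℂ volume ℂ (p := 2) (by simp)).topologicalClosure_map_submodule
      (span_torusUnit_closure_eq_top (d := d))

theorem orthonormal_torusUnitLp : Orthonormal ℂ (torusUnitLp (d := d)) := by
  rw [orthonormal_iff_ite]
  intro m n
  rw [ContinuousMap.inner_toLp]
  have : ∀ y : Torus d, torusUnit n y * conj (torusUnit m y)
      = ((torusConst d * torusConst d : ℝ) : ℂ) * torusChar (n - m) y := by
    intro y
    rw [torusUnit_apply, torusUnit_apply, map_mul, conj_torusChar, sub_eq_add_neg, torusChar_add,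
      Complex.conj_ofReal]
    push_cast
    ring
  simp_rw [this]
  rw [integral_const_mul, integral_torusChar]
  have hc := torusConst_sq d
  by_cases h : m = n
  · subst h
    rw [if_pos (sub_self _), if_pos rfl, ← Complex.ofReal_mul, hc, Complex.ofReal_one]
  · rw [if_neg (by rwa [sub_eq_zero, eq_comm]), if_neg h, mul_zero]

/-- The Hilbert basis of `L²(𝕋^d)` made of the normalized characters. -/
def torusBasis : HilbertBasis (Fin d → ℤ) ℂ (Lp ℂ 2 (volume : Measure (Torus d))) :=
  HilbertBasis.mk orthonormal_torusUnitLp span_torusUnitLp_closure_eq_top.ge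

theorem torusBasis_repr {g : Torus d → ℂ} (hg : MemLp g 2 volume) (k : Fin d → ℤ) :
    torusBasis.repr (hg.toLp g) k = torusCoeff g k := by
  rw [torusBasis.repr_apply_apply, MeasureTheory.L2.inner_def, torusCoeff_eq, torusBasis,
    HilbertBasis.coe_mk, ← integral_const_mul]
  apply integral_congr_ae
  filter_upwards [ContinuousMap.coeFn_toLp (p := 2) (𝕜 := ℂ) volume (torusUnit k), hg.coeFn_toLp]
    with y h1 h2
  rw [h1, h2, RCLike.inner_apply, torusUnit_apply, map_mul, conj_torusChar, Complex.conj_ofReal]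
  ring

/-- The polarized form of Parseval is needed, besides the norm identity, to write the coefficients
of a product as a convolution. -/
theorem hasSum_conj_torusCoeff_mul {f g : Torus d → ℂ} (hf : MemLp f 2 volume)
    (hg : MemLp g 2 volume) :
    HasSum (fun k => conj (torusCoeff f k) * torusCoeff g k) (∫ y, conj (f y) * g y) := by
  have h := torusBasis.hasSum_inner_mul_inner (hf.toLp f) (hg.toLp g)
  have h2 : inner ℂ (hf.toLp f) (hg.toLp g) = ∫ y, conj (f y) * g y := by
    rw [MeasureTheory.L2.inner_def]
    apply integral_congr_ae
    filter_upwards [hf.coeFn_toLp, hg.coeFn_toLp] with y h1 h2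
    rw [h1, h2, RCLike.inner_apply, mul_comm]
  rw [h2] at h
  refine h.congr_fun fun k => ?_
  rw [← torusBasis_repr hf, ← torusBasis_repr hg, HilbertBasis.repr_apply_apply,
    HilbertBasis.repr_apply_apply, inner_conj_symm]

/-- Parseval's identity on the torus. -/
theorem tsum_enorm_torusCoeff_sq {g : Torus d → ℂ} (hg : MemLp g 2 volume) :
    ∑' k, ‖torusCoeff g k‖ₑ ^ 2 = ∫⁻ y, ‖g y‖ₑ ^ 2 := by
  have h := hasSum_conj_torusCoeff_mul hg hg
  have e1 : (fun k => conj (torusCoeff g k) * torusCoeff g k)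
      = fun k => ((‖torusCoeff g k‖ ^ 2 : ℝ) : ℂ) := by
    ext k
    rw [Complex.conj_mul']
    push_cast
    rfl
  have e2 : ∫ y, conj (g y) * g y = ((∫ y, ‖g y‖ ^ 2 : ℝ) : ℂ) := by
    rw [← integral_complex_ofReal]
    congr 1
    ext y
    rw [Complex.conj_mul']
    push_cast
    rfl
  rw [e1, e2, Complex.hasSum_ofReal] at h
  have h3 : ∀ z : ℂ, ‖z‖ₑ ^ 2 = ENNReal.ofReal (‖z‖ ^ 2) := by
    intro z
    rw [ENNReal.ofReal_pow (norm_nonneg _), ofReal_norm]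
  simp_rw [h3]
  rw [← ENNReal.ofReal_tsum_of_nonneg (fun k => by positivity) h.summable, h.tsum_eq]
  rw [ofReal_integral_eq_lintegral_ofReal]
  · exact hg.integrable_norm_pow (by norm_num)
  · exact Eventually.of_forall fun y => by positivity

end NLSCylinder
end

/-! ### Sobolev spaces on the torus: algebra property and the cubic nonlinearity. -/

noncomputable section

namespace NLSCylinder

open scoped ComplexConjugate

variable {d : ℕ}

/-- The Cauchy-Schwarz inequality, for squares. -/
theorem lintegral_mul_sq_le {X : Type*} [MeasurableSpace X] {μ : Measure X} {f g : X → ℝ≥0∞}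
    (hf : AEMeasurable f μ) (hg : AEMeasurable g μ) :
    (∫⁻ x, f x * g x ∂μ) ^ 2 ≤ (∫⁻ x, f x ^ 2 ∂μ) * ∫⁻ x, g x ^ 2 ∂μ := by
  have h := ENNReal.lintegral_mul_le_Lp_mul_Lq μ
    (p := 2) (q := 2) (Real.holderConjugate_iff.mpr ⟨by norm_num, by norm_num⟩) hf hg
  have h2 := pow_le_pow_left' h 2
  refine h2.trans (le_of_eq ?_)
  rw [mul_pow, ← ENNReal.rpow_natCast, ← ENNReal.rpow_mul, ← ENNReal.rpow_natCast,
    ← ENNReal.rpow_mul]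
  norm_num

/-- The Cauchy-Schwarz inequality with a weight. -/
theorem lintegral_mul_sq_le_weight {X : Type*} [MeasurableSpace X] {μ : Measure X}
    {w f : X → ℝ≥0∞} (hw : AEMeasurable w μ) (hf : AEMeasurable f μ) :
    (∫⁻ x, w x * f x ∂μ) ^ 2 ≤ (∫⁻ x, w x ∂μ) * ∫⁻ x, w x * f x ^ 2 ∂μ := by
  have hs : ∀ x, w x ^ (1 / 2 : ℝ) * w x ^ (1 / 2 : ℝ) = w x := by
    intro x
    rw [← ENNReal.rpow_add_of_nonneg _ _ (by norm_num) (by norm_num)]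
    norm_num
  have h := lintegral_mul_sq_le (μ := μ) (f := fun x => w x ^ (1 / 2 : ℝ))
    (g := fun x => w x ^ (1 / 2 : ℝ) * f x) (hw.pow_const _) ((hw.pow_const _).mul hf)
  have e1 : ∀ x, w x ^ (1 / 2 : ℝ) * (w x ^ (1 / 2 : ℝ) * f x) = w x * f x := fun x => by
    rw [← mul_assoc, hs]
  have e2 : ∀ x, (w x ^ (1 / 2 : ℝ)) ^ 2 = w x := fun x => by rw [sq, hs]
  have e3 : ∀ x, (w x ^ (1 / 2 : ℝ) * f x) ^ 2 = w x * f x ^ 2 := fun x => by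
    rw [mul_pow, e2]
  simpa only [e1, e2, e3] using h

/-- Weighted Cauchy–Schwarz for the counting measure, with weight `u⁻¹` and function `u a`. It is
the step that converts `ℓ²` bounds with weights into absolute convergence. -/
theorem tsum_sq_le_weight {ι : Type*} {u a : ι → ℝ≥0∞} (h0 : ∀ i, u i ≠ 0) (h1 : ∀ i, u i ≠ ⊤) :
    (∑' i, a i) ^ 2 ≤ (∑' i, (u i)⁻¹) * ∑' i, u i * a i ^ 2 := by
  let _ : MeasurableSpace ι := ⊤
  have h := lintegral_mul_sq_le_weight (μ := Measure.count) (w := fun i => (u i)⁻¹)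
    (f := fun i => u i * a i) (measurable_from_top).aemeasurable (measurable_from_top).aemeasurable
  rw [lintegral_count, lintegral_count, lintegral_count] at h
  convert h using 4 with i i
  · rw [← mul_assoc, ENNReal.inv_mul_cancel (h0 i) (h1 i), one_mul]
  · rw [mul_pow, sq (u i), mul_assoc, ← mul_assoc (u i)⁻¹, ENNReal.inv_mul_cancel (h0 i) (h1 i),
      one_mul]

/-- The weight `(1 + |k|²)^s` of `H^s`. -/
def hsWeight (s : ℝ) (k : Fin d → ℤ) : ℝ≥0∞ := ENNReal.ofReal ((1 + freqSq k) ^ s)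

theorem freqSq_nonneg (k : Fin d → ℤ) : 0 ≤ freqSq k := Finset.sum_nonneg fun _ _ => sq_nonneg _

theorem one_add_freqSq_pos (k : Fin d → ℤ) : 0 < 1 + freqSq k := by
  linarith [freqSq_nonneg k]

theorem hsWeight_ne_zero (s : ℝ) (k : Fin d → ℤ) : hsWeight s k ≠ 0 := by
  simpa [hsWeight] using Real.rpow_pos_of_pos (one_add_freqSq_pos k) s

theorem hsWeight_ne_top (s : ℝ) (k : Fin d → ℤ) : hsWeight s k ≠ ⊤ := ENNReal.ofReal_ne_top

theorem one_le_hsWeight {s : ℝ} (hs : 0 ≤ s) (k : Fin d → ℤ) : 1 ≤ hsWeight s k := by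
  rw [hsWeight, ENNReal.one_le_ofReal]
  exact Real.one_le_rpow (by linarith [freqSq_nonneg k]) hs

theorem freqSq_neg (k : Fin d → ℤ) : freqSq (-k) = freqSq k := by simp [freqSq]

theorem hsWeight_neg (s : ℝ) (k : Fin d → ℤ) : hsWeight s (-k) = hsWeight s k := by
  rw [hsWeight, hsWeight, freqSq_neg]

theorem freqSq_le (k j : Fin d → ℤ) : freqSq k ≤ 2 * (freqSq j + freqSq (k - j)) := by
  unfold freqSq
  rw [← Finset.sum_add_distrib, Finset.mul_sum]
  refine Finset.sum_le_sum fun i _ => ?_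
  simp only [Pi.sub_apply, Int.cast_sub]
  nlinarith [sq_nonneg (2 * (j i : ℝ) - k i)]

/-- One of the frequencies `j`, `k - j` carries the size of `k`: `1 + |k|² ≤ 4 max(1 + |j|², 1 + |k
- j|²)`. The maximum of the two weights is then bounded by their sum. -/
theorem hsWeight_le {s : ℝ} (hs : 0 ≤ s) (k j : Fin d → ℤ) :
    hsWeight s k ≤ ENNReal.ofReal (4 ^ s) * (hsWeight s j + hsWeight s (k - j)) := by
  have p1 := one_add_freqSq_pos j
  have p2 := one_add_freqSq_pos (k - j)
  have p3 := one_add_freqSq_pos k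
  unfold hsWeight
  rw [← ENNReal.ofReal_add (by positivity) (by positivity), ← ENNReal.ofReal_mul (by positivity)]
  apply ENNReal.ofReal_le_ofReal
  have h := freqSq_le k j
  have hm : 1 + freqSq k ≤ 4 * max (1 + freqSq j) (1 + freqSq (k - j)) := by
    have := le_max_left (1 + freqSq j) (1 + freqSq (k - j))
    have := le_max_right (1 + freqSq j) (1 + freqSq (k - j))
    linarith
  calc (1 + freqSq k) ^ s ≤ (4 * max (1 + freqSq j) (1 + freqSq (k - j))) ^ s :=
        Real.rpow_le_rpow p3.le hm hs
    _ = 4 ^ s * (max (1 + freqSq j) (1 + freqSq (k - j))) ^ s :=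
        Real.mul_rpow (by norm_num) (le_max_of_le_left p1.le)
    _ ≤ _ := by
        refine mul_le_mul_of_nonneg_left ?_ (by positivity)
        rcases max_cases (1 + freqSq j) (1 + freqSq (k - j)) with ⟨h, _⟩ | ⟨h, _⟩ <;> rw [h]
        · linarith [Real.rpow_nonneg p2.le s]
        · linarith [Real.rpow_nonneg p1.le s]

theorem tsum_prod_fin (f : ℤ → ℝ≥0∞) (d : ℕ) :
    ∑' k : Fin d → ℤ, ∏ j, f (k j) = (∑' n, f n) ^ d := by
  induction d with
  | zero => simp
  | succ d ih =>
    rw [← (Fin.consEquiv fun _ : Fin (d + 1) => ℤ).tsum_eq, ENNReal.tsum_prod', pow_succ',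
      ← ENNReal.tsum_mul_right]
    refine tsum_congr fun n => ?_
    rw [← ih, ← ENNReal.tsum_mul_left]
    refine tsum_congr fun k => ?_
    rw [Fin.prod_univ_succ]
    simp [Fin.consEquiv]

/-- The weights `(1 + |k|²)^{-α}` are summable over `ℤ^d` for `α > d / 2`. -/
theorem tsum_hsWeight_inv_ne_top (hd : 1 ≤ d) {α : ℝ} (hα : (d : ℝ) / 2 < α) :
    ∑' k : Fin d → ℤ, (hsWeight α k)⁻¹ ≠ ⊤ := by
  have hd0 : (0 : ℝ) < d := by exact_mod_cast hd
  have hα0 : 0 < α := by linarith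
  -- Each factor `1 + k_j²` is at most `1 + |k|²`, so the weight to the power `-1` is at most a
  -- product of one-dimensional terms `(1 + k_j²)^{-β}` with `β = α / d`. Their sum over `ℤ`
  -- converges because `2β > 1`, which is `α > d/2`.
  set β := α / d with hβ
  have hβ1 : 1 < 2 * β := by
    rw [hβ, mul_div_assoc', lt_div_iff₀ hd0]
    linarith
  have hle : ∀ k : Fin d → ℤ, (hsWeight α k)⁻¹
      ≤ ∏ j, ENNReal.ofReal ((1 + (k j : ℝ) ^ 2) ^ (-β)) := by
    intro k
    rw [hsWeight, ← ENNReal.ofReal_inv_of_pos (Real.rpow_pos_of_pos (one_add_freqSq_pos k) _),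
      ← ENNReal.ofReal_prod_of_nonneg (fun j _ => by positivity)]
    apply ENNReal.ofReal_le_ofReal
    rw [Real.finsetProd_rpow _ _ (fun j _ => by positivity), Real.rpow_neg
      (Finset.prod_nonneg fun j _ => by positivity)]
    have hpos : 0 < ∏ j, (1 + (k j : ℝ) ^ 2) := Finset.prod_pos fun j _ => by positivity
    refine inv_anti₀ (Real.rpow_pos_of_pos hpos _) ?_
    have h1 : ∏ j, (1 + (k j : ℝ) ^ 2) ≤ (1 + freqSq k) ^ d := by
      calc ∏ j, (1 + (k j : ℝ) ^ 2) ≤ ∏ _j : Fin d, (1 + freqSq k) := by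
            refine Finset.prod_le_prod (fun j _ => by positivity) fun j _ => ?_
            have := Finset.single_le_sum (f := fun j => (k j : ℝ) ^ 2)
              (fun i _ => sq_nonneg _) (Finset.mem_univ j)
            unfold freqSq
            linarith
        _ = _ := by simp
    calc (∏ j, (1 + (k j : ℝ) ^ 2)) ^ β ≤ ((1 + freqSq k) ^ d) ^ β :=
          Real.rpow_le_rpow hpos.le h1 (by positivity)
      _ = (1 + freqSq k) ^ α := by
          rw [← Real.rpow_natCast, ← Real.rpow_mul (one_add_freqSq_pos k).le, hβ,
            mul_div_cancel₀ _ hd0.ne']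
  refine ne_top_of_le_ne_top ?_ (ENNReal.tsum_le_tsum hle)
  rw [tsum_prod_fin (fun n => ENNReal.ofReal ((1 + (n : ℝ) ^ 2) ^ (-β)))]
  refine ENNReal.pow_ne_top ?_
  have hs : Summable fun n : ℤ => (1 + (n : ℝ) ^ 2) ^ (-β) := by
    have h1 : Summable fun n : ℤ => |(n : ℝ)| ^ (-(2 * β)) := Real.summable_abs_int_rpow hβ1
    refine Summable.of_norm_bounded_eventually h1 ?_
    filter_upwards [(Set.finite_singleton (0 : ℤ)).compl_mem_cofinite] with n hn
    have hn0 : (0 : ℝ) < |(n : ℝ)| := by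
      rw [abs_pos]
      exact_mod_cast hn
    rw [Real.norm_of_nonneg (by positivity), ← mul_neg, Real.rpow_mul hn0.le]
    refine Real.rpow_le_rpow_of_nonpos (by positivity) ?_ (by linarith)
    rw [Real.rpow_two, sq_abs]
    linarith
  rw [← ENNReal.ofReal_tsum_of_nonneg (fun n => by positivity) hs]
  exact ENNReal.ofReal_ne_top

/-- The square of the norm of `H^s(𝕋^d)`. -/
def hsSq (s : ℝ) (g : Torus d → ℂ) : ℝ≥0∞ := ∑' k, hsWeight s k * ‖torusCoeff g k‖ₑ ^ 2

theorem hsNorm_eq (s : ℝ) (g : Torus d → ℂ) : hsNorm s g = hsSq s g ^ (1 / 2 : ℝ) := by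
  unfold hsNorm hsSq hsWeight
  congr 1
  refine tsum_congr fun k => ?_
  rw [ENNReal.ofReal_mul (Real.rpow_nonneg (one_add_freqSq_pos k).le _),
    ENNReal.ofReal_pow (norm_nonneg _), ofReal_norm]

theorem hsNorm_sq (s : ℝ) (g : Torus d → ℂ) : hsNorm s g ^ (2 : ℝ) = hsSq s g := by
  rw [hsNorm_eq, ← ENNReal.rpow_mul]
  norm_num

theorem torusCoeff_add {f g : Torus d → ℂ} (hf : Integrable f) (hg : Integrable g)
    (k : Fin d → ℤ) : torusCoeff (fun y => f y + g y) k = torusCoeff f k + torusCoeff g k := by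
  have h : ∀ f : Torus d → ℂ, Integrable f → Integrable fun y => f y * torusChar (-k) y :=
    fun f hf => hf.mul_bdd (c := 1) (continuous_torusChar _).aestronglyMeasurable
      (Eventually.of_forall fun y => (norm_torusChar _ _).le)
  simp only [torusCoeff_eq, add_mul]
  rw [integral_add (h f hf) (h g hg), mul_add]

theorem torusCoeff_const_mul (c : ℂ) (f : Torus d → ℂ) (k : Fin d → ℤ) :
    torusCoeff (fun y => c * f y) k = c * torusCoeff f k := by
  simp only [torusCoeff_eq, mul_assoc]
  rw [integral_const_mul]
  ring

theorem torusCoeff_neg (f : Torus d → ℂ) (k : Fin d → ℤ) :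
    torusCoeff (fun y => -f y) k = -torusCoeff f k := by
  simpa using torusCoeff_const_mul (-1) f k

theorem torusCoeff_sub {f g : Torus d → ℂ} (hf : Integrable f) (hg : Integrable g)
    (k : Fin d → ℤ) : torusCoeff (fun y => f y - g y) k = torusCoeff f k - torusCoeff g k := by
  simp only [sub_eq_add_neg]
  rw [torusCoeff_add (g := fun y => -g y) hf hg.neg, torusCoeff_neg]

theorem torusCoeff_conj (f : Torus d → ℂ) (k : Fin d → ℤ) :
    torusCoeff (fun y => conj (f y)) k = conj (torusCoeff f (-k)) := by
  rw [torusCoeff_eq, torusCoeff_eq, map_mul, Complex.conj_ofReal, ← integral_conj]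
  simp only [map_mul, conj_torusChar, neg_neg]

theorem torusCoeff_congr_ae {f g : Torus d → ℂ} (h : f =ᵐ[volume] g) (k : Fin d → ℤ) :
    torusCoeff f k = torusCoeff g k := by
  rw [torusCoeff_eq, torusCoeff_eq]
  congr 1
  apply integral_congr_ae
  filter_upwards [h] with y hy
  rw [hy]

theorem hsSq_conj (s : ℝ) (g : Torus d → ℂ) : hsSq s (fun y => conj (g y)) = hsSq s g := by
  unfold hsSq
  rw [← (Equiv.neg (Fin d → ℤ)).tsum_eq]
  refine tsum_congr fun k => ?_
  rw [Equiv.neg_apply, hsWeight_neg, torusCoeff_conj, neg_neg]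
  simp [← ofReal_norm]

theorem hsSq_neg (s : ℝ) (g : Torus d → ℂ) : hsSq s (fun y => -g y) = hsSq s g := by
  simp [hsSq, torusCoeff_neg]

theorem hsSq_const_mul (s : ℝ) (c : ℂ) (g : Torus d → ℂ) :
    hsSq s (fun y => c * g y) = ‖c‖ₑ ^ 2 * hsSq s g := by
  unfold hsSq
  rw [← ENNReal.tsum_mul_left]
  refine tsum_congr fun k => ?_
  rw [torusCoeff_const_mul, enorm_mul, mul_pow]
  ring

theorem enorm_add_sq_le (a b : ℂ) : ‖a + b‖ₑ ^ 2 ≤ 2 * (‖a‖ₑ ^ 2 + ‖b‖ₑ ^ 2) := by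
  simp only [← ofReal_norm]
  rw [← ENNReal.ofReal_pow (norm_nonneg _), ← ENNReal.ofReal_pow (norm_nonneg _),
    ← ENNReal.ofReal_pow (norm_nonneg _), ← ENNReal.ofReal_add (by positivity) (by positivity),
    ← ENNReal.ofReal_ofNat, ← ENNReal.ofReal_mul (by norm_num)]
  apply ENNReal.ofReal_le_ofReal
  have := norm_add_le a b
  nlinarith [norm_nonneg (a + b), norm_nonneg a, norm_nonneg b, sq_nonneg (‖a‖ - ‖b‖)]

theorem hsSq_add_le (s : ℝ) {f g : Torus d → ℂ} (hf : Integrable f) (hg : Integrable g) :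
    hsSq s (fun y => f y + g y) ≤ 2 * (hsSq s f + hsSq s g) := by
  unfold hsSq
  rw [← ENNReal.tsum_add, ← ENNReal.tsum_mul_left]
  refine ENNReal.tsum_le_tsum fun k => ?_
  rw [torusCoeff_add hf hg, ← mul_add, mul_left_comm]
  gcongr
  exact enorm_add_sq_le _ _

theorem Continuous.memLp_torus {g : Torus d → ℂ} (hg : Continuous g) (p : ℝ≥0∞) :
    MemLp g p volume := by
  obtain ⟨C, hC⟩ := isCompact_univ.exists_bound_of_continuousOn hg.continuousOn
  exact MemLp.of_bound hg.aestronglyMeasurable C (Eventually.of_forall fun y => hC y (Set.mem_univ y))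

theorem Continuous.integrable_torus {g : Torus d → ℂ} (hg : Continuous g) : Integrable g :=
  memLp_one_iff_integrable.mp (Continuous.memLp_torus hg 1)

/-- Polarized Parseval, applied to the conjugate of `g` and to `h e^{-i ⟨k, ·⟩}` whose coefficients
are those of `h` shifted by `k`, gives the discrete convolution; the triangle inequality does the
rest. -/
theorem enorm_torusCoeff_mul_le {g h : Torus d → ℂ} (hg : Continuous g) (hh : Continuous h)
    (k : Fin d → ℤ) : ‖torusCoeff (fun y => g y * h y) k‖ₑ
      ≤ ENNReal.ofReal (torusConst d) * ∑' j, ‖torusCoeff g j‖ₑ * ‖torusCoeff h (k - j)‖ₑ := by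
  have h1 := hasSum_conj_torusCoeff_mul (f := fun y => conj (g y))
    (g := fun y => h y * torusChar (-k) y)
    (Continuous.memLp_torus (Complex.continuous_conj.comp hg) 2)
    (Continuous.memLp_torus (hh.mul (continuous_torusChar _)) 2)
  have h2 : torusCoeff (fun y => g y * h y) k
      = (torusConst d : ℂ) * ∫ y, conj (conj (g y)) * (h y * torusChar (-k) y) := by
    rw [torusCoeff_eq]
    simp only [RingHomCompTriple.comp_apply, RingHom.id_apply, mul_assoc]
  rw [h2, ← h1.tsum_eq, enorm_mul]
  have h3 : ∀ i, conj (torusCoeff (fun y => conj (g y)) i)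
      * torusCoeff (fun y => h y * torusChar (-k) y) i
      = torusCoeff g (-i) * torusCoeff h (k - -i) := by
    intro i
    rw [torusCoeff_conj, Complex.conj_conj]
    congr 1
    rw [torusCoeff_eq, torusCoeff_eq]
    congr 2
    ext y
    rw [mul_assoc, ← torusChar_add]
    congr 2
    abel
  simp only [h3]
  gcongr
  · simp [← ofReal_norm, abs_of_pos (torusConst_pos d)]
  · refine (enorm_tsum_le_tsum_enorm (ε := ℂ)).trans (le_of_eq ?_)
    simp only [enorm_mul]
    exact (Equiv.neg (Fin d → ℤ)).tsum_eq fun j => ‖torusCoeff g j‖ₑ * ‖torusCoeff h (k - j)‖ₑ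

/-- The constant in the algebra property of `H^α`. -/
def algConst (d : ℕ) (α : ℝ) : ℝ≥0∞ :=
  ENNReal.ofReal (torusConst d) ^ 2
    * (ENNReal.ofReal (4 ^ α) * (2 * ∑' k : Fin d → ℤ, (hsWeight α k)⁻¹))

theorem algConst_ne_top (hd : 1 ≤ d) {α : ℝ} (hα : (d : ℝ) / 2 < α) : algConst d α ≠ ⊤ :=
  ENNReal.mul_ne_top (ENNReal.pow_ne_top ENNReal.ofReal_ne_top)
    (ENNReal.mul_ne_top ENNReal.ofReal_ne_top
      (ENNReal.mul_ne_top (by norm_num) (tsum_hsWeight_inv_ne_top hd hα)))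

/-- The algebra property of `H^α(𝕋^d)` for `α > d / 2`. -/
theorem hsSq_mul_le {α : ℝ} (hα : 0 ≤ α) {g h : Torus d → ℂ}
    (hg : Continuous g) (hh : Continuous h) :
    hsSq α (fun y => g y * h y) ≤ algConst d α * (hsSq α g * hsSq α h) := by
  set S : ℝ≥0∞ := ∑' k : Fin d → ℤ, (hsWeight α k)⁻¹ with hS
  have hk : ∀ k : Fin d → ℤ, hsWeight α k * ‖torusCoeff (fun y => g y * h y) k‖ₑ ^ 2
      ≤ algConst d α * ∑' j, (hsWeight α j * ‖torusCoeff g j‖ₑ ^ 2)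
        * (hsWeight α (k - j) * ‖torusCoeff h (k - j)‖ₑ ^ 2) := by
    intro k
    have h1 := tsum_sq_le_weight (u := fun j => hsWeight α j * hsWeight α (k - j))
      (a := fun j => ‖torusCoeff g j‖ₑ * ‖torusCoeff h (k - j)‖ₑ)
      (fun j => mul_ne_zero (hsWeight_ne_zero _ _) (hsWeight_ne_zero _ _))
      (fun j => ENNReal.mul_ne_top (hsWeight_ne_top _ _) (hsWeight_ne_top _ _))
    -- This bound is uniform in `k`: dividing `hsWeight_le` by the product of the weights at `j` and
    -- `k - j` leaves the sum of their inverses, and each of these sums over `j` to `S`.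
    have h2 : hsWeight α k * ∑' j, (hsWeight α j * hsWeight α (k - j))⁻¹
        ≤ ENNReal.ofReal (4 ^ α) * (2 * S) := by
      have e : S = ∑' j, (hsWeight α (k - j))⁻¹ :=
        (Equiv.tsum_eq (Equiv.subLeft k) fun j => (hsWeight α j)⁻¹).symm
      calc hsWeight α k * ∑' j, (hsWeight α j * hsWeight α (k - j))⁻¹
          = ∑' j, hsWeight α k * (hsWeight α j * hsWeight α (k - j))⁻¹ :=
            ENNReal.tsum_mul_left.symm
        _ ≤ ∑' j, ENNReal.ofReal (4 ^ α) * ((hsWeight α j)⁻¹ + (hsWeight α (k - j))⁻¹) := by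
            refine ENNReal.tsum_le_tsum fun j => ?_
            have ha := hsWeight_ne_zero α j
            have hb := hsWeight_ne_zero α (k - j)
            have ha' := hsWeight_ne_top α j
            have hb' := hsWeight_ne_top α (k - j)
            refine (mul_le_mul_left (hsWeight_le hα k j) _).trans (le_of_eq ?_)
            rw [mul_assoc]
            congr 1
            rw [ENNReal.mul_inv (Or.inl ha) (Or.inl ha'), add_mul, ← mul_assoc,
              ENNReal.mul_inv_cancel ha ha', one_mul, mul_left_comm,
              ENNReal.mul_inv_cancel hb hb', mul_one, add_comm]
        _ = ENNReal.ofReal (4 ^ α) * (2 * S) := by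
            rw [ENNReal.tsum_mul_left, ENNReal.tsum_add, ← e, two_mul]
    calc hsWeight α k * ‖torusCoeff (fun y => g y * h y) k‖ₑ ^ 2
        ≤ hsWeight α k * (ENNReal.ofReal (torusConst d)
          * ∑' j, ‖torusCoeff g j‖ₑ * ‖torusCoeff h (k - j)‖ₑ) ^ 2 := by
          gcongr
          exact enorm_torusCoeff_mul_le hg hh k
      _ ≤ hsWeight α k * (ENNReal.ofReal (torusConst d) ^ 2
          * ((∑' j, (hsWeight α j * hsWeight α (k - j))⁻¹)
            * ∑' j, hsWeight α j * hsWeight α (k - j)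
              * (‖torusCoeff g j‖ₑ * ‖torusCoeff h (k - j)‖ₑ) ^ 2)) := by
          rw [mul_pow]
          gcongr
      _ = ENNReal.ofReal (torusConst d) ^ 2
          * (hsWeight α k * (∑' j, (hsWeight α j * hsWeight α (k - j))⁻¹))
            * ∑' j, hsWeight α j * hsWeight α (k - j)
              * (‖torusCoeff g j‖ₑ * ‖torusCoeff h (k - j)‖ₑ) ^ 2 := by ring
      _ ≤ algConst d α * ∑' j, hsWeight α j * hsWeight α (k - j)
              * (‖torusCoeff g j‖ₑ * ‖torusCoeff h (k - j)‖ₑ) ^ 2 := by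
          unfold algConst
          gcongr
      _ = _ := by
          congr 1
          refine tsum_congr fun j => ?_
          ring
  refine (ENNReal.tsum_le_tsum hk).trans (le_of_eq ?_)
  -- With the sum over `k` performed first, the shifted series is the full norm of `h` for every
  -- `j`, and the double sum factors.
  rw [ENNReal.tsum_mul_left, ENNReal.tsum_comm]
  congr 1
  simp only [ENNReal.tsum_mul_left]
  have e : ∀ j, ∑' k : Fin d → ℤ, hsWeight α (k - j) * ‖torusCoeff h (k - j)‖ₑ ^ 2 = hsSq α h :=
    fun j => Equiv.tsum_eq (Equiv.subRight j) fun k => hsWeight α k * ‖torusCoeff h k‖ₑ ^ 2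
  simp only [e]
  rw [ENNReal.tsum_mul_right]
  rfl

theorem cubic_eq (z : ℂ) : cubic z = z * z * conj z := by
  rw [cubic, mul_assoc, Complex.mul_conj']
  push_cast
  ring

theorem continuous_cubic : Continuous cubic := by
  unfold cubic
  fun_prop

/-- Every term is a product of three functions, one of which is the difference or its conjugate. The
same identity serves the pointwise Lipschitz bound and the one in `H^α`. -/
theorem cubic_sub_cubic (a b : ℂ) :
    cubic a - cubic b = (a - b) * (a * conj a) + (b * (a - b) * conj a
      + b * b * conj (a - b)) := by
  rw [cubic_eq, cubic_eq, map_sub]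
  ring

theorem norm_cubic (z : ℂ) : ‖cubic z‖ = ‖z‖ ^ 3 := by
  rw [cubic, norm_mul, Complex.norm_real, Real.norm_of_nonneg (by positivity)]
  ring

theorem norm_cubic_sub_le (a b : ℂ) {M : ℝ} (ha : ‖a‖ ≤ M) (hb : ‖b‖ ≤ M) :
    ‖cubic a - cubic b‖ ≤ 3 * M ^ 2 * ‖a - b‖ := by
  have hM : 0 ≤ M := (norm_nonneg a).trans ha
  have h1 : ‖a‖ * ‖a‖ ≤ M * M := mul_le_mul ha ha (norm_nonneg _) hM
  have h2 : ‖b‖ * ‖a‖ ≤ M * M := mul_le_mul hb ha (norm_nonneg _) hM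
  have h3 : ‖b‖ * ‖b‖ ≤ M * M := mul_le_mul hb hb (norm_nonneg _) hM
  rw [cubic_sub_cubic]
  calc _ ≤ ‖(a - b) * (a * conj a)‖ + (‖b * (a - b) * conj a‖ + ‖b * b * conj (a - b)‖) :=
        (norm_add_le _ _).trans (by gcongr; exact norm_add_le _ _)
    _ = (‖a‖ * ‖a‖ + (‖b‖ * ‖a‖ + ‖b‖ * ‖b‖)) * ‖a - b‖ := by
        simp only [norm_mul, RCLike.norm_conj]
        ring
    _ ≤ _ := by
        refine mul_le_mul_of_nonneg_right ?_ (norm_nonneg _)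
        linarith

/-- The cubic nonlinearity is locally Lipschitz in `H^α(𝕋^d)`. -/
theorem hsSq_cubic_sub_le {α : ℝ} (hα : 0 ≤ α) {g h : Torus d → ℂ}
    (hg : Continuous g) (hh : Continuous h) {M : ℝ≥0∞} (hgM : hsSq α g ≤ M) (hhM : hsSq α h ≤ M) :
    hsSq α (fun y => cubic (g y) - cubic (h y))
      ≤ 10 * algConst d α ^ 2 * M ^ 2 * hsSq α (fun y => g y - h y) := by
  simp only [cubic_sub_cubic]
  set A := algConst d α
  set D := hsSq α (fun y => g y - h y) with hD
  have cg : Continuous fun y => conj (g y) := Complex.continuous_conj.comp hg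
  have cgh : Continuous fun y => g y - h y := hg.sub hh
  have ccgh : Continuous fun y => conj (g y - h y) := Complex.continuous_conj.comp cgh
  have i1 : hsSq α (fun y => (g y - h y) * (g y * conj (g y))) ≤ A ^ 2 * M ^ 2 * D :=
    calc _ ≤ A * (D * (A * (hsSq α g * hsSq α fun y => conj (g y)))) := by
          refine (hsSq_mul_le hα cgh (hg.mul cg)).trans ?_
          gcongr
          exact hsSq_mul_le hα hg cg
      _ ≤ A * (D * (A * (M * M))) := by
          rw [hsSq_conj]
          gcongr
      _ = _ := by ring
  have i2 : hsSq α (fun y => h y * (g y - h y) * conj (g y)) ≤ A ^ 2 * M ^ 2 * D :=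
    calc _ ≤ A * ((A * (hsSq α h * D)) * hsSq α fun y => conj (g y)) := by
          refine (hsSq_mul_le hα (hh.mul cgh) cg).trans ?_
          gcongr
          exact hsSq_mul_le hα hh cgh
      _ ≤ A * ((A * (M * D)) * M) := by
          rw [hsSq_conj]
          gcongr
      _ = _ := by ring
  have i3 : hsSq α (fun y => h y * h y * conj (g y - h y)) ≤ A ^ 2 * M ^ 2 * D :=
    calc _ ≤ A * ((A * (hsSq α h * hsSq α h)) * hsSq α fun y => conj (g y - h y)) := by
          refine (hsSq_mul_le hα (hh.mul hh) ccgh).trans ?_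
          gcongr
          exact hsSq_mul_le hα hh hh
      _ ≤ A * ((A * (M * M)) * D) := by
          rw [hsSq_conj]
          gcongr
      _ = _ := by ring
  have I1 : Integrable fun y => (g y - h y) * (g y * conj (g y)) :=
    Continuous.integrable_torus (cgh.mul (hg.mul cg))
  have I2 : Integrable fun y => h y * (g y - h y) * conj (g y) :=
    Continuous.integrable_torus ((hh.mul cgh).mul cg)
  have I3 : Integrable fun y => h y * h y * conj (g y - h y) :=
    Continuous.integrable_torus ((hh.mul hh).mul ccgh)
  -- Two uses of `‖a + b‖² ≤ 2 (‖a‖² + ‖b‖²)` on three equal bounds give `2 (1 + 2 (1 + 1)) = 10`.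
  calc _ ≤ 2 * (A ^ 2 * M ^ 2 * D + 2 * (A ^ 2 * M ^ 2 * D + A ^ 2 * M ^ 2 * D)) := by
        refine (hsSq_add_le α I1 (I2.add I3)).trans ?_
        refine mul_le_mul_right (add_le_add i1 ?_) _
        refine (hsSq_add_le α I2 I3).trans ?_
        gcongr
    _ = _ := by ring

end NLSCylinder
end

/-! ### Weak derivatives on the line and one-dimensional interpolation inequalities. -/

noncomputable section

namespace NLSCylinder

open Set

theorem IsTest.isTest_deriv {φ : ℝ → ℂ} (h : IsTest φ) : IsTest (deriv φ) :=
  ⟨(contDiff_infty_iff_deriv.mp h.1).2, h.2.deriv⟩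

theorem IsTest.continuous {φ : ℝ → ℂ} (h : IsTest φ) : Continuous φ := h.1.continuous

theorem IsTest.hasDerivAt {φ : ℝ → ℂ} (h : IsTest φ) (x : ℝ) : HasDerivAt φ (deriv φ x) x :=
  ((h.1.differentiable (by simp)) x).hasDerivAt

theorem IsTest.integrable {φ : ℝ → ℂ} (h : IsTest φ) : Integrable φ :=
  h.continuous.integrable_of_hasCompactSupport h.2

theorem IsTest.exists_bound {φ : ℝ → ℂ} (h : IsTest φ) :
    ∃ R : ℝ, 0 < R ∧ ∀ x, R ≤ |x| → φ x = 0 := by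
  obtain ⟨R, hR⟩ := h.2.isBounded.subset_closedBall 0
  refine ⟨max R 0 + 1, by positivity, fun x hx => ?_⟩
  by_contra hne
  have h1 := hR (subset_tsupport φ hne)
  rw [mem_closedBall_zero_iff, Real.norm_eq_abs] at h1
  linarith [le_max_left R 0]

/-- For `g` merely locally integrable, integration by parts is Fubini's theorem on the triangle `s ≤
v` in a square containing the supports, together with `∫_s^b φ' = -φ(s)`. -/
theorem integral_primitive_mul_deriv {g : ℝ → ℂ} (hg : LocallyIntegrable g) {φ : ℝ → ℂ}
    (hφ : IsTest φ) :
    ∫ v, (∫ s in (0 : ℝ)..v, g s) * deriv φ v = -∫ v, g v * φ v := by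
  obtain ⟨R, hR0, hR⟩ := hφ.exists_bound
  obtain ⟨R', -, hR'⟩ := hφ.isTest_deriv.exists_bound
  set b := max R R' with hb
  have hb0 : 0 < b := lt_max_of_lt_left hR0
  have hab : -b ≤ b := by linarith
  have z1 : ∀ x, b ≤ |x| → φ x = 0 := fun x hx => hR x ((le_max_left _ _).trans hx)
  have z2 : ∀ x, b ≤ |x| → deriv φ x = 0 := fun x hx => hR' x ((le_max_right _ _).trans hx)
  have hi : ∀ x y : ℝ, IntervalIntegrable g volume x y := fun x y =>
    (hg.integrableOn_isCompact isCompact_uIcc).intervalIntegrable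
  have hsupp : ∀ f : ℝ → ℂ, (∀ x, b ≤ |x| → f x = 0) → ∫ v, f v = ∫ v in (-b)..b, f v := by
    intro f hf
    refine (intervalIntegral.integral_eq_integral_of_support_subset fun x hx => ?_).symm
    by_contra h
    refine hx (hf x ?_)
    rw [mem_Ioc, not_and_or, not_lt, not_le] at h
    rcases h with h | h
    · rw [abs_of_nonpos (by linarith)]
      linarith
    · exact h.le.trans (le_abs_self x)
  have hφ'i : IntervalIntegrable (deriv φ) volume (-b) b := hφ.isTest_deriv.continuous.intervalIntegrable _ _
  have hftc : ∀ s, ∫ v in s..b, deriv φ v = -φ s := by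
    intro s
    rw [intervalIntegral.integral_eq_sub_of_hasDerivAt (fun x _ => hφ.hasDerivAt x)
      (hφ.isTest_deriv.continuous.intervalIntegrable _ _), z1 b (le_abs_self b), zero_sub]
  have hcont : Continuous fun v => ∫ s in (-b)..v, g s :=
    intervalIntegral.continuous_primitive hi _
  rw [hsupp _ (fun x hx => by rw [z2 x hx, mul_zero]),
    hsupp (fun v => g v * φ v) (fun x hx => by rw [z1 x hx, mul_zero])]
  -- Moving the base point of the primitive from `0` to `-b` adds a constant, which integrates to
  -- zero against `φ'`.
  have e1 : ∫ v in (-b)..b, (∫ s in (0 : ℝ)..v, g s) * deriv φ v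
      = ∫ v in (-b)..b, (∫ s in (-b)..v, g s) * deriv φ v := by
    have : ∀ v, (∫ s in (0 : ℝ)..v, g s) * deriv φ v
        = (∫ s in (0 : ℝ)..(-b), g s) * deriv φ v + (∫ s in (-b)..v, g s) * deriv φ v := by
      intro v
      rw [← add_mul, intervalIntegral.integral_add_adjacent_intervals (hi _ _) (hi _ _)]
    simp_rw [this]
    have hcd : IntervalIntegrable (fun v => (∫ s in (-b)..v, g s) * deriv φ v) volume (-b) b :=
      Continuous.intervalIntegrable (hcont.mul hφ.isTest_deriv.continuous) _ _
    rw [intervalIntegral.integral_add (hφ'i.const_mul _) hcd,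
      intervalIntegral.integral_const_mul, hftc, z1 (-b) (by rw [abs_neg]; exact le_abs_self b)]
    simp
  rw [e1, intervalIntegral.integral_of_le hab, intervalIntegral.integral_of_le hab]
  set μ := volume.restrict (Ioc (-b) b)
  have hint : Integrable (Function.uncurry fun v s : ℝ =>
      ({p : ℝ × ℝ | p.2 ≤ p.1}).indicator (fun p => deriv φ p.1 * g p.2) (v, s)) (μ.prod μ) := by
    have : Integrable (fun p : ℝ × ℝ => deriv φ p.1 * g p.2) (μ.prod μ) :=
      Integrable.mul_prod hφ.isTest_deriv.integrable.restrict
        ((intervalIntegrable_iff_integrableOn_Ioc_of_le hab).mp (hi _ _))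
    exact this.indicator (measurableSet_le measurable_snd measurable_fst)
  have hswap := integral_integral_swap hint
  have L : ∀ v ∈ Ioc (-b) b, (∫ s, ({p : ℝ × ℝ | p.2 ≤ p.1}).indicator
      (fun p => deriv φ p.1 * g p.2) (v, s) ∂μ) = (∫ s in (-b)..v, g s) * deriv φ v := by
    intro v hv
    have : ∀ s, ({p : ℝ × ℝ | p.2 ≤ p.1}).indicator (fun p => deriv φ p.1 * g p.2) (v, s)
        = (Iic v).indicator (fun s => deriv φ v * g s) s := fun s => rfl
    simp_rw [this]
    rw [setIntegral_indicator measurableSet_Iic, Ioc_inter_Iic, min_eq_right hv.2,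
      integral_const_mul, intervalIntegral.integral_of_le hv.1.le, mul_comm]
  have Rr : ∀ s ∈ Ioc (-b) b, (∫ v, ({p : ℝ × ℝ | p.2 ≤ p.1}).indicator
      (fun p => deriv φ p.1 * g p.2) (v, s) ∂μ) = -(g s * φ s) := by
    intro s hs
    have : ∀ v, ({p : ℝ × ℝ | p.2 ≤ p.1}).indicator (fun p => deriv φ p.1 * g p.2) (v, s)
        = (Ici s).indicator (fun v => deriv φ v * g s) v := fun v => rfl
    simp_rw [this]
    have hset : Ioc (-b) b ∩ Ici s = Icc s b := by
      ext x
      simp only [mem_inter_iff, mem_Ioc, mem_Ici, mem_Icc]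
      constructor
      · rintro ⟨⟨_, h2⟩, h3⟩
        exact ⟨h3, h2⟩
      · rintro ⟨h1, h2⟩
        exact ⟨⟨hs.1.trans_le h1, h2⟩, h1⟩
    rw [setIntegral_indicator measurableSet_Ici, hset, integral_Icc_eq_integral_Ioc,
      integral_mul_const, ← intervalIntegral.integral_of_le hs.2, hftc]
    ring
  rw [setIntegral_congr_fun measurableSet_Ioc L, setIntegral_congr_fun measurableSet_Ioc Rr] at hswap
  rw [hswap, integral_neg]

/-- A test function with vanishing integral is the derivative of a test function. -/
theorem IsTest.exists_primitive {ψ : ℝ → ℂ} (hψ : IsTest ψ) (h0 : ∫ x, ψ x = 0) :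
    ∃ φ, IsTest φ ∧ deriv φ = ψ := by
  obtain ⟨R, hR0, hR⟩ := hψ.exists_bound
  have hd : ∀ x, HasDerivAt (fun x => ∫ s in (-R)..x, ψ s) (ψ x) x := fun x =>
    intervalIntegral.integral_hasDerivAt_right (hψ.continuous.intervalIntegrable _ _)
      hψ.continuous.stronglyMeasurable.stronglyMeasurableAtFilter hψ.continuous.continuousAt
  have hde : deriv (fun x => ∫ s in (-R)..x, ψ s) = ψ := funext fun x => (hd x).deriv
  refine ⟨fun x => ∫ s in (-R)..x, ψ s, ⟨?_, ?_⟩, hde⟩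
  · rw [contDiff_infty_iff_deriv, hde]
    exact ⟨fun x => (hd x).differentiableAt, hψ.1⟩
  · refine HasCompactSupport.intro (isCompact_Icc (a := -R) (b := R)) fun x hx => ?_
    rw [mem_Icc, not_and_or, not_le, not_le] at hx
    rcases hx with hx | hx
    · rw [intervalIntegral.integral_symm, intervalIntegral.integral_of_le hx.le,
        setIntegral_eq_zero_of_forall_eq_zero, neg_zero]
      intro s hs
      refine hR s ?_
      rw [abs_of_nonpos (by linarith [hs.2])]
      linarith [hs.2]
    · rw [intervalIntegral.integral_eq_integral_of_support_subset, h0]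
      intro s hs
      by_contra h
      refine hs (hR s ?_)
      rw [mem_Ioc, not_and_or, not_lt, not_le] at h
      rcases h with h | h
      · rw [abs_of_nonpos (by linarith)]
        linarith
      · exact (hx.trans h).le.trans (le_abs_self s)

theorem isTest_ofReal {g : ℝ → ℝ} (h1 : ContDiff ℝ (⊤ : ℕ∞) g) (h2 : HasCompactSupport g) :
    IsTest fun x => (g x : ℂ) :=
  ⟨Complex.ofRealCLM.contDiff.comp h1, h2.comp_left Complex.ofReal_zero⟩

/-- A function with vanishing weak derivative is constant. -/
theorem ae_const_of_integral_mul_deriv_eq_zero {h : ℝ → ℂ} (hh : LocallyIntegrable h)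
    (h0 : ∀ φ, IsTest φ → ∫ x, h x * deriv φ x = 0) : ∃ c : ℂ, h =ᵐ[volume] fun _ => c := by
  let ρ₀ : ContDiffBump (0 : ℝ) := default
  set ρ : ℝ → ℂ := fun x => ((ρ₀.normed volume x : ℝ) : ℂ) with hρ
  have hρt : IsTest ρ := isTest_ofReal ρ₀.contDiff_normed ρ₀.hasCompactSupport_normed
  have hρ1 : ∫ x, ρ x = 1 := by
    rw [hρ, integral_complex_ofReal, ρ₀.integral_normed, Complex.ofReal_one]
  have hint : ∀ φ, IsTest φ → Integrable fun x => h x * φ x := fun φ hφ => by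
    simpa [mul_comm] using hh.integrable_smul_left_of_hasCompactSupport hφ.continuous hφ.2
  set c := ∫ x, h x * ρ x with hc
  refine ⟨c, ?_⟩
  refine ae_eq_of_integral_contDiff_smul_eq hh (locallyIntegrable_const c) fun g hg1 hg2 => ?_
  have hgt := isTest_ofReal hg1 hg2
  set I : ℂ := ∫ x, (g x : ℂ) with hI
  -- Subtracting the multiple of the bump `ρ` with the same integral makes the test function a
  -- derivative, on which `h` vanishes by hypothesis. Hence `∫ h g = c ∫ g` with `c = ∫ h ρ`.
  set ψ : ℝ → ℂ := fun x => (g x : ℂ) - I * ρ x with hψ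
  have hψt : IsTest ψ := ⟨hgt.1.sub (contDiff_const.mul hρt.1), hgt.2.sub hρt.2.mul_left⟩
  have hψ0 : ∫ x, ψ x = 0 := by
    rw [hψ, integral_sub hgt.integrable (hρt.integrable.const_mul I), integral_const_mul, hρ1]
    simp [hI]
  obtain ⟨φ, hφ, hφd⟩ := hψt.exists_primitive hψ0
  have h1 := h0 φ hφ
  rw [hφd, hψ] at h1
  have e : ∀ x, h x * ((g x : ℂ) - I * ρ x) = h x * (g x : ℂ) - I * (h x * ρ x) := fun x => by ring
  simp_rw [e] at h1
  rw [integral_sub (hint _ hgt) ((hint _ hρt).const_mul _), integral_const_mul, sub_eq_zero] at h1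
  simp only [Complex.real_smul]
  rw [integral_mul_const, ← hI, ← h1]
  simp only [mul_comm]

/-- A function with a locally integrable weak derivative has a continuous representative, which is
the primitive of this derivative. -/
theorem exists_primitive_of_weak_deriv {f g : ℝ → ℂ} (hf : LocallyIntegrable f)
    (hg : LocallyIntegrable g)
    (h : ∀ φ, IsTest φ → ∫ x, g x * φ x = -∫ x, f x * deriv φ x) :
    ∃ F : ℝ → ℂ, Continuous F ∧ f =ᵐ[volume] F ∧ ∀ v v', F v - F v' = ∫ s in v'..v, g s := by
  have hi : ∀ x y : ℝ, IntervalIntegrable g volume x y := fun x y =>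
    (hg.integrableOn_isCompact isCompact_uIcc).intervalIntegrable
  have hcont : Continuous fun v => ∫ s in (0 : ℝ)..v, g s :=
    intervalIntegral.continuous_primitive hi _
  have hint : ∀ φ, IsTest φ → ∀ f : ℝ → ℂ, LocallyIntegrable f → Integrable fun x => f x * φ x :=
    fun φ hφ f hf => by
      simpa [mul_comm] using hf.integrable_smul_left_of_hasCompactSupport hφ.continuous hφ.2
  obtain ⟨c, hc⟩ := ae_const_of_integral_mul_deriv_eq_zero
    (h := fun v => f v - ∫ s in (0 : ℝ)..v, g s) (hf.sub hcont.locallyIntegrable) fun φ hφ => by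
      simp only [sub_mul]
      rw [integral_sub (hint _ hφ.isTest_deriv _ hf) (hint _ hφ.isTest_deriv _ hcont.locallyIntegrable),
        integral_primitive_mul_deriv hg hφ, h φ hφ]
      ring
  refine ⟨fun v => c + ∫ s in (0 : ℝ)..v, g s, continuous_const.add hcont, ?_, fun v v' => ?_⟩
  · filter_upwards [hc] with v hv
    rw [← hv]
    ring
  · rw [add_sub_add_left_eq_sub, intervalIntegral.integral_interval_sub_left (hi _ _) (hi _ _)]

theorem enorm_integral_sq_le {g : ℝ → ℂ} (hg : AEStronglyMeasurable g) (a b : ℝ) :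
    ‖∫ s in a..b, g s‖ₑ ^ 2 ≤ ENNReal.ofReal |b - a| * ∫⁻ s, ‖g s‖ₑ ^ 2 := by
  have h1 : ‖∫ s in a..b, g s‖ₑ ≤ ∫⁻ s in uIoc a b, 1 * ‖g s‖ₑ := by
    rw [← ofReal_norm, intervalIntegral.norm_intervalIntegral_eq, ofReal_norm]
    simpa using enorm_integral_le_lintegral_enorm _
  calc ‖∫ s in a..b, g s‖ₑ ^ 2 ≤ (∫⁻ s in uIoc a b, 1 * ‖g s‖ₑ) ^ 2 := by gcongr
    _ ≤ (∫⁻ s in uIoc a b, 1 ^ 2) * ∫⁻ s in uIoc a b, ‖g s‖ₑ ^ 2 :=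
        lintegral_mul_sq_le aemeasurable_const hg.enorm.restrict
    _ ≤ _ := by
        refine mul_le_mul' ?_ (setLIntegral_le_lintegral _ _)
        simp [uIoc, Real.volume_Ioc, max_sub_min_eq_abs]

theorem enorm_sub_sq_le {F g : ℝ → ℂ} (hg : AEStronglyMeasurable g)
    (h : ∀ v v', F v - F v' = ∫ s in v'..v, g s) (v v' : ℝ) :
    ‖F v - F v'‖ₑ ^ 2 ≤ ENNReal.ofReal |v - v'| * ∫⁻ s, ‖g s‖ₑ ^ 2 := by
  rw [h]
  exact enorm_integral_sq_le hg _ _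

/-- Choice of the length scale: `L = x / (4b)` balances the terms when `b > 0`. When `b = 0`, the
value `L = (2a + 1) / x` contradicts `x > 0`. -/
theorem sq_le_of_forall_le {x a b : ℝ} (hx : 0 ≤ x) (ha : 0 ≤ a) (hb : 0 ≤ b)
    (h : ∀ L : ℝ, 0 < L → L * x ≤ 2 * a + 2 * L ^ 2 * b) : x ^ 2 ≤ 16 * a * b := by
  by_contra hlt
  push Not at hlt
  have hx0 : 0 < x := by
    rcases hx.eq_or_lt with h0 | h0
    · rw [← h0] at hlt
      nlinarith [mul_nonneg ha hb]
    · exact h0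
  rcases hb.eq_or_lt with h0 | hb0
  · have := h ((2 * a + 1) / x) (by positivity)
    rw [div_mul_cancel₀ _ hx0.ne', ← h0] at this
    linarith
  · have := h (x / (4 * b)) (by positivity)
    have e1 : x / (4 * b) * x = x ^ 2 / (4 * b) := by ring
    have e2 : 2 * (x / (4 * b)) ^ 2 * b = x ^ 2 / (8 * b) := by
      field_simp
      ring
    rw [e1, e2] at this
    have e3 : x ^ 2 / (4 * b) = 2 * (x ^ 2 / (8 * b)) := by
      field_simp
      ring
    have e4 : x ^ 2 / (8 * b) ≤ 2 * a := by linarith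
    rw [div_le_iff₀ (by positivity)] at e4
    linarith

/-- The inequality `‖F‖_∞² ≤ 4 ‖F‖_{L²} ‖F'‖_{L²}`. -/
theorem enorm_pow_four_le {F g : ℝ → ℂ} (hF : Continuous F) (hg : AEStronglyMeasurable g)
    (h : ∀ v v', F v - F v' = ∫ s in v'..v, g s) (hA : ∫⁻ s, ‖F s‖ₑ ^ 2 ≠ ⊤)
    (hB : ∫⁻ s, ‖g s‖ₑ ^ 2 ≠ ⊤) (v : ℝ) :
    (‖F v‖ₑ ^ 2) ^ 2 ≤ 16 * (∫⁻ s, ‖F s‖ₑ ^ 2) * ∫⁻ s, ‖g s‖ₑ ^ 2 := by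
  set A := ∫⁻ s, ‖F s‖ₑ ^ 2
  set B := ∫⁻ s, ‖g s‖ₑ ^ 2
  -- Averaging over `s` in an interval of length `L` starting at `v`: `F(v)` is `F(s)` plus an
  -- increment whose square is at most `L B` by Cauchy–Schwarz. The length `L` is optimized
  -- afterwards.
  have key : ∀ L : ℝ, 0 < L →
      ENNReal.ofReal L * ‖F v‖ₑ ^ 2 ≤ 2 * A + 2 * ENNReal.ofReal L ^ 2 * B := by
    intro L hL
    calc ENNReal.ofReal L * ‖F v‖ₑ ^ 2 = ∫⁻ s in Ioc v (v + L), ‖F v‖ₑ ^ 2 := by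
          rw [setLIntegral_const, Real.volume_Ioc, add_sub_cancel_left, mul_comm]
      _ ≤ ∫⁻ s in Ioc v (v + L), (2 * ‖F s‖ₑ ^ 2 + 2 * (ENNReal.ofReal L * B)) := by
          refine setLIntegral_mono (by fun_prop) fun s hs => ?_
          have e : F v = F s + (F v - F s) := by ring
          rw [e, ← mul_add]
          refine (enorm_add_sq_le _ _).trans ?_
          gcongr
          refine (enorm_sub_sq_le hg h _ _).trans ?_
          gcongr
          rw [abs_of_nonpos (by linarith [hs.1])]
          linarith [hs.2]
      _ ≤ _ := by
          rw [lintegral_add_left (by fun_prop), setLIntegral_const, Real.volume_Ioc,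
            add_sub_cancel_left, lintegral_const_mul _ (by fun_prop)]
          refine add_le_add (by gcongr; exact setLIntegral_le_lintegral _ _) (le_of_eq (by ring))
  have hr := sq_le_of_forall_le (x := ‖F v‖ ^ 2) (a := A.toReal) (b := B.toReal) (by positivity)
    ENNReal.toReal_nonneg ENNReal.toReal_nonneg fun L hL => by
      have h1 := ENNReal.toReal_mono (by finiteness) (key L hL)
      rw [ENNReal.toReal_add (by finiteness) (by finiteness)] at h1
      simpa [ENNReal.toReal_mul, ENNReal.toReal_pow, hL.le] using h1
  have h2 := ENNReal.ofReal_le_ofReal hr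
  rw [ENNReal.ofReal_pow (by positivity), ENNReal.ofReal_pow (norm_nonneg _), ofReal_norm,
    ENNReal.ofReal_mul (by positivity), ENNReal.ofReal_mul (by positivity),
    ENNReal.ofReal_toReal hA, ENNReal.ofReal_toReal hB] at h2
  simpa using h2

/-- The interpolated Hölder bound `|F(v) - F(v')|⁶ ≤ 256 |v - v'| ‖F‖_{L²}² ‖F'‖_{L²}⁴`. -/
theorem enorm_sub_pow_six_le {F g : ℝ → ℂ} (hF : Continuous F) (hg : AEStronglyMeasurable g)
    (h : ∀ v v', F v - F v' = ∫ s in v'..v, g s) (hA : ∫⁻ s, ‖F s‖ₑ ^ 2 ≠ ⊤)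
    (hB : ∫⁻ s, ‖g s‖ₑ ^ 2 ≠ ⊤) (v v' : ℝ) :
    (‖F v - F v'‖ₑ ^ 2) ^ 3 ≤ 256 * ENNReal.ofReal |v - v'| *
      ((∫⁻ s, ‖F s‖ₑ ^ 2) * (∫⁻ s, ‖g s‖ₑ ^ 2) ^ 2) := by
  set A := ∫⁻ s, ‖F s‖ₑ ^ 2
  set B := ∫⁻ s, ‖g s‖ₑ ^ 2
  -- The increment is at most twice the larger of the two values, so its fourth power costs `16`
  -- times the constant `16` of the supremum bound.
  have h1 : (‖F v - F v'‖ₑ ^ 2) ^ 2 ≤ 256 * A * B := by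
    have e1 : ‖F v - F v'‖ₑ ^ 2 ≤ 2 * (‖F v‖ₑ ^ 2 + ‖F v'‖ₑ ^ 2) := by
      have := enorm_add_sq_le (F v) (-F v')
      rwa [enorm_neg, ← sub_eq_add_neg] at this
    rcases le_total (‖F v‖ₑ ^ 2) (‖F v'‖ₑ ^ 2) with hle | hle
    · calc (‖F v - F v'‖ₑ ^ 2) ^ 2 ≤ (2 * (‖F v'‖ₑ ^ 2 + ‖F v'‖ₑ ^ 2)) ^ 2 := by
            gcongr
            exact e1.trans (by gcongr)
        _ = 16 * (‖F v'‖ₑ ^ 2) ^ 2 := by ring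
        _ ≤ 16 * (16 * A * B) := by gcongr; exact enorm_pow_four_le hF hg h hA hB v'
        _ = _ := by ring
    · calc (‖F v - F v'‖ₑ ^ 2) ^ 2 ≤ (2 * (‖F v‖ₑ ^ 2 + ‖F v‖ₑ ^ 2)) ^ 2 := by
            gcongr
            exact e1.trans (by gcongr)
        _ = 16 * (‖F v‖ₑ ^ 2) ^ 2 := by ring
        _ ≤ 16 * (16 * A * B) := by gcongr; exact enorm_pow_four_le hF hg h hA hB v
        _ = _ := by ring
  -- One squared factor takes the Hölder-1/2 bound, linear in `|v - v'|`, and the other two take the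
  -- bound by the supremum.
  calc (‖F v - F v'‖ₑ ^ 2) ^ 3 = ‖F v - F v'‖ₑ ^ 2 * (‖F v - F v'‖ₑ ^ 2) ^ 2 := by ring
    _ ≤ (ENNReal.ofReal |v - v'| * B) * (256 * A * B) := by
        gcongr
        exact enorm_sub_sq_le hg h v v'
    _ = _ := by ring

/-- Translations are Lipschitz in `L²` on functions with derivative in `L²`. -/
theorem lintegral_enorm_sub_translate_le {F g : ℝ → ℂ} (hg : AEStronglyMeasurable g)
    (h : ∀ v v', F v - F v' = ∫ s in v'..v, g s) (z : ℝ) :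
    ∫⁻ v, ‖F v - F (v - z)‖ₑ ^ 2 ≤ ENNReal.ofReal (z ^ 2) * ∫⁻ s, ‖g s‖ₑ ^ 2 := by
  -- A strongly measurable representative keeps `(v, θ) ↦ g(v - z θ)` jointly measurable, as
  -- Tonelli's theorem requires below.
  set g' := hg.mk g with hg'
  have hgm : StronglyMeasurable g' := hg.stronglyMeasurable_mk
  have h' : ∀ v v', F v - F v' = ∫ s in v'..v, g' s := by
    intro v v'
    rw [h]
    exact intervalIntegral.integral_congr_ae (hg.ae_eq_mk.mono fun x hx _ => hx)
  have e0 : ∫⁻ s, ‖g s‖ₑ ^ 2 = ∫⁻ s, ‖g' s‖ₑ ^ 2 :=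
    lintegral_congr_ae (hg.ae_eq_mk.mono fun x hx => by simp only [hx, hg'])
  have hm : Measurable fun p : ℝ × ℝ => ‖g' (p.1 - z * p.2)‖ₑ ^ 2 :=
    (hgm.measurable.comp (by fun_prop)).enorm.pow_const 2
  -- The increment is `z` times the mean of `g(v - z θ)` over `θ ∈ [0, 1]`. After Cauchy–Schwarz in
  -- `θ` and integration in `v`, translation invariance removes `θ`.
  have key : ∀ v, ‖F v - F (v - z)‖ₑ ^ 2
      ≤ ENNReal.ofReal (z ^ 2) * ∫⁻ θ in Ioc (0 : ℝ) 1, ‖g' (v - z * θ)‖ₑ ^ 2 := by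
    intro v
    have e1 : F v - F (v - z) = z • ∫ θ in (0 : ℝ)..1, g' (v - z * θ) := by
      rw [intervalIntegral.smul_integral_comp_sub_mul, h']
      simp
    rw [e1, enorm_smul, mul_pow]
    gcongr
    · rw [← ofReal_norm, ← ENNReal.ofReal_pow (norm_nonneg _), Real.norm_eq_abs, sq_abs]
    · rw [intervalIntegral.integral_of_le zero_le_one]
      calc _ ≤ (∫⁻ θ in Ioc (0 : ℝ) 1, 1 * ‖g' (v - z * θ)‖ₑ) ^ 2 := by
            gcongr
            simpa using enorm_integral_le_lintegral_enorm _
        _ ≤ (∫⁻ θ in Ioc (0 : ℝ) 1, 1 ^ 2) * ∫⁻ θ in Ioc (0 : ℝ) 1, ‖g' (v - z * θ)‖ₑ ^ 2 :=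
            lintegral_mul_sq_le aemeasurable_const
              (hgm.measurable.comp (by fun_prop)).enorm.aemeasurable
        _ = _ := by simp
  calc ∫⁻ v, ‖F v - F (v - z)‖ₑ ^ 2
      ≤ ∫⁻ v, ENNReal.ofReal (z ^ 2) * ∫⁻ θ in Ioc (0 : ℝ) 1, ‖g' (v - z * θ)‖ₑ ^ 2 :=
        lintegral_mono key
    _ = ENNReal.ofReal (z ^ 2) * ∫⁻ θ in Ioc (0 : ℝ) 1, ∫⁻ v, ‖g' (v - z * θ)‖ₑ ^ 2 := by
        rw [lintegral_const_mul' _ _ ENNReal.ofReal_ne_top, lintegral_lintegral_swap]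
        exact hm.aemeasurable
    _ = _ := by
        congr 1
        have : ∀ θ : ℝ, ∫⁻ v, ‖g' (v - z * θ)‖ₑ ^ 2 = ∫⁻ s, ‖g' s‖ₑ ^ 2 := fun θ =>
          lintegral_sub_right_eq_self (fun v => ‖g' v‖ₑ ^ 2) (z * θ)
        simp [this, e0]

end NLSCylinder
end

/-! ### Functions on the cylinder mode by mode, and their regular representatives. -/

noncomputable section

namespace NLSCylinder

open Set

variable {d : ℕ}

/-- The square of the norm of `L²(ℝ × 𝕋^d)`. -/
def l2Sq (f : ℝ → Torus d → ℂ) : ℝ≥0∞ := ∫⁻ p : ℝ × Torus d, ‖f p.1 p.2‖ₑ ^ 2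

theorem l2Norm_eq (f : ℝ → Torus d → ℂ) : l2Norm f = l2Sq f ^ (1 / 2 : ℝ) := by
  rw [l2Norm, eLpNorm_eq_lintegral_rpow_enorm_toReal (by norm_num) (by norm_num), l2Sq]
  norm_num

theorem l2Norm_sq (f : ℝ → Torus d → ℂ) : l2Norm f ^ 2 = l2Sq f := by
  rw [l2Norm_eq, ← ENNReal.rpow_natCast, ← ENNReal.rpow_mul]
  norm_num

theorem InL2.l2Sq_ne_top {f : ℝ → Torus d → ℂ} (hf : InL2 f) : l2Sq f ≠ ⊤ := by
  rw [← l2Norm_sq]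
  exact ENNReal.pow_ne_top hf.2.ne

theorem l2Sq_eq_iterated {f : ℝ → Torus d → ℂ}
    (hf : AEStronglyMeasurable (fun p : ℝ × Torus d => f p.1 p.2)) :
    l2Sq f = ∫⁻ v, ∫⁻ y, ‖f v y‖ₑ ^ 2 := by
  rw [l2Sq, Measure.volume_eq_prod, lintegral_prod _ (hf.enorm.pow_const 2)]

theorem InL2.ae_memLp {f : ℝ → Torus d → ℂ} (hf : InL2 f) :
    ∀ᵐ v : ℝ, MemLp (f v) 2 volume := by
  have h1 : ∀ᵐ v : ℝ, AEStronglyMeasurable (f v) volume := AEStronglyMeasurable.prodMk_left hf.1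
  have h2 := hf.l2Sq_ne_top
  rw [l2Sq_eq_iterated hf.1] at h2
  have h3 := ae_lt_top' (hf.1.enorm.pow_const 2).lintegral_prod_right' h2
  filter_upwards [h1, h3] with v hv1 hv3
  refine ⟨hv1, ?_⟩
  rw [eLpNorm_lt_top_iff_lintegral_rpow_enorm_lt_top (by norm_num) (by norm_num)]
  simpa using hv3

theorem aestronglyMeasurable_torusCoeff {f : ℝ → Torus d → ℂ}
    (hf : AEStronglyMeasurable (fun p : ℝ × Torus d => f p.1 p.2)) (k : Fin d → ℤ) :
    AEStronglyMeasurable fun v => torusCoeff (f v) k := by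
  simp only [torusCoeff_eq]
  refine AEStronglyMeasurable.const_mul ?_ _
  exact (hf.mul ((continuous_torusChar (-k)).comp
    continuous_snd).aestronglyMeasurable).integral_prod_right'

/-- Parseval's identity in `y`, integrated in `x`. -/
theorem InL2.tsum_lintegral {f : ℝ → Torus d → ℂ} (hf : InL2 f) :
    ∑' k, ∫⁻ v, ‖torusCoeff (f v) k‖ₑ ^ 2 = l2Sq f := by
  rw [l2Sq_eq_iterated hf.1, ← lintegral_tsum fun k =>
    (aestronglyMeasurable_torusCoeff hf.1 k).enorm.pow_const 2]
  refine lintegral_congr_ae ?_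
  filter_upwards [hf.ae_memLp] with v hv
  exact tsum_enorm_torusCoeff_sq hv

theorem l2HsNorm_sq {f : ℝ → Torus d → ℂ}
    (hf : AEStronglyMeasurable (fun p : ℝ × Torus d => f p.1 p.2)) (s : ℝ) :
    l2HsNorm s f ^ 2 = ∑' k, hsWeight s k * ∫⁻ v, ‖torusCoeff (f v) k‖ₑ ^ 2 := by
  rw [l2HsNorm, ← ENNReal.rpow_natCast, ← ENNReal.rpow_mul]
  simp only [hsNorm_sq, hsSq]
  rw [lintegral_tsum fun k =>
    ((aestronglyMeasurable_torusCoeff hf k).enorm.pow_const 2).const_mul _]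
  norm_num
  refine tsum_congr fun k => ?_
  rw [lintegral_const_mul' _ _ (hsWeight_ne_top s k)]

theorem l2Norm_le_l2HsNorm {f : ℝ → Torus d → ℂ} (hf : InL2 f) {s : ℝ} (hs : 0 ≤ s) :
    l2Norm f ≤ l2HsNorm s f := by
  rw [← ENNReal.pow_le_pow_left_iff two_ne_zero, l2Norm_sq, l2HsNorm_sq hf.1, ← hf.tsum_lintegral]
  refine ENNReal.tsum_le_tsum fun k => ?_
  exact le_mul_of_one_le_left' (one_le_hsWeight hs k)

theorem lintegral_torusCoeff_ne_top {f : ℝ → Torus d → ℂ} (hf : InL2 f) (k : Fin d → ℤ) :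
    ∫⁻ v, ‖torusCoeff (f v) k‖ₑ ^ 2 ≠ ⊤ :=
  ne_top_of_le_ne_top hf.l2Sq_ne_top (by
    rw [← hf.tsum_lintegral]
    exact ENNReal.le_tsum k)

theorem memLp_torusCoeff {f : ℝ → Torus d → ℂ} (hf : InL2 f) (k : Fin d → ℤ) :
    MemLp (fun v => torusCoeff (f v) k) 2 volume := by
  refine ⟨aestronglyMeasurable_torusCoeff hf.1 k, ?_⟩
  rw [eLpNorm_lt_top_iff_lintegral_rpow_enorm_lt_top (by norm_num) (by norm_num)]
  simpa using (lintegral_torusCoeff_ne_top hf k).lt_top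

theorem memLp_mul_torusChar {φ : ℝ → ℂ} (hφ : MemLp φ 2 volume) (k : Fin d → ℤ) :
    MemLp (fun p : ℝ × Torus d => φ p.1 * torusChar (-k) p.2) 2 (volume.prod volume) := by
  have hm : AEStronglyMeasurable (fun p : ℝ × Torus d => φ p.1 * torusChar (-k) p.2)
      (volume.prod volume) :=
    hφ.1.comp_fst.mul (continuous_torusChar (-k)).aestronglyMeasurable.comp_snd
  rw [memLp_two_iff_integrable_sq_norm hm]
  simp only [norm_mul, norm_torusChar, mul_one]
  exact ((memLp_two_iff_integrable_sq_norm hφ.1).mp hφ).comp_fst _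

theorem integrable_pairing {f : ℝ → Torus d → ℂ} (hf : InL2 f) {φ : ℝ → ℂ}
    (hφ : MemLp φ 2 volume) (k : Fin d → ℤ) :
    Integrable fun p : ℝ × Torus d => f p.1 p.2 * (φ p.1 * torusChar (-k) p.2) := by
  have h1 : MemLp (fun p : ℝ × Torus d => φ p.1 * torusChar (-k) p.2) 2 (volume.prod volume) :=
    memLp_mul_torusChar hφ k
  exact hf.integrable_mul h1

/-- This turns identities between distributions on the cylinder into one-dimensional identities for
each Fourier coefficient in `y`. -/
theorem torusConst_mul_pairing {f : ℝ → Torus d → ℂ} (hf : InL2 f) {φ : ℝ → ℂ}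
    (hφ : MemLp φ 2 volume) (k : Fin d → ℤ) :
    (torusConst d : ℂ) * pairing f φ k = ∫ v, torusCoeff (f v) k * φ v := by
  rw [pairing, Measure.volume_eq_prod, integral_prod _ (integrable_pairing hf hφ k),
    ← integral_const_mul]
  congr 1
  ext v
  rw [torusCoeff_eq, mul_assoc, ← integral_mul_const]
  congr 2
  ext y
  ring

/-- `g` is the derivative of `f` in the first variable, in the sense of distributions. -/
def HasWeakDeriv (f g : ℝ → Torus d → ℂ) : Prop :=
  ∀ φ : ℝ → ℂ, IsTest φ → ∀ k : Fin d → ℤ, pairing g φ k = -pairing f (deriv φ) k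

theorem IsTest.memLp {φ : ℝ → ℂ} (h : IsTest φ) (p : ℝ≥0∞) : MemLp φ p volume :=
  h.continuous.memLp_of_hasCompactSupport h.2

theorem exists_coeff_primitive {f g : ℝ → Torus d → ℂ} (hf : InL2 f) (hg : InL2 g)
    (h : HasWeakDeriv f g) (k : Fin d → ℤ) :
    ∃ F : ℝ → ℂ, Continuous F ∧ (fun v => torusCoeff (f v) k) =ᵐ[volume] F ∧
      ∀ v v', F v - F v' = ∫ s in v'..v, torusCoeff (g s) k := by
  refine exists_primitive_of_weak_deriv ((memLp_torusCoeff hf k).locallyIntegrable (by norm_num))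
    ((memLp_torusCoeff hg k).locallyIntegrable (by norm_num)) fun φ hφ => ?_
  rw [← torusConst_mul_pairing hg (hφ.memLp 2), ← torusConst_mul_pairing hf (hφ.isTest_deriv.memLp 2),
    h φ hφ]
  ring

/-- The sum of an absolutely convergent Fourier series. -/
def fourierSum (a : (Fin d → ℤ) → ℂ) (y : Torus d) : ℂ := ∑' k, a k * torusUnit k y

theorem norm_torusUnit (k : Fin d → ℤ) (y : Torus d) : ‖torusUnit k y‖ = torusConst d := by
  rw [torusUnit_apply, norm_mul, norm_torusChar, mul_one, Complex.norm_real,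
    Real.norm_of_nonneg (torusConst_pos d).le]

theorem torusCoeff_torusUnit (k l : Fin d → ℤ) :
    torusCoeff (torusUnit l) k = if k = l then 1 else 0 := by
  have h := orthonormal_iff_ite.mp (orthonormal_torusUnitLp (d := d)) k l
  rw [ContinuousMap.inner_toLp] at h
  rw [← h, torusCoeff_eq, ← integral_const_mul]
  congr 1
  ext y
  rw [torusUnit_apply k, map_mul, conj_torusChar, Complex.conj_ofReal]
  ring

/-- Absolute summability permits termwise integration, and orthonormality keeps the term `l = k`. -/
theorem torusCoeff_fourierSum {a : (Fin d → ℤ) → ℂ} (ha : Summable fun k => ‖a k‖)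
    (k : Fin d → ℤ) : torusCoeff (fourierSum a) k = a k := by
  have h1 : torusCoeff (fourierSum a) k
      = (torusConst d : ℂ) * ∫ y, ∑' l, a l * torusUnit l y * torusChar (-k) y := by
    rw [torusCoeff_eq]
    congr 2
    ext y
    rw [fourierSum, tsum_mul_right]
  have hn : ∀ l y, ‖a l * torusUnit l y * torusChar (-k) y‖ = ‖a l‖ * torusConst d := fun l y => by
    rw [norm_mul, norm_mul, norm_torusChar, mul_one, norm_torusUnit]
  have hc : ∀ l, Continuous fun y => a l * torusUnit l y * torusChar (-k) y := fun l =>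
    (continuous_const.mul (torusUnit l).continuous).mul (continuous_torusChar _)
  rw [h1, ← integral_tsum_of_summable_integral_norm
    (fun l => Continuous.integrable_torus (hc l))]
  · rw [← tsum_mul_left, tsum_eq_single k]
    · have : (torusConst d : ℂ) * ∫ y, a k * torusUnit k y * torusChar (-k) y
          = a k * torusCoeff (torusUnit k) k := by
        simp only [mul_assoc]
        rw [integral_const_mul, torusCoeff_eq]
        ring
      rw [this, torusCoeff_torusUnit, if_pos rfl, mul_one]
    · intro l hl
      have : (torusConst d : ℂ) * ∫ y, a l * torusUnit l y * torusChar (-k) y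
          = a l * torusCoeff (torusUnit l) k := by
        simp only [mul_assoc]
        rw [integral_const_mul, torusCoeff_eq]
        ring
      rw [this, torusCoeff_torusUnit, if_neg (Ne.symm hl), mul_zero]
  · simp only [hn, integral_const]
    exact (ha.mul_right _).mul_left _

/-- Parseval under continuity alone, with both sides possibly infinite. It applies to the
differences `W(v) - W(v - z)` before these are known to lie in `L²`. -/
theorem lintegral_translate_eq_tsum {W : ℝ → Torus d → ℂ}
    (hW : Continuous fun p : ℝ × Torus d => W p.1 p.2) :
    l2Sq W = ∑' k, ∫⁻ v, ‖torusCoeff (W v) k‖ₑ ^ 2 := by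
  rw [l2Sq_eq_iterated hW.aestronglyMeasurable, ← lintegral_tsum fun k =>
    (aestronglyMeasurable_torusCoeff hW.aestronglyMeasurable k).enorm.pow_const 2]
  refine lintegral_congr fun v => ?_
  exact (tsum_enorm_torusCoeff_sq (Continuous.memLp_torus (hW.comp (Continuous.prodMk_right v)) 2)).symm

theorem tsum_rpow_mul_rpow_le {ι : Type*} (f g : ι → ℝ≥0∞) {p q : ℝ} (hp : 0 ≤ p) (hq : 0 ≤ q)
    (hpq : p + q = 1) : ∑' i, f i ^ p * g i ^ q ≤ (∑' i, f i) ^ p * (∑' i, g i) ^ q := by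
  let _ : MeasurableSpace ι := ⊤
  simpa only [lintegral_count] using ENNReal.lintegral_mul_norm_pow_le (μ := Measure.count)
    (measurable_from_top (f := f)).aemeasurable (measurable_from_top (f := g)).aemeasurable
    hp hq hpq

/-- The reason for the regularity `3α`: the interpolation below leaves a third of the exponent on
the weighted `L²` norm. -/
theorem hsWeight_three_mul (α : ℝ) (k : Fin d → ℤ) :
    hsWeight (3 * α) k ^ (1 / 3 : ℝ) = hsWeight α k := by
  rw [hsWeight, hsWeight, ENNReal.ofReal_rpow_of_nonneg
    (Real.rpow_nonneg (one_add_freqSq_pos k).le _) (by norm_num),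
    ← Real.rpow_mul (one_add_freqSq_pos k).le]
  congr 2
  ring

/-- The constant in the embedding of `H^α(𝕋^d)` in the bounded functions. -/
def supConst (d : ℕ) (α : ℝ) : ℝ≥0∞ :=
  ENNReal.ofReal (torusConst d) ^ 2 * (4 * ∑' k : Fin d → ℤ, (hsWeight α k)⁻¹)

theorem supConst_ne_top (hd : 1 ≤ d) {α : ℝ} (hα : (d : ℝ) / 2 < α) : supConst d α ≠ ⊤ :=
  ENNReal.mul_ne_top (ENNReal.pow_ne_top ENNReal.ofReal_ne_top)
    (ENNReal.mul_ne_top (by norm_num) (tsum_hsWeight_inv_ne_top hd hα))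

/-- The bounds on a profile `W` in terms of bounds `U` and `X` on the `L²` and `X⁺` norms. -/
structure ProfileBounds (α : ℝ) (U X : ℝ≥0∞) (W : ℝ → Torus d → ℂ) : Prop where
  continuous : Continuous fun p : ℝ × Torus d => W p.1 p.2
  hsSq_le : ∀ v, hsSq α (W v) ≤ 4 * (U ^ (1 / 3 : ℝ) * X ^ (5 / 3 : ℝ))
  sup_le : ∀ v y, ‖W v y‖ₑ ^ 2 ≤ supConst d α * (U ^ (1 / 3 : ℝ) * X ^ (5 / 3 : ℝ))
  holder : ∀ v v', hsSq α (fun y => W v y - W v' y)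
    ≤ 256 * (ENNReal.ofReal |v - v'| ^ (1 / 3 : ℝ) * X ^ 2)
  translate : ∀ z, l2Sq (fun v y => W v y - W (v - z) y) ≤ ENNReal.ofReal (z ^ 2) * X ^ 2

/-- A function with finite `L²`, `H¹_v L²_y` and `L²_v H^{3α}_y` norms has a continuous
representative, bounded and Hölder continuous in `v` with values in `H^α_y`. -/
theorem exists_profileBounds (hd : 1 ≤ d) {α : ℝ} (hα : (d : ℝ) / 2 < α) {U X : ℝ≥0∞}
    (hU : U ≠ ⊤) (hX : X ≠ ⊤) {f g : ℝ → Torus d → ℂ} (hf : InL2 f) (hg : InL2 g)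
    (h : HasWeakDeriv f g) (hfU : l2Norm f ≤ U) (hfX : l2HsNorm (3 * α) f ≤ X)
    (hgX : l2Norm g ≤ X) :
    ∃ W : ℝ → Torus d → ℂ, ProfileBounds α U X W ∧
      (fun p : ℝ × Torus d => f p.1 p.2) =ᵐ[volume] fun p => W p.1 p.2 := by
  choose F hFc hFf hF using exists_coeff_primitive hf hg h
  set a : (Fin d → ℤ) → ℝ≥0∞ := fun k => ∫⁻ v, ‖F k v‖ₑ ^ 2 with ha
  set b : (Fin d → ℤ) → ℝ≥0∞ := fun k => ∫⁻ v, ‖torusCoeff (g v) k‖ₑ ^ 2 with hb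
  have ha' : ∀ k, a k = ∫⁻ v, ‖torusCoeff (f v) k‖ₑ ^ 2 := fun k =>
    lintegral_congr_ae ((hFf k).mono fun v hv => by simp only [hv])
  have haf : ∀ k, a k ≠ ⊤ := fun k => by
    rw [ha']
    exact lintegral_torusCoeff_ne_top hf k
  have hbf : ∀ k, b k ≠ ⊤ := lintegral_torusCoeff_ne_top hg
  have hgm := fun k => aestronglyMeasurable_torusCoeff hg.1 k
  have hA : ∑' k, a k ≤ U ^ 2 := by
    simp only [ha']
    rw [hf.tsum_lintegral, ← l2Norm_sq]
    gcongr
  have hB : ∑' k, b k ≤ X ^ 2 := by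
    rw [hb, hg.tsum_lintegral, ← l2Norm_sq]
    gcongr
  have hH : ∑' k, hsWeight (3 * α) k * a k ≤ X ^ 2 := by
    simp only [ha']
    rw [← l2HsNorm_sq hf.1]
    gcongr
  set S : ℝ≥0∞ := ∑' k : Fin d → ℤ, (hsWeight α k)⁻¹ with hS
  have hSf : S ≠ ⊤ := tsum_hsWeight_inv_ne_top hd hα
  set Q : ℝ≥0∞ := U ^ (1 / 3 : ℝ) * X ^ (5 / 3 : ℝ) with hQ
  have hQf : Q ≠ ⊤ := ENNReal.mul_ne_top (ENNReal.rpow_ne_top_of_nonneg (by norm_num) hU)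
    (ENNReal.rpow_ne_top_of_nonneg (by norm_num) hX)
  -- the sup bounds
  set m : (Fin d → ℤ) → ℝ≥0∞ := fun k => 4 * (a k * b k) ^ (1 / 2 : ℝ) with hm
  have hFm : ∀ k v, ‖F k v‖ₑ ^ 2 ≤ m k := by
    intro k v
    have h1 := enorm_pow_four_le (hFc k) (hgm k) (hF k) (haf k) (hbf k) v
    rw [← ENNReal.pow_le_pow_left_iff two_ne_zero]
    refine h1.trans (le_of_eq ?_)
    rw [hm, mul_pow, ← ENNReal.rpow_natCast (_ ^ (1 / 2 : ℝ)), ← ENNReal.rpow_mul]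
    norm_num
    ring
  -- Splitting `a^{1/2} = a^{1/6} a^{1/3}` and giving the weight to the second factor yields
  -- `a^{1/6} (hsWeight (3α) a)^{1/3} b^{1/2}`. The exponents add up to one, and Hölder's
  -- inequality, applied twice, produces `U^{1/3} X^{2/3} X`.
  have hmsum : ∑' k, hsWeight α k * m k ≤ 4 * Q := by
    have e : ∀ k, hsWeight α k * m k
        = 4 * ((a k ^ (1 / 3 : ℝ) * (hsWeight (3 * α) k * a k) ^ (2 / 3 : ℝ)) ^ (1 / 2 : ℝ)
          * b k ^ (1 / 2 : ℝ)) := by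
      intro k
      rw [ENNReal.mul_rpow_of_nonneg _ _ (by norm_num : (0 : ℝ) ≤ 1 / 2),
        ENNReal.mul_rpow_of_nonneg _ _ (by norm_num : (0 : ℝ) ≤ 2 / 3),
        ENNReal.mul_rpow_of_nonneg _ _ (by norm_num : (0 : ℝ) ≤ 1 / 2),
        ← ENNReal.rpow_mul, ← ENNReal.rpow_mul, ← ENNReal.rpow_mul, hm]
      simp only
      rw [ENNReal.mul_rpow_of_nonneg _ _ (by norm_num : (0 : ℝ) ≤ 1 / 2)]
      have e1 : a k ^ (1 / 2 : ℝ) = a k ^ ((1 / 3 : ℝ) * (1 / 2)) * a k ^ ((2 / 3 : ℝ) * (1 / 2)) := by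
        rw [← ENNReal.rpow_add_of_nonneg _ _ (by norm_num) (by norm_num)]
        norm_num
      have e2 : hsWeight (3 * α) k ^ ((2 / 3 : ℝ) * (1 / 2)) = hsWeight α k := by
        rw [← hsWeight_three_mul α]
        norm_num
      rw [e1, e2]
      ring
    calc ∑' k, hsWeight α k * m k
        = 4 * ∑' k, (a k ^ (1 / 3 : ℝ) * (hsWeight (3 * α) k * a k) ^ (2 / 3 : ℝ)) ^ (1 / 2 : ℝ)
          * b k ^ (1 / 2 : ℝ) := by
          rw [← ENNReal.tsum_mul_left]
          exact tsum_congr e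
      _ ≤ 4 * ((∑' k, a k ^ (1 / 3 : ℝ) * (hsWeight (3 * α) k * a k) ^ (2 / 3 : ℝ)) ^ (1 / 2 : ℝ)
          * (∑' k, b k) ^ (1 / 2 : ℝ)) := by
          gcongr
          exact tsum_rpow_mul_rpow_le _ _ (by norm_num) (by norm_num) (by norm_num)
      _ ≤ 4 * (((U ^ 2) ^ (1 / 3 : ℝ) * (X ^ 2) ^ (2 / 3 : ℝ)) ^ (1 / 2 : ℝ)
          * (X ^ 2) ^ (1 / 2 : ℝ)) := by
          gcongr
          refine (tsum_rpow_mul_rpow_le _ _ (by norm_num) (by norm_num) (by norm_num)).trans ?_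
          gcongr
      _ = 4 * Q := by
          rw [hQ, ENNReal.mul_rpow_of_nonneg _ _ (by norm_num : (0 : ℝ) ≤ 1 / 2)]
          simp only [← ENNReal.rpow_natCast, ← ENNReal.rpow_mul]
          rw [mul_assoc, ← ENNReal.rpow_add_of_nonneg _ _ (by norm_num) (by norm_num)]
          norm_num
  -- Cauchy–Schwarz against the summable inverse weights: the Fourier series converges absolutely,
  -- uniformly in `v` and `y`. This gives both the continuity of `W` and its supremum bound.
  have hssum : (∑' k, m k ^ (1 / 2 : ℝ)) ^ 2 ≤ 4 * S * Q := by
    refine (tsum_sq_le_weight (u := hsWeight α) (fun k => hsWeight_ne_zero _ _)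
      (fun k => hsWeight_ne_top _ _)).trans ?_
    have e : ∀ k, (m k ^ (1 / 2 : ℝ)) ^ 2 = m k := fun k => by
      rw [← ENNReal.rpow_natCast, ← ENNReal.rpow_mul]
      norm_num
    simp only [e]
    calc _ ≤ S * (4 * Q) := by gcongr
      _ = _ := by ring
  have hsf : ∑' k, m k ^ (1 / 2 : ℝ) ≠ ⊤ := by
    intro htop
    rw [htop] at hssum
    have : 4 * S * Q ≠ ⊤ := by finiteness
    simp only [ne_eq, OfNat.ofNat_ne_zero, not_false_eq_true, ENNReal.top_pow, top_le_iff] at hssum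
    exact this hssum
  have hmf : ∀ k, m k ^ (1 / 2 : ℝ) ≠ ⊤ := fun k => ne_top_of_le_ne_top hsf (ENNReal.le_tsum k)
  have hFs : ∀ k v, ‖F k v‖ₑ ≤ m k ^ (1 / 2 : ℝ) := by
    intro k v
    have := ENNReal.rpow_le_rpow (hFm k v) (by norm_num : (0 : ℝ) ≤ 1 / 2)
    rw [← ENNReal.rpow_natCast, ← ENNReal.rpow_mul] at this
    norm_num at this
    simpa using this
  have hFs' : ∀ k v, ‖F k v‖ ≤ (m k ^ (1 / 2 : ℝ)).toReal := fun k v => by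
    rw [← toReal_enorm]
    exact ENNReal.toReal_mono (hmf k) (hFs k v)
  have hsumm : Summable fun k => (m k ^ (1 / 2 : ℝ)).toReal := ENNReal.summable_toReal hsf
  have hFsumm : ∀ v, Summable fun k => ‖F k v‖ := fun v =>
    Summable.of_nonneg_of_le (fun k => norm_nonneg _) (fun k => hFs' k v) hsumm
  -- the representative
  set W : ℝ → Torus d → ℂ := fun v y => fourierSum (fun k => F k v) y with hW
  have hWc : Continuous fun p : ℝ × Torus d => W p.1 p.2 := by
    refine continuous_tsum (u := fun k => (m k ^ (1 / 2 : ℝ)).toReal * torusConst d) (fun k => ?_)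
      (hsumm.mul_right _) (fun k p => ?_)
    · exact ((hFc k).comp continuous_fst).mul ((torusUnit k).continuous.comp continuous_snd)
    · rw [norm_mul, norm_torusUnit]
      exact mul_le_mul_of_nonneg_right (hFs' k _) (torusConst_pos d).le
  have hWv : ∀ v, Continuous (W v) := fun v => hWc.comp (Continuous.prodMk_right v)
  have hWk : ∀ v k, torusCoeff (W v) k = F k v := fun v k => torusCoeff_fourierSum (hFsumm v) k
  have hWsub : ∀ v v' k, torusCoeff (fun y => W v y - W v' y) k = F k v - F k v' := fun v v' k => by
    rw [torusCoeff_sub (Continuous.integrable_torus (hWv v))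
      (Continuous.integrable_torus (hWv v')), hWk, hWk]
  refine ⟨W, ⟨hWc, fun v => ?_, fun v y => ?_, fun v v' => ?_, fun z => ?_⟩, ?_⟩
  · refine le_trans (ENNReal.tsum_le_tsum fun k => ?_) hmsum
    rw [hWk]
    gcongr
    exact hFm k v
  · have h1 : ‖W v y‖ₑ ≤ ENNReal.ofReal (torusConst d) * ∑' k, m k ^ (1 / 2 : ℝ) := by
      rw [← ENNReal.tsum_mul_left]
      refine (enorm_tsum_le_tsum_enorm (ε := ℂ)).trans (ENNReal.tsum_le_tsum fun k => ?_)
      rw [enorm_mul, ← ofReal_norm (torusUnit k y), norm_torusUnit, mul_comm]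
      gcongr
      exact hFs k v
    calc ‖W v y‖ₑ ^ 2 ≤ (ENNReal.ofReal (torusConst d) * ∑' k, m k ^ (1 / 2 : ℝ)) ^ 2 := by gcongr
      _ ≤ ENNReal.ofReal (torusConst d) ^ 2 * (4 * S * Q) := by
          rw [mul_pow]
          gcongr
      _ = _ := by
          rw [supConst]
          ring
  -- The cube root of the sixth-power inequality gives `a^{1/3} b^{2/3}`, and the weight of `H^α`
  -- becomes the weight of `H^{3α}` inside the cube root. Hölder's inequality with exponents `1/3`
  -- and `2/3` then gives `X²`.
  · have hD : ∀ k, hsWeight α k * ‖torusCoeff (fun y => W v y - W v' y) k‖ₑ ^ 2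
        ≤ (256 * ENNReal.ofReal |v - v'|) ^ (1 / 3 : ℝ)
          * ((hsWeight (3 * α) k * a k) ^ (1 / 3 : ℝ) * b k ^ (2 / 3 : ℝ)) := by
      intro k
      rw [hWsub]
      have h1 := enorm_sub_pow_six_le (hFc k) (hgm k) (hF k) (haf k) (hbf k) v v'
      have h2 := ENNReal.rpow_le_rpow h1 (by norm_num : (0 : ℝ) ≤ 1 / 3)
      rw [← ENNReal.rpow_natCast _ 3, ← ENNReal.rpow_mul] at h2
      norm_num at h2
      rw [ENNReal.mul_rpow_of_nonneg (hsWeight (3 * α) k) _ (by norm_num : (0 : ℝ) ≤ 1 / 3),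
        hsWeight_three_mul]
      calc _ ≤ hsWeight α k * (256 * ENNReal.ofReal |v - v'| * (a k * b k ^ 2)) ^ (1 / 3 : ℝ) := by
            gcongr
        _ = _ := by
            rw [ENNReal.mul_rpow_of_nonneg _ _ (by norm_num : (0 : ℝ) ≤ 1 / 3),
              ENNReal.mul_rpow_of_nonneg (a k) _ (by norm_num : (0 : ℝ) ≤ 1 / 3),
              ← ENNReal.rpow_natCast, ← ENNReal.rpow_mul]
            norm_num [mul_assoc, mul_left_comm, mul_comm]
    calc hsSq α (fun y => W v y - W v' y) ≤ ∑' k, (256 * ENNReal.ofReal |v - v'|) ^ (1 / 3 : ℝ)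
          * ((hsWeight (3 * α) k * a k) ^ (1 / 3 : ℝ) * b k ^ (2 / 3 : ℝ)) :=
          ENNReal.tsum_le_tsum hD
      _ ≤ (256 * ENNReal.ofReal |v - v'|) ^ (1 / 3 : ℝ)
          * ((X ^ 2) ^ (1 / 3 : ℝ) * (X ^ 2) ^ (2 / 3 : ℝ)) := by
          rw [ENNReal.tsum_mul_left]
          gcongr
          refine (tsum_rpow_mul_rpow_le _ _ (by norm_num) (by norm_num) (by norm_num)).trans ?_
          gcongr
      _ = 256 ^ (1 / 3 : ℝ) * (ENNReal.ofReal |v - v'| ^ (1 / 3 : ℝ) * X ^ 2) := by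
          rw [← ENNReal.rpow_add_of_nonneg _ _ (by norm_num) (by norm_num),
            ENNReal.mul_rpow_of_nonneg _ _ (by norm_num : (0 : ℝ) ≤ 1 / 3)]
          norm_num
          ring
      -- The crude bound `256^{1/3} ≤ 256` keeps a numeral as constant.
      _ ≤ _ := by
          gcongr
          have : (256 : ℝ≥0∞) ^ (1 / 3 : ℝ) ≤ 256 ^ (1 : ℝ) :=
            ENNReal.rpow_le_rpow_of_exponent_le (by norm_num) (by norm_num)
          rwa [ENNReal.rpow_one] at this
  · have hc : Continuous fun p : ℝ × Torus d => (fun v y => W v y - W (v - z) y) p.1 p.2 :=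
      hWc.sub (hWc.comp (by fun_prop : Continuous fun p : ℝ × Torus d => (p.1 - z, p.2)))
    rw [lintegral_translate_eq_tsum hc]
    simp only [hWsub]
    calc _ ≤ ∑' k, ENNReal.ofReal (z ^ 2) * b k := ENNReal.tsum_le_tsum fun k =>
          lintegral_enorm_sub_translate_le (hgm k) (hF k) z
      _ ≤ _ := by
          rw [ENNReal.tsum_mul_left]
          gcongr
  -- For almost every `v`, all coefficients of `f(v)` agree with those of `W(v)`, since there are
  -- countably many of them; Parseval then gives `f = W` almost everywhere.
  · have hfW : AEStronglyMeasurable fun p : ℝ × Torus d => f p.1 p.2 - W p.1 p.2 :=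
      hf.1.sub hWc.aestronglyMeasurable
    have h0 : l2Sq (fun v y => f v y - W v y) = 0 := by
      rw [l2Sq_eq_iterated hfW, lintegral_eq_zero_iff' (hfW.enorm.pow_const 2).lintegral_prod_right']
      filter_upwards [hf.ae_memLp, ae_all_iff.mpr hFf] with v hv1 hv2
      have hm2 := hv1.sub (Continuous.memLp_torus (hWv v) 2)
      have := tsum_enorm_torusCoeff_sq hm2
      change ∫⁻ y, ‖(f v - W v) y‖ₑ ^ 2 = 0
      rw [← this, ENNReal.tsum_eq_zero]
      intro k
      have e : torusCoeff (f v - W v) k = 0 := by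
        change torusCoeff (fun y => f v y - W v y) k = 0
        rw [torusCoeff_sub (hv1.integrable (by norm_num))
          (Continuous.integrable_torus (hWv v)), hWk, hv2 k, sub_self]
      rw [e]
      simp
    rw [l2Sq, lintegral_eq_zero_iff' (hfW.enorm.pow_const 2)] at h0
    filter_upwards [h0] with p hp
    simpa [sub_eq_zero] using hp

end NLSCylinder
end

/-! ### The profile transform, under which `L_x` becomes `i ∂_v`. -/

noncomputable section

namespace NLSCylinder

open Set

variable {d : ℕ}

/-- The dilation of the first variable. -/
def dilation (d : ℕ) {t : ℝ} (ht : 0 < t) : (ℝ × Torus d) ≃ᵐ (ℝ × Torus d) :=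
  (Homeomorph.mulLeft₀ t ht.ne').toMeasurableEquiv.prodCongr (MeasurableEquiv.refl _)

theorem map_dilation {t : ℝ} (ht : 0 < t) :
    Measure.map (dilation d ht) volume = ENNReal.ofReal t⁻¹ • volume := by
  have h1 : (dilation d ht : ℝ × Torus d → ℝ × Torus d) = Prod.map (fun x => t * x) id := rfl
  rw [Measure.volume_eq_prod, h1, ← Measure.map_prod_map _ _ (by fun_prop) measurable_id,
    Real.map_volume_mul_left ht.ne', Measure.map_id, abs_of_pos (inv_pos.mpr ht)]
  exact Measure.prod_smul_left _

theorem lintegral_dilation {t : ℝ} (ht : 0 < t) (F : ℝ × Torus d → ℝ≥0∞) :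
    ∫⁻ p : ℝ × Torus d, F (t * p.1, p.2) = ENNReal.ofReal t⁻¹ * ∫⁻ p, F p := by
  have := lintegral_map_equiv (μ := volume) F (dilation d ht)
  rw [map_dilation, lintegral_smul_measure] at this
  exact this.symm

theorem integral_dilation {t : ℝ} (ht : 0 < t) (F : ℝ × Torus d → ℂ) :
    ∫ p : ℝ × Torus d, F (t * p.1, p.2) = (t : ℂ)⁻¹ * ∫ p, F p := by
  have := integral_map_equiv (μ := volume) (dilation d ht) F
  rw [map_dilation, integral_smul_measure, ENNReal.toReal_ofReal (by positivity)] at this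
  rw [Complex.real_smul, Complex.ofReal_inv] at this
  exact this.symm

theorem quasiMeasurePreserving_dilation {t : ℝ} (ht : 0 < t) :
    Measure.QuasiMeasurePreserving (fun p : ℝ × Torus d => (t * p.1, p.2)) volume volume := by
  refine ⟨(dilation d ht).measurable, ?_⟩
  have := map_dilation (d := d) ht
  change Measure.map (dilation d ht) volume ≪ volume
  rw [this]
  exact Measure.smul_absolutelyContinuous

/-- The profile `t^{1/2} e^{-i t v² / 2} f(t v, y)` of a function `f` at time `t`. -/
def profileAt (t : ℝ) (f : ℝ → Torus d → ℂ) (v : ℝ) (y : Torus d) : ℂ :=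
  (Real.sqrt t : ℂ) * Complex.exp (-Complex.I * (t : ℂ) * (v : ℂ) ^ 2 / 2) * f (t * v) y

theorem norm_exp_profile (t v : ℝ) :
    ‖Complex.exp (-Complex.I * (t : ℂ) * (v : ℂ) ^ 2 / 2)‖ = 1 := by
  have : -Complex.I * (t : ℂ) * (v : ℂ) ^ 2 / 2 = ((-t * v ^ 2 / 2 : ℝ) : ℂ) * Complex.I := by
    push_cast
    ring
  rw [this, Complex.norm_exp_ofReal_mul_I]

theorem enorm_profileAt_sq {t : ℝ} (ht : 0 < t) (f : ℝ → Torus d → ℂ) (v : ℝ) (y : Torus d) :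
    ‖profileAt t f v y‖ₑ ^ 2 = ENNReal.ofReal t * ‖f (t * v) y‖ₑ ^ 2 := by
  rw [← ofReal_norm, profileAt, norm_mul, norm_mul, norm_exp_profile, mul_one, Complex.norm_real,
    Real.norm_of_nonneg (Real.sqrt_nonneg t), ← ENNReal.ofReal_pow (by positivity), mul_pow,
    Real.sq_sqrt ht.le, ENNReal.ofReal_mul ht.le, ENNReal.ofReal_pow (norm_nonneg _), ofReal_norm]

theorem ofReal_mul_ofReal_inv {t : ℝ} (ht : 0 < t) :
    ENNReal.ofReal t * ENNReal.ofReal t⁻¹ = 1 := by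
  rw [← ENNReal.ofReal_mul ht.le, mul_inv_cancel₀ ht.ne', ENNReal.ofReal_one]

theorem l2Sq_profileAt {t : ℝ} (ht : 0 < t) (f : ℝ → Torus d → ℂ) :
    l2Sq (profileAt t f) = l2Sq f := by
  simp only [l2Sq, enorm_profileAt_sq ht]
  rw [lintegral_const_mul' _ _ ENNReal.ofReal_ne_top,
    lintegral_dilation ht (fun p => ‖f p.1 p.2‖ₑ ^ 2), ← mul_assoc, ofReal_mul_ofReal_inv ht,
    one_mul]

theorem l2Norm_profileAt {t : ℝ} (ht : 0 < t) (f : ℝ → Torus d → ℂ) :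
    l2Norm (profileAt t f) = l2Norm f := by
  rw [l2Norm_eq, l2Norm_eq, l2Sq_profileAt ht]

theorem InL2.profileAt {t : ℝ} (ht : 0 < t) {f : ℝ → Torus d → ℂ} (hf : InL2 f) :
    InL2 (profileAt t f) := by
  refine ⟨?_, (l2Norm_profileAt ht f).trans_lt hf.2⟩
  have h1 := hf.1.comp_quasiMeasurePreserving (quasiMeasurePreserving_dilation ht)
  refine AEStronglyMeasurable.mul ?_ h1
  exact Continuous.aestronglyMeasurable (by fun_prop)

theorem l2HsNorm_profileAt {t : ℝ} (ht : 0 < t) (s : ℝ) (f : ℝ → Torus d → ℂ) :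
    l2HsNorm s (profileAt t f) = l2HsNorm s f := by
  unfold l2HsNorm
  simp only [hsNorm_sq]
  have h1 : ∀ v, hsSq s (profileAt t f v) = ENNReal.ofReal t * hsSq s (f (t * v)) := by
    intro v
    have := hsSq_const_mul s
      ((Real.sqrt t : ℂ) * Complex.exp (-Complex.I * (t : ℂ) * (v : ℂ) ^ 2 / 2)) (f (t * v))
    refine this.trans ?_
    congr 1
    rw [← ofReal_norm, norm_mul, norm_exp_profile, mul_one, Complex.norm_real,
      Real.norm_of_nonneg (Real.sqrt_nonneg t), ← ENNReal.ofReal_pow (by positivity),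
      Real.sq_sqrt ht.le]
  have h2 := lintegral_map_equiv (μ := volume) (fun x => hsSq s (f x))
    (Homeomorph.mulLeft₀ t ht.ne').toMeasurableEquiv
  have h3 : ((Homeomorph.mulLeft₀ t ht.ne').toMeasurableEquiv : ℝ → ℝ) = fun x => t * x := rfl
  rw [h3, Real.map_volume_mul_left ht.ne', lintegral_smul_measure,
    abs_of_pos (inv_pos.mpr ht)] at h2
  simp only [h1]
  rw [lintegral_const_mul' _ _ ENNReal.ofReal_ne_top, ← h2, smul_eq_mul, ← mul_assoc,
    ofReal_mul_ofReal_inv ht, one_mul]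

/-- The function `t^{-1/2} e^{-i x² / (2 t)} φ(x / t)`, dual to the profile. -/
def dualProfile (t : ℝ) (φ : ℝ → ℂ) (x : ℝ) : ℂ :=
  (Real.sqrt t : ℂ)⁻¹ * Complex.exp (-Complex.I * (x : ℂ) ^ 2 / (2 * t)) * φ (x / t)

/-- The change of variables `x = t v` moves the profile transform to the test function; of the
Jacobian `t⁻¹` and the factor `t^{1/2}` there remains `t^{-1/2}`. -/
theorem pairing_profileAt {t : ℝ} (ht : 0 < t) (f : ℝ → Torus d → ℂ) (φ : ℝ → ℂ)
    (k : Fin d → ℤ) : pairing (profileAt t f) φ k = pairing f (dualProfile t φ) k := by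
  have htc : (t : ℂ) ≠ 0 := by exact_mod_cast ht.ne'
  have hsq : (Real.sqrt t : ℂ) * (Real.sqrt t : ℂ) = t := by
    rw [← Complex.ofReal_mul, Real.mul_self_sqrt ht.le]
  have hs0 : (Real.sqrt t : ℂ) ≠ 0 := by exact_mod_cast (Real.sqrt_pos.mpr ht).ne'
  have h := integral_dilation (d := d) ht fun p =>
    (t : ℂ) * (f p.1 p.2 * (dualProfile t φ p.1 * torusChar (-k) p.2))
  rw [integral_const_mul, integral_const_mul, inv_mul_cancel_left₀ htc] at h
  rw [pairing, pairing, ← h, ← integral_const_mul]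
  congr 1
  ext p
  simp only [profileAt, dualProfile]
  rw [mul_div_cancel_left₀ _ ht.ne']
  have e1 : -Complex.I * ((t * p.1 : ℝ) : ℂ) ^ 2 / (2 * t) = -Complex.I * t * (p.1 : ℂ) ^ 2 / 2 := by
    push_cast
    field_simp
  rw [e1]
  have e2 : (t : ℂ) * (Real.sqrt t : ℂ)⁻¹ = Real.sqrt t := by
    rw [← hsq, mul_inv_cancel_right₀ hs0]
  linear_combination (-f (t * p.1) p.2 * Complex.exp (-Complex.I * t * (p.1 : ℂ) ^ 2 / 2)
    * φ p.1 * torusChar (-k) p.2) * e2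

theorem IsTest.dualProfile {t : ℝ} (ht : 0 < t) {φ : ℝ → ℂ} (hφ : IsTest φ) :
    IsTest (dualProfile t φ) := by
  constructor
  · unfold NLSCylinder.dualProfile
    refine ContDiff.mul (contDiff_const.mul (ContDiff.cexp ?_)) (hφ.1.comp (contDiff_id.div_const t))
    exact (contDiff_const.mul (Complex.ofRealCLM.contDiff.pow 2)).div_const _
  · have h1 : HasCompactSupport fun x : ℝ => φ (x / t) := by
      have : (fun x : ℝ => φ (x / t)) = φ ∘ (Homeomorph.mulRight₀ t⁻¹ (inv_ne_zero ht.ne')) := rfl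
      rw [this]
      exact hφ.2.comp_homeomorph _
    exact h1.mul_left

theorem hasDerivAt_dualProfile {t : ℝ} (ht : 0 < t) {φ : ℝ → ℂ} {x : ℝ} {φ' : ℂ}
    (hφ : HasDerivAt φ φ' (x / t)) :
    HasDerivAt (dualProfile t φ)
      (-Complex.I * x / t * dualProfile t φ x
        + (Real.sqrt t : ℂ)⁻¹ * Complex.exp (-Complex.I * (x : ℂ) ^ 2 / (2 * t)) * (φ' / t)) x := by
  have htc : (t : ℂ) ≠ 0 := by exact_mod_cast ht.ne'
  have h1 : HasDerivAt (fun x : ℝ => -Complex.I * (x : ℂ) ^ 2 / (2 * t))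
      (-Complex.I * x / t) x := by
    have := (((hasDerivAt_id x).ofReal_comp.pow 2).const_mul (-Complex.I)).div_const (2 * (t : ℂ))
    refine this.congr_deriv ?_
    simp
    field_simp
  have h2 : HasDerivAt (fun x : ℝ => φ (x / t)) (φ' / t) x := by
    have := hφ.scomp x ((hasDerivAt_id x).div_const t)
    refine this.congr_deriv ?_
    simp
    ring
  refine ((h1.cexp.const_mul (Real.sqrt t : ℂ)⁻¹).mul h2).congr_deriv ?_
  simp only [dualProfile]
  ring

/-- The operator `x - i t ∂_x` annihilates `e^{-i x² / (2t)}`, so only the derivative of `φ(x / t)`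
survives; its factor `1 / t` cancels `t`. -/
theorem dualProfile_identity {t : ℝ} (ht : 0 < t) {φ : ℝ → ℂ} (hφ : IsTest φ) (x : ℝ) :
    (x : ℂ) * dualProfile t φ x - Complex.I * t * deriv (dualProfile t φ) x
      = -Complex.I * dualProfile t (deriv φ) x := by
  have htc : (t : ℂ) ≠ 0 := by exact_mod_cast ht.ne'
  rw [(hasDerivAt_dualProfile ht (hφ.hasDerivAt (x / t))).deriv]
  have hI := Complex.I_sq
  simp only [dualProfile]
  field_simp
  linear_combination ((x : ℂ) * φ (x / t) * (Real.sqrt t : ℂ)⁻¹) * hI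

theorem pairing_const_mul (c : ℂ) (f : ℝ → Torus d → ℂ) (φ : ℝ → ℂ) (k : Fin d → ℤ) :
    pairing f (fun x => c * φ x) k = c * pairing f φ k := by
  rw [pairing, pairing, ← integral_const_mul]
  congr 1
  ext p
  ring

theorem pairing_const_mul_left (c : ℂ) (f : ℝ → Torus d → ℂ) (φ : ℝ → ℂ) (k : Fin d → ℤ) :
    pairing (fun x y => c * f x y) φ k = c * pairing f φ k := by
  rw [pairing, pairing, ← integral_const_mul]
  congr 1
  ext p
  ring

/-- The distributional form of `i ∂_v w = t^{1/2} e^{-i t v² / 2} (L_x u)(t v)`, by duality from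
`dualProfile_identity`. -/
theorem IsLx.hasWeakDeriv {t : ℝ} (ht : 0 < t) {f g : ℝ → Torus d → ℂ} (h : IsLx t f g) :
    HasWeakDeriv (profileAt t f) (fun v y => -Complex.I * profileAt t g v y) := by
  intro φ hφ k
  rw [pairing_const_mul_left, pairing_profileAt ht, pairing_profileAt ht, h.2 _ (hφ.dualProfile ht)]
  have e : (fun x : ℝ => (x : ℂ) * dualProfile t φ x - Complex.I * t * deriv (dualProfile t φ) x)
      = fun x => -Complex.I * dualProfile t (deriv φ) x := funext (dualProfile_identity ht hφ)
  rw [e, pairing_const_mul]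
  linear_combination (pairing f (dualProfile t (deriv φ)) k) * Complex.I_sq

/-- Test functions determine each Fourier coefficient almost everywhere, and Parseval recovers the
norm. The infimum defining `lxNorm` is thus the norm of any `L_x f`. -/
theorem IsLx.l2Norm_eq_of {t : ℝ} {f g g' : ℝ → Torus d → ℂ} (h : IsLx t f g) (h' : IsLx t f g') :
    l2Norm g = l2Norm g' := by
  rw [l2Norm_eq, l2Norm_eq, ← h.1.tsum_lintegral, ← h'.1.tsum_lintegral]
  congr 1
  refine tsum_congr fun k => ?_
  have hae : (fun v => torusCoeff (g v) k) =ᵐ[volume] fun v => torusCoeff (g' v) k := by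
    refine ae_eq_of_integral_contDiff_smul_eq
      ((memLp_torusCoeff h.1 k).locallyIntegrable (by norm_num))
      ((memLp_torusCoeff h'.1 k).locallyIntegrable (by norm_num)) fun ρ h1 h2 => ?_
    have hρ := isTest_ofReal h1 h2
    simp only [Complex.real_smul, mul_comm ((ρ _ : ℝ) : ℂ)]
    rw [← torusConst_mul_pairing h.1 (hρ.memLp 2), ← torusConst_mul_pairing h'.1 (hρ.memLp 2),
      h.2 _ hρ, h'.2 _ hρ]
  refine lintegral_congr_ae ?_
  filter_upwards [hae] with v hv
  simp only [hv]

theorem IsLx.lxNorm_eq {t : ℝ} {f g : ℝ → Torus d → ℂ} (h : IsLx t f g) : lxNorm t f = l2Norm g :=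
  le_antisymm (iInf₂_le g h) (le_iInf₂ fun _ h' => (h.l2Norm_eq_of h').le)

theorem IsLx.xPlusNorm_eq {t : ℝ} {f g : ℝ → Torus d → ℂ} (h : IsLx t f g) (s : ℝ) :
    xPlusNorm s t f = (l2Norm g ^ 2 + l2HsNorm s f ^ 2) ^ (1 / 2 : ℝ) := by
  rw [xPlusNorm, h.lxNorm_eq]
  norm_num

theorem IsLx.xPlusNorm_sq {t : ℝ} {f g : ℝ → Torus d → ℂ} (h : IsLx t f g) (s : ℝ) :
    xPlusNorm s t f ^ 2 = l2Norm g ^ 2 + l2HsNorm s f ^ 2 := by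
  rw [h.xPlusNorm_eq, ← ENNReal.rpow_natCast, ← ENNReal.rpow_mul]
  norm_num

theorem IsLx.l2Norm_le_xPlusNorm {t : ℝ} {f g : ℝ → Torus d → ℂ} (h : IsLx t f g) (s : ℝ) :
    l2Norm g ≤ xPlusNorm s t f := by
  rw [← ENNReal.pow_le_pow_left_iff two_ne_zero, h.xPlusNorm_sq]
  exact le_self_add

theorem IsLx.l2HsNorm_le_xPlusNorm {t : ℝ} {f g : ℝ → Torus d → ℂ} (h : IsLx t f g) (s : ℝ) :
    l2HsNorm s f ≤ xPlusNorm s t f := by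
  rw [← ENNReal.pow_le_pow_left_iff two_ne_zero, h.xPlusNorm_sq]
  exact le_add_self

theorem IsLx.xPlusNorm_ne_top {t s : ℝ} {f g : ℝ → Torus d → ℂ} (h : IsLx t f g)
    (hs : l2HsNorm s f < ⊤) : xPlusNorm s t f ≠ ⊤ := by
  rw [h.xPlusNorm_eq]
  exact ENNReal.rpow_ne_top_of_nonneg (by norm_num)
    (ENNReal.add_ne_top.mpr ⟨ENNReal.pow_ne_top h.1.2.ne, ENNReal.pow_ne_top hs.ne⟩)

/-- The profile of a function in `X⁺` has a continuous representative with the bounds given by its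
`L²` and `X⁺` norms. -/
theorem IsLx.exists_profileBounds (hd : 1 ≤ d) {α : ℝ} (hα : (d : ℝ) / 2 < α) {t : ℝ} (ht : 0 < t)
    {f g : ℝ → Torus d → ℂ} (hf : InL2 f) (hs : l2HsNorm (3 * α) f < ⊤) (h : IsLx t f g) :
    ∃ W : ℝ → Torus d → ℂ, ProfileBounds α (l2Norm f) (xPlusNorm (3 * α) t f) W ∧
      (fun p : ℝ × Torus d => profileAt t f p.1 p.2) =ᵐ[volume] fun p => W p.1 p.2 := by
  have hg' : InL2 fun v y => -Complex.I * profileAt t g v y := (h.1.profileAt ht).const_mul _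
  refine NLSCylinder.exists_profileBounds hd hα hf.2.ne (h.xPlusNorm_ne_top hs) (hf.profileAt ht)
    hg' (h.hasWeakDeriv ht) (l2Norm_profileAt ht f).le ?_ ?_
  · rw [l2HsNorm_profileAt ht]
    exact h.l2HsNorm_le_xPlusNorm _
  · refine le_trans (le_of_eq ?_) (h.l2Norm_le_xPlusNorm (3 * α))
    rw [← l2Norm_profileAt ht g, l2Norm_eq, l2Norm_eq, l2Sq, l2Sq]
    congr 2
    ext p
    rw [enorm_mul]
    simp [← ofReal_norm]

/-- Functions in `X⁺` are bounded. -/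
theorem IsLx.ae_enorm_sq_le (hd : 1 ≤ d) {α : ℝ} (hα : (d : ℝ) / 2 < α) {t : ℝ} (ht : 0 < t)
    {f g : ℝ → Torus d → ℂ} (hf : InL2 f) (hs : l2HsNorm (3 * α) f < ⊤) (h : IsLx t f g) :
    ∀ᵐ p : ℝ × Torus d, ‖f p.1 p.2‖ₑ ^ 2 ≤ ENNReal.ofReal t⁻¹ * (supConst d α *
      (l2Norm f ^ (1 / 3 : ℝ) * xPlusNorm (3 * α) t f ^ (5 / 3 : ℝ))) := by
  obtain ⟨W, hW, hfW⟩ := h.exists_profileBounds hd hα ht hf hs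
  have h1 := (quasiMeasurePreserving_dilation (d := d) (inv_pos.mpr ht)).ae hfW
  filter_upwards [h1] with p hp
  -- The supremum bound at `v = x / t`. The dispersive factor `t⁻¹` comes from `|w(v)|² = t |f(t
  -- v)|²`.
  have h2 := hW.sup_le (t⁻¹ * p.1) p.2
  rw [← hp, enorm_profileAt_sq ht, mul_inv_cancel_left₀ ht.ne'] at h2
  calc ‖f p.1 p.2‖ₑ ^ 2 = ENNReal.ofReal t⁻¹ * (ENNReal.ofReal t * ‖f p.1 p.2‖ₑ ^ 2) := by
        rw [← mul_assoc, mul_comm (ENNReal.ofReal t⁻¹), ofReal_mul_ofReal_inv ht, one_mul]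
    _ ≤ _ := by gcongr

end NLSCylinder
end

/-! ### Convolutions at scale `1 / N` and the bounds on the error term. -/

noncomputable section

namespace NLSCylinder

open Set

variable {d : ℕ}

/-- The convolution in the first variable with the kernel `N K(N ·)`. -/
def convolve (K : ℝ → ℂ) (N : ℝ) (h : ℝ → Torus d → ℂ) (v : ℝ) (y : Torus d) : ℂ :=
  ∫ s, K s * h (v - s / N) y

theorem integrable_mul_of_bounded {K : ℝ → ℂ} (hK : Integrable K) {h : ℝ → ℂ} (hh : Continuous h)
    {M : ℝ} (hM : ∀ s, ‖h s‖ ≤ M) : Integrable fun s => K s * h s :=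
  hK.mul_bdd (c := M) hh.aestronglyMeasurable (Eventually.of_forall hM)

theorem aemeasurable_enorm_mul {K : ℝ → ℂ} (hK : Integrable K) {g : ℝ → ℝ≥0∞}
    (hg : AEMeasurable g) : AEMeasurable fun s => ‖K s‖ₑ * g s :=
  hK.1.enorm.mul hg

theorem continuous_integral_kernel {Y : Type*} [TopologicalSpace Y] [FirstCountableTopology Y]
    {K : ℝ → ℂ} (hK : Integrable K) {H : ℝ → Y → ℂ} (hH : Continuous fun p : ℝ × Y => H p.1 p.2)
    {M : ℝ} (hM : ∀ s y, ‖H s y‖ ≤ M) : Continuous fun y => ∫ s, K s * H s y := by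
  refine continuous_of_dominated (bound := fun s => ‖K s‖ * M) (fun y => ?_)
    (fun y => Eventually.of_forall fun s => ?_) (hK.norm.mul_const M)
    (Eventually.of_forall fun s => ?_)
  · exact hK.1.mul (hH.comp (Continuous.prodMk_left y)).aestronglyMeasurable
  · rw [norm_mul]
    gcongr
    exact hM s y
  · exact continuous_const.mul (hH.comp (Continuous.prodMk_right s))

theorem continuous_convolve {K : ℝ → ℂ} (hK : Integrable K) (N : ℝ) {h : ℝ → Torus d → ℂ}
    (hh : Continuous fun p : ℝ × Torus d => h p.1 p.2) {M : ℝ} (hM : ∀ v y, ‖h v y‖ ≤ M) :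
    Continuous fun p : ℝ × Torus d => convolve K N h p.1 p.2 := by
  refine continuous_integral_kernel (H := fun s (p : ℝ × Torus d) => h (p.1 - s / N) p.2) hK ?_
    (fun s p => hM _ _)
  exact hh.comp (by fun_prop : Continuous fun p : ℝ × ℝ × Torus d => (p.2.1 - p.1 / N, p.2.2))

/-- Cauchy–Schwarz for the measure `|K| ds`. The right side is linear in `|h|²`, so Minkowski-type
bounds in Hilbert norms follow by Tonelli's theorem. -/
theorem enorm_integral_kernel_sq_le {K : ℝ → ℂ} (hK : Integrable K) {h : ℝ → ℂ}
    (hh : Continuous h) :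
    ‖∫ s, K s * h s‖ₑ ^ 2 ≤ (∫⁻ s, ‖K s‖ₑ) * ∫⁻ s, ‖K s‖ₑ * ‖h s‖ₑ ^ 2 := by
  calc ‖∫ s, K s * h s‖ₑ ^ 2 ≤ (∫⁻ s, ‖K s‖ₑ * ‖h s‖ₑ) ^ 2 := by
        gcongr
        simpa only [enorm_mul] using enorm_integral_le_lintegral_enorm fun s => K s * h s
    _ ≤ _ := lintegral_mul_sq_le_weight hK.1.enorm hh.enorm.aemeasurable

theorem torusCoeff_integral_kernel {K : ℝ → ℂ} (hK : Integrable K) {H : ℝ → Torus d → ℂ}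
    (hH : Continuous fun p : ℝ × Torus d => H p.1 p.2) {M : ℝ} (hM : ∀ s y, ‖H s y‖ ≤ M)
    (k : Fin d → ℤ) :
    torusCoeff (fun y => ∫ s, K s * H s y) k = ∫ s, K s * torusCoeff (H s) k := by
  have hint : Integrable (Function.uncurry fun (y : Torus d) (s : ℝ) =>
      K s * H s y * torusChar (-k) y) (volume.prod volume) := by
    have h1 : Integrable (fun p : Torus d × ℝ => (torusChar (-k) p.1) * K p.2)
        (volume.prod volume) :=
      (Continuous.integrable_torus (continuous_torusChar (-k))).mul_prod hK
    have h2 : Continuous fun p : Torus d × ℝ => H p.2 p.1 := hH.comp continuous_swap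
    refine (h1.mul_bdd (c := M) h2.aestronglyMeasurable
      (Eventually.of_forall fun p => hM _ _)).congr (Eventually.of_forall fun p => ?_)
    simp only [Function.uncurry]
    ring
  have hsw := integral_integral_swap hint
  simp only [torusCoeff_eq]
  simp only [← integral_mul_const]
  rw [hsw, ← integral_const_mul]
  congr 1
  ext s
  rw [← integral_const_mul, ← integral_const_mul, ← integral_const_mul]
  congr 1
  ext y
  ring

/-- Minkowski's inequality in `H^s`, in quadratic form. -/
theorem hsSq_integral_kernel_le (s : ℝ) {K : ℝ → ℂ} (hK : Integrable K) {H : ℝ → Torus d → ℂ}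
    (hH : Continuous fun p : ℝ × Torus d => H p.1 p.2) {M : ℝ} (hM : ∀ s y, ‖H s y‖ ≤ M) :
    hsSq s (fun y => ∫ r, K r * H r y) ≤ (∫⁻ r, ‖K r‖ₑ) * ∫⁻ r, ‖K r‖ₑ * hsSq s (H r) := by
  have hc : ∀ k, Continuous fun r => torusCoeff (H r) k := by
    intro k
    simp only [torusCoeff_eq]
    refine continuous_const.mul (continuous_of_dominated (bound := fun _ => M) (fun r => ?_)
      (fun r => Eventually.of_forall fun y => ?_) (integrable_const M)
      (Eventually.of_forall fun y => ?_))
    · exact ((hH.comp (Continuous.prodMk_right r)).mul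
        (continuous_torusChar (-k))).aestronglyMeasurable
    · rw [norm_mul, norm_torusChar, mul_one]
      exact hM r y
    · exact (hH.comp (Continuous.prodMk_left y)).mul continuous_const
  unfold hsSq
  calc _ ≤ ∑' k, hsWeight s k * ((∫⁻ r, ‖K r‖ₑ) * ∫⁻ r, ‖K r‖ₑ * ‖torusCoeff (H r) k‖ₑ ^ 2) := by
        refine ENNReal.tsum_le_tsum fun k => ?_
        rw [torusCoeff_integral_kernel hK hH hM]
        gcongr
        exact enorm_integral_kernel_sq_le hK (hc k)
    _ = (∫⁻ r, ‖K r‖ₑ) * ∑' k, ∫⁻ r, ‖K r‖ₑ * (hsWeight s k * ‖torusCoeff (H r) k‖ₑ ^ 2) := by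
        rw [← ENNReal.tsum_mul_left]
        refine tsum_congr fun k => ?_
        rw [mul_left_comm, ← lintegral_const_mul' _ _ (hsWeight_ne_top s k)]
        congr 2
        ext r
        ring
    _ = _ := by
        rw [← lintegral_tsum fun k =>
          aemeasurable_enorm_mul hK (((hc k).enorm.measurable.pow_const 2).const_mul _).aemeasurable]
        simp only [ENNReal.tsum_mul_left]

/-- Minkowski's inequality in `L²(ℝ × 𝕋^d)`, in quadratic form. -/
theorem l2Sq_integral_kernel_le {K : ℝ → ℂ} (hK : Integrable K) {H : ℝ → ℝ → Torus d → ℂ}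
    (hH : Continuous fun p : ℝ × ℝ × Torus d => H p.1 p.2.1 p.2.2) :
    l2Sq (fun v y => ∫ r, K r * H r v y) ≤ (∫⁻ r, ‖K r‖ₑ) * ∫⁻ r, ‖K r‖ₑ * l2Sq (H r) := by
  have hm : AEMeasurable (Function.uncurry fun (p : ℝ × Torus d) (r : ℝ) =>
      ‖K r‖ₑ * ‖H r p.1 p.2‖ₑ ^ 2) (volume.prod volume) := by
    refine AEMeasurable.mul (hK.1.enorm.comp_snd) ?_
    exact ((hH.comp continuous_swap).enorm.measurable.pow_const 2).aemeasurable
  have hK1 : ∫⁻ r, ‖K r‖ₑ ≠ ⊤ := hK.2.ne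
  calc l2Sq (fun v y => ∫ r, K r * H r v y)
      ≤ ∫⁻ p : ℝ × Torus d, (∫⁻ r, ‖K r‖ₑ) * ∫⁻ r, ‖K r‖ₑ * ‖H r p.1 p.2‖ₑ ^ 2 :=
        lintegral_mono fun p => enorm_integral_kernel_sq_le hK
          (hH.comp (Continuous.prodMk_left (p.1, p.2)))
    _ = (∫⁻ r, ‖K r‖ₑ) * ∫⁻ r, ∫⁻ p : ℝ × Torus d, ‖K r‖ₑ * ‖H r p.1 p.2‖ₑ ^ 2 := by
        rw [lintegral_const_mul' _ _ hK1, lintegral_lintegral_swap hm]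
    _ = _ := by
        congr 2
        ext r
        rw [lintegral_const_mul' _ _ (enorm_ne_top), l2Sq]

/-- The source of all the gain: comparing a convolution with its mean leaves only increments of `h`
over distance `s / N`. -/
theorem mean_mul_sub_convolve {K : ℝ → ℂ} (hK : Integrable K) (N : ℝ) {h : ℝ → Torus d → ℂ}
    (hh : Continuous fun p : ℝ × Torus d => h p.1 p.2) {M : ℝ} (hM : ∀ v y, ‖h v y‖ ≤ M)
    (v : ℝ) (y : Torus d) :
    (∫ s, K s) * h v y - convolve K N h v y = ∫ s, K s * (h v y - h (v - s / N) y) := by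
  simp only [mul_sub]
  have h2 : Continuous fun s : ℝ => h (v - s / N) y :=
    hh.comp (by fun_prop : Continuous fun s : ℝ => (v - s / N, y))
  rw [integral_sub (hK.mul_const _) (integrable_mul_of_bounded hK h2 fun s => hM _ _),
    integral_mul_const, convolve]

/-- Hölder exponent `1/6` for the norm is `1/3` for its square, whence the moment of order `1/3` of
the kernel and the factor `N^{-1/3}`. -/
theorem hsSq_sub_convolve_le (α : ℝ) {K : ℝ → ℂ} (hK : Integrable K) {N : ℝ} (hN : 0 < N)
    {h : ℝ → Torus d → ℂ} (hh : Continuous fun p : ℝ × Torus d => h p.1 p.2) {M : ℝ}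
    (hM : ∀ v y, ‖h v y‖ ≤ M) {A : ℝ≥0∞} (hA : ∀ v v', hsSq α (fun y => h v y - h v' y)
      ≤ ENNReal.ofReal |v - v'| ^ (1 / 3 : ℝ) * A) (v : ℝ) :
    hsSq α (fun y => (∫ s, K s) * h v y - convolve K N h v y)
      ≤ (∫⁻ s, ‖K s‖ₑ) * (∫⁻ s, ‖K s‖ₑ * ENNReal.ofReal |s| ^ (1 / 3 : ℝ))
        * (ENNReal.ofReal N⁻¹ ^ (1 / 3 : ℝ) * A) := by
  simp only [mean_mul_sub_convolve hK N hh hM]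
  refine (hsSq_integral_kernel_le α (H := fun s y => h v y - h (v - s / N) y) hK ?_
    (M := M + M) fun s y => (norm_sub_le _ _).trans (add_le_add (hM _ _) (hM _ _))).trans ?_
  · exact (hh.comp (by fun_prop : Continuous fun p : ℝ × Torus d => (v, p.2))).sub
      (hh.comp (by fun_prop : Continuous fun p : ℝ × Torus d => (v - p.1 / N, p.2)))
  · rw [mul_assoc]
    gcongr
    rw [← lintegral_mul_const'' _ (aemeasurable_enorm_mul hK (by fun_prop))]
    refine lintegral_mono fun s => ?_
    rw [mul_assoc]
    gcongr
    refine (hA _ _).trans (le_of_eq ?_)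
    rw [sub_sub_cancel, abs_div, abs_of_pos hN, div_eq_mul_inv, ENNReal.ofReal_mul (abs_nonneg _),
      ENNReal.mul_rpow_of_nonneg _ _ (by norm_num), mul_assoc]

theorem l2Sq_sub_convolve_le {K : ℝ → ℂ} (hK : Integrable K) (N : ℝ)
    {h : ℝ → Torus d → ℂ} (hh : Continuous fun p : ℝ × Torus d => h p.1 p.2) {M : ℝ}
    (hM : ∀ v y, ‖h v y‖ ≤ M) {A : ℝ≥0∞} (hA : ∀ z, l2Sq (fun v y => h v y - h (v - z) y)
      ≤ ENNReal.ofReal (z ^ 2) * A) :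
    l2Sq (fun v y => (∫ s, K s) * h v y - convolve K N h v y)
      ≤ (∫⁻ s, ‖K s‖ₑ) * (∫⁻ s, ‖K s‖ₑ * ENNReal.ofReal (s ^ 2))
        * (ENNReal.ofReal (N⁻¹ ^ 2) * A) := by
  simp only [mean_mul_sub_convolve hK N hh hM]
  refine (l2Sq_integral_kernel_le (H := fun s v y => h v y - h (v - s / N) y) hK ?_).trans ?_
  · exact (hh.comp (by fun_prop : Continuous fun p : ℝ × ℝ × Torus d => (p.2.1, p.2.2))).sub
      (hh.comp (by fun_prop : Continuous fun p : ℝ × ℝ × Torus d => (p.2.1 - p.1 / N, p.2.2)))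
  · rw [mul_assoc]
    gcongr
    rw [← lintegral_mul_const'' _ (aemeasurable_enorm_mul hK (by fun_prop))]
    refine lintegral_mono fun s => ?_
    rw [mul_assoc]
    gcongr
    refine (hA _).trans (le_of_eq ?_)
    rw [div_eq_mul_inv, mul_pow, ENNReal.ofReal_mul (sq_nonneg _), mul_assoc]

theorem hsSq_convolve_le (α : ℝ) {K : ℝ → ℂ} (hK : Integrable K) (N : ℝ)
    {h : ℝ → Torus d → ℂ} (hh : Continuous fun p : ℝ × Torus d => h p.1 p.2) {M : ℝ}
    (hM : ∀ v y, ‖h v y‖ ≤ M) {A : ℝ≥0∞} (hA : ∀ v, hsSq α (h v) ≤ A) (v : ℝ) :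
    hsSq α (convolve K N h v) ≤ (∫⁻ s, ‖K s‖ₑ) ^ 2 * A := by
  refine (hsSq_integral_kernel_le α (H := fun s y => h (v - s / N) y) hK ?_
    fun s y => hM _ _).trans ?_
  · exact hh.comp (by fun_prop : Continuous fun p : ℝ × Torus d => (v - p.1 / N, p.2))
  · rw [sq, mul_assoc]
    gcongr
    rw [← lintegral_mul_const'' _ hK.1.enorm]
    refine lintegral_mono fun s => ?_
    gcongr
    exact hA _

theorem enorm_convolve_sq_le {K : ℝ → ℂ} (hK : Integrable K) (N : ℝ)
    {h : ℝ → Torus d → ℂ} (hh : Continuous fun p : ℝ × Torus d => h p.1 p.2)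
    {A : ℝ≥0∞} (hA : ∀ v y, ‖h v y‖ₑ ^ 2 ≤ A) (v : ℝ) (y : Torus d) :
    ‖convolve K N h v y‖ₑ ^ 2 ≤ (∫⁻ s, ‖K s‖ₑ) ^ 2 * A := by
  refine (enorm_integral_kernel_sq_le (h := fun s => h (v - s / N) y) hK ?_).trans ?_
  · exact hh.comp (by fun_prop : Continuous fun s : ℝ => (v - s / N, y))
  · rw [sq, mul_assoc]
    gcongr
    rw [← lintegral_mul_const'' _ hK.1.enorm]
    refine lintegral_mono fun s => ?_
    gcongr
    exact hA _ _

theorem exists_norm_le {h : ℝ → Torus d → ℂ} {A : ℝ≥0∞} (hA : A ≠ ⊤)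
    (hh : ∀ v y, ‖h v y‖ₑ ^ 2 ≤ A) : ∃ M : ℝ, ∀ v y, ‖h v y‖ ≤ M := by
  refine ⟨Real.sqrt A.toReal, fun v y => Real.le_sqrt_of_sq_le ?_⟩
  have := ENNReal.toReal_mono hA (hh v y)
  simpa using this

theorem enorm_cubic_sub_sq_le {a b : ℂ} {A : ℝ≥0∞} (hA : A ≠ ⊤) (ha : ‖a‖ₑ ^ 2 ≤ A)
    (hb : ‖b‖ₑ ^ 2 ≤ A) : ‖cubic a - cubic b‖ₑ ^ 2 ≤ 9 * A ^ 2 * ‖a - b‖ₑ ^ 2 := by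
  have h1 : ∀ z : ℂ, ‖z‖ₑ ^ 2 ≤ A → ‖z‖ ≤ Real.sqrt A.toReal := fun z hz =>
    Real.le_sqrt_of_sq_le (by simpa using ENNReal.toReal_mono hA hz)
  have h2 := norm_cubic_sub_le a b (h1 a ha) (h1 b hb)
  rw [Real.sq_sqrt ENNReal.toReal_nonneg] at h2
  have h3 := ENNReal.ofReal_le_ofReal h2
  rw [ENNReal.ofReal_mul (by positivity), ENNReal.ofReal_mul (by positivity),
    ENNReal.ofReal_toReal hA, ofReal_norm, ofReal_norm] at h3
  calc ‖cubic a - cubic b‖ₑ ^ 2 ≤ (ENNReal.ofReal 3 * A * ‖a - b‖ₑ) ^ 2 := by gcongr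
    _ = _ := by
        rw [mul_pow, mul_pow]
        norm_num

theorem l2Sq_add_le {f g : ℝ → Torus d → ℂ}
    (hf : AEStronglyMeasurable (fun p : ℝ × Torus d => f p.1 p.2)) :
    l2Sq (fun v y => f v y + g v y) ≤ 2 * (l2Sq f + l2Sq g) := by
  unfold l2Sq
  rw [← lintegral_add_left' (hf.enorm.pow_const 2), ← lintegral_const_mul' _ _ (by norm_num)]
  exact lintegral_mono fun p => enorm_add_sq_le _ _

theorem l2Sq_const_mul (c : ℂ) (f : ℝ → Torus d → ℂ) :
    l2Sq (fun v y => c * f v y) = ‖c‖ₑ ^ 2 * l2Sq f := by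
  unfold l2Sq
  rw [← lintegral_const_mul' _ _ (by finiteness)]
  simp only [enorm_mul, mul_pow]

theorem l2Sq_neg (f : ℝ → Torus d → ℂ) : l2Sq (fun v y => -f v y) = l2Sq f := by
  simp [l2Sq]

/-- The error term `(P F - |γ|² γ + B * W) / t` with `F = |W|² W` and `γ = P W`. -/
def errorTerm (P B : ℝ → ℂ) (t : ℝ) (W : ℝ → Torus d → ℂ) (v : ℝ) (y : Torus d) : ℂ :=
  (t : ℂ)⁻¹ * (convolve P (Real.sqrt t) (fun v y => cubic (W v y)) v y
    - cubic (convolve P (Real.sqrt t) W v y) + convolve B (Real.sqrt t) W v y)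

/-- Inserting `∫ P = 1` and `∫ B = 0` exhibits two of the three brackets as a mean minus a
convolution. The middle one is a Lipschitz difference of `W` and `P W`. -/
theorem errorTerm_eq {P B : ℝ → ℂ} (hP : ∫ s, P s = 1) (hB : ∫ s, B s = 0) (t : ℝ)
    (W : ℝ → Torus d → ℂ) (v : ℝ) (y : Torus d) :
    errorTerm P B t W v y = (t : ℂ)⁻¹ *
      (-((∫ s, P s) * cubic (W v y) - convolve P (Real.sqrt t) (fun v y => cubic (W v y)) v y)
        + ((cubic (W v y) - cubic (convolve P (Real.sqrt t) W v y))
          + -((∫ s, B s) * W v y - convolve B (Real.sqrt t) W v y))) := by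
  rw [errorTerm, hP, hB]
  ring

section ErrorBounds

variable {α : ℝ} {U X : ℝ≥0∞} {W : ℝ → Torus d → ℂ}

theorem ProfileBounds.exists_norm_le (hd : 1 ≤ d) (hα : (d : ℝ) / 2 < α) (hU : U ≠ ⊤) (hX : X ≠ ⊤)
    (hW : ProfileBounds α U X W) : ∃ M : ℝ, ∀ v y, ‖W v y‖ ≤ M :=
  NLSCylinder.exists_norm_le (ENNReal.mul_ne_top (supConst_ne_top hd hα)
    (ENNReal.mul_ne_top (ENNReal.rpow_ne_top_of_nonneg (by norm_num) hU)
      (ENNReal.rpow_ne_top_of_nonneg (by norm_num) hX))) hW.sup_le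

theorem exists_norm_cubic_le {h : ℝ → Torus d → ℂ} (hM : ∃ M : ℝ, ∀ v y, ‖h v y‖ ≤ M) :
    ∃ M : ℝ, ∀ v y, ‖cubic (h v y)‖ ≤ M := by
  obtain ⟨M, hM⟩ := hM
  refine ⟨M ^ 3, fun v y => ?_⟩
  rw [norm_cubic]
  gcongr
  exact hM v y

theorem continuous_errorTerm {P B : ℝ → ℂ} (hP : Integrable P) (hB : Integrable B) (t : ℝ)
    (hW : Continuous fun p : ℝ × Torus d => W p.1 p.2) (hM : ∃ M : ℝ, ∀ v y, ‖W v y‖ ≤ M) :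
    Continuous fun p : ℝ × Torus d => errorTerm P B t W p.1 p.2 := by
  obtain ⟨M', hM'⟩ := exists_norm_cubic_le hM
  obtain ⟨M, hM⟩ := hM
  exact continuous_const.mul (((continuous_convolve hP _ (continuous_cubic.comp hW) hM').sub
    (continuous_cubic.comp (continuous_convolve hP _ hW hM))).add (continuous_convolve hB _ hW hM))

theorem exists_errorTerm_bounds (hd : 1 ≤ d) (hα : (d : ℝ) / 2 < α) {P B : ℝ → ℂ}
    (hP : Integrable P) (hB : Integrable B) (hP1 : ∫ s, P s = 1) (hB0 : ∫ s, B s = 0)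
    (hP2 : ∫⁻ s, ‖P s‖ₑ * ENNReal.ofReal (s ^ 2) ≠ ⊤)
    (hB2 : ∫⁻ s, ‖B s‖ₑ * ENNReal.ofReal (s ^ 2) ≠ ⊤)
    (hP3 : ∫⁻ s, ‖P s‖ₑ * ENNReal.ofReal |s| ^ (1 / 3 : ℝ) ≠ ⊤)
    (hB3 : ∫⁻ s, ‖B s‖ₑ * ENNReal.ofReal |s| ^ (1 / 3 : ℝ) ≠ ⊤) :
    ∃ C : ℝ≥0∞, C ≠ ⊤ ∧ ∀ t : ℝ, 0 < t → ∀ U X : ℝ≥0∞, U ≠ ⊤ → X ≠ ⊤ →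
      ∀ W : ℝ → Torus d → ℂ, ProfileBounds α U X W →
        l2Sq (errorTerm P B t W) ≤ C * (‖(t : ℂ)⁻¹‖ₑ ^ 2 * ENNReal.ofReal ((Real.sqrt t)⁻¹ ^ 2)
          * ((U ^ (1 / 3 : ℝ) * X ^ (5 / 3 : ℝ)) ^ 2 + 1) * X ^ 2) ∧
        ∀ v, hsSq α (errorTerm P B t W v) ≤ C * (‖(t : ℂ)⁻¹‖ₑ ^ 2
          * ENNReal.ofReal (Real.sqrt t)⁻¹ ^ (1 / 3 : ℝ)
          * ((U ^ (1 / 3 : ℝ) * X ^ (5 / 3 : ℝ)) ^ 2 + 1) * X ^ 2) := by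
  have hα0 : 0 ≤ α := le_trans (by positivity) hα.le
  set p := ∫⁻ s, ‖P s‖ₑ with hp
  set b := ∫⁻ s, ‖B s‖ₑ with hb
  set p2 := ∫⁻ s, ‖P s‖ₑ * ENNReal.ofReal (s ^ 2)
  set b2 := ∫⁻ s, ‖B s‖ₑ * ENNReal.ofReal (s ^ 2)
  set p3 := ∫⁻ s, ‖P s‖ₑ * ENNReal.ofReal |s| ^ (1 / 3 : ℝ)
  set b3 := ∫⁻ s, ‖B s‖ₑ * ENNReal.ofReal |s| ^ (1 / 3 : ℝ)
  have hpf : p ≠ ⊤ := hP.2.ne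
  have hbf : b ≠ ⊤ := hB.2.ne
  set S := supConst d α
  set A := algConst d α
  have hSf : S ≠ ⊤ := supConst_ne_top hd hα
  have hAf : A ≠ ⊤ := algConst_ne_top hd hα
  -- The first bracket carries `2` and the other two `4`, from splitting the sum of three terms in
  -- two stages. The factors `9 S²` and `10 A²` are the Lipschitz constants of the cubic in `L²` and
  -- in `H^α`, and `16` and `256` come from `ProfileBounds`.
  set C1 : ℝ≥0∞ := 2 * (p * p2 * (9 * S ^ 2))
    + 4 * (9 * ((1 + p ^ 2) * S) ^ 2 * (p * p2)) + 4 * (b * b2) with hC1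
  set C2 : ℝ≥0∞ := 2 * (p * p3 * (10 * A ^ 2 * 16 * 256))
    + 4 * (10 * A ^ 2 * ((1 + p ^ 2) * 4) ^ 2 * (p * p3 * 256)) + 4 * (b * b3 * 256) with hC2
  refine ⟨C1 + C2, by rw [hC1, hC2]; finiteness, fun t ht U X hU hX W hW => ?_⟩
  set Q : ℝ≥0∞ := U ^ (1 / 3 : ℝ) * X ^ (5 / 3 : ℝ) with hQ
  have hQf : Q ≠ ⊤ := ENNReal.mul_ne_top (ENNReal.rpow_ne_top_of_nonneg (by norm_num) hU)
    (ENNReal.rpow_ne_top_of_nonneg (by norm_num) hX)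
  have hN : 0 < Real.sqrt t := Real.sqrt_pos.mpr ht
  set N := Real.sqrt t with hNdef
  have hMW := hW.exists_norm_le hd hα hU hX
  obtain ⟨M', hM'⟩ := exists_norm_cubic_le hMW
  obtain ⟨M, hM⟩ := hMW
  have hFc : Continuous fun p : ℝ × Torus d => cubic (W p.1 p.2) := continuous_cubic.comp hW.continuous
  have hγc := continuous_convolve hP N hW.continuous hM
  have hWv : ∀ v, Continuous (W v) := fun v => hW.continuous.comp (Continuous.prodMk_right v)
  have hγv : ∀ v, Continuous (convolve P N W v) := fun v => hγc.comp (Continuous.prodMk_right v)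
  have hPFc := continuous_convolve hP N hFc hM'
  have hBWc := continuous_convolve hB N hW.continuous hM
  have c1 : Continuous fun q : ℝ × Torus d =>
      -((∫ s, P s) * cubic (W q.1 q.2) - convolve P N (fun v y => cubic (W v y)) q.1 q.2) :=
    ((continuous_const.mul hFc).sub hPFc).neg
  have c2 : Continuous fun q : ℝ × Torus d => cubic (W q.1 q.2) - cubic (convolve P N W q.1 q.2) :=
    hFc.sub (continuous_cubic.comp hγc)
  have c3 : Continuous fun q : ℝ × Torus d =>
      -((∫ s, B s) * W q.1 q.2 - convolve B N W q.1 q.2) :=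
    ((continuous_const.mul hW.continuous).sub hBWc).neg
  have eqE : errorTerm P B t W = fun v y => (t : ℂ)⁻¹ *
      (-((∫ s, P s) * cubic (W v y) - convolve P N (fun v y => cubic (W v y)) v y)
        + ((cubic (W v y) - cubic (convolve P N W v y))
          + -((∫ s, B s) * W v y - convolve B N W v y))) := by
    funext v y
    exact errorTerm_eq hP1 hB0 t W v y
  have hle1 : Q ^ 2 ≤ Q ^ 2 + 1 := le_self_add
  have hle2 : 1 ≤ Q ^ 2 + 1 := le_add_self
  constructor
  · set δ := ENNReal.ofReal (N⁻¹ ^ 2) with hδ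
    have i1 : l2Sq (fun v y => (∫ s, P s) * cubic (W v y)
        - convolve P N (fun v y => cubic (W v y)) v y) ≤ p * p2 * (δ * (9 * (S * Q) ^ 2 * X ^ 2)) := by
      refine l2Sq_sub_convolve_le hP N hFc hM' fun z => ?_
      calc l2Sq (fun v y => cubic (W v y) - cubic (W (v - z) y))
          ≤ ∫⁻ q : ℝ × Torus d, 9 * (S * Q) ^ 2 * ‖W q.1 q.2 - W (q.1 - z) q.2‖ₑ ^ 2 :=
            lintegral_mono fun q => enorm_cubic_sub_sq_le (by finiteness) (hW.sup_le _ _)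
              (hW.sup_le _ _)
        _ = 9 * (S * Q) ^ 2 * l2Sq (fun v y => W v y - W (v - z) y) := by
            rw [lintegral_const_mul' _ _ (by finiteness), l2Sq]
        _ ≤ 9 * (S * Q) ^ 2 * (ENNReal.ofReal (z ^ 2) * X ^ 2) := by
            gcongr
            exact hW.translate z
        _ = _ := by ring
    have i2 : l2Sq (fun v y => cubic (W v y) - cubic (convolve P N W v y))
        ≤ 9 * ((1 + p ^ 2) * S * Q) ^ 2 * (p * p2 * (δ * X ^ 2)) := by
      have j1 : l2Sq (fun v y => W v y - convolve P N W v y) ≤ p * p2 * (δ * X ^ 2) := by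
        have := l2Sq_sub_convolve_le hP N hW.continuous hM hW.translate
        simpa only [hP1, one_mul] using this
      -- The factor `1 + p²` dominates both `1`, for `W`, and `p²`, for its convolution, so one
      -- bound serves both arguments of the cubic.
      have j2 : (1 + p ^ 2) * S * Q ≠ ⊤ := by finiteness
      calc _ ≤ ∫⁻ q : ℝ × Torus d, 9 * ((1 + p ^ 2) * S * Q) ^ 2
            * ‖W q.1 q.2 - convolve P N W q.1 q.2‖ₑ ^ 2 := by
            refine lintegral_mono fun q => enorm_cubic_sub_sq_le j2 ?_ ?_
            · refine (hW.sup_le _ _).trans ?_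
              rw [mul_assoc]
              exact le_mul_of_one_le_left' le_self_add
            · refine (enorm_convolve_sq_le hP N hW.continuous hW.sup_le _ _).trans ?_
              rw [mul_assoc (1 + p ^ 2)]
              gcongr
              exact le_add_self
        _ = 9 * ((1 + p ^ 2) * S * Q) ^ 2 * l2Sq (fun v y => W v y - convolve P N W v y) := by
            rw [lintegral_const_mul' _ _ (by finiteness), l2Sq]
        _ ≤ _ := by gcongr
    have i3 : l2Sq (fun v y => (∫ s, B s) * W v y - convolve B N W v y) ≤ b * b2 * (δ * X ^ 2) :=
      l2Sq_sub_convolve_le hB N hW.continuous hM hW.translate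
    rw [eqE, l2Sq_const_mul]
    have i4 := (l2Sq_add_le
        (f := fun v y => -((∫ s, P s) * cubic (W v y) - convolve P N (fun v y => cubic (W v y)) v y))
        (g := fun v y => (cubic (W v y) - cubic (convolve P N W v y))
          + -((∫ s, B s) * W v y - convolve B N W v y)) c1.aestronglyMeasurable).trans
      (mul_le_mul_right (add_le_add_right (l2Sq_add_le
        (f := fun v y => cubic (W v y) - cubic (convolve P N W v y))
        (g := fun v y => -((∫ s, B s) * W v y - convolve B N W v y)) c2.aestronglyMeasurable) _) _)
    rw [l2Sq_neg, l2Sq_neg] at i4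
    calc _ ≤ ‖(t : ℂ)⁻¹‖ₑ ^ 2 * (2 * (p * p2 * (δ * (9 * (S * Q) ^ 2 * X ^ 2))
          + 2 * (9 * ((1 + p ^ 2) * S * Q) ^ 2 * (p * p2 * (δ * X ^ 2))
            + b * b2 * (δ * X ^ 2)))) := by
          gcongr
          exact i4.trans (by gcongr)
      _ = (2 * (p * p2 * (9 * S ^ 2)) * Q ^ 2
          + 4 * (9 * ((1 + p ^ 2) * S) ^ 2 * (p * p2)) * Q ^ 2 + 4 * (b * b2) * 1)
            * (‖(t : ℂ)⁻¹‖ₑ ^ 2 * δ * X ^ 2) := by ring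
      _ ≤ (2 * (p * p2 * (9 * S ^ 2)) * (Q ^ 2 + 1)
          + 4 * (9 * ((1 + p ^ 2) * S) ^ 2 * (p * p2)) * (Q ^ 2 + 1) + 4 * (b * b2) * (Q ^ 2 + 1))
            * (‖(t : ℂ)⁻¹‖ₑ ^ 2 * δ * X ^ 2) := by gcongr
      _ = C1 * (‖(t : ℂ)⁻¹‖ₑ ^ 2 * δ * (Q ^ 2 + 1) * X ^ 2) := by
          rw [hC1]
          ring
      _ ≤ _ := by
          gcongr
          exact le_self_add
  · intro v
    set δ := ENNReal.ofReal N⁻¹ ^ (1 / 3 : ℝ) with hδ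
    have hh : ∀ v v', hsSq α (fun y => W v y - W v' y)
        ≤ ENNReal.ofReal |v - v'| ^ (1 / 3 : ℝ) * (256 * X ^ 2) := fun v v' =>
      (hW.holder v v').trans (le_of_eq (by ring))
    have i1 : hsSq α (fun y => (∫ s, P s) * cubic (W v y)
        - convolve P N (fun v y => cubic (W v y)) v y)
        ≤ p * p3 * (δ * (10 * A ^ 2 * (4 * Q) ^ 2 * (256 * X ^ 2))) := by
      refine hsSq_sub_convolve_le α hP hN hFc hM' (fun v v' => ?_) v
      refine (hsSq_cubic_sub_le hα0 (hWv v) (hWv v') (hW.hsSq_le v) (hW.hsSq_le v')).trans ?_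
      calc _ ≤ 10 * A ^ 2 * (4 * Q) ^ 2
            * (ENNReal.ofReal |v - v'| ^ (1 / 3 : ℝ) * (256 * X ^ 2)) := by
            gcongr
            exact hh v v'
        _ = _ := by ring
    have i2 : hsSq α (fun y => cubic (W v y) - cubic (convolve P N W v y))
        ≤ 10 * A ^ 2 * ((1 + p ^ 2) * (4 * Q)) ^ 2 * (p * p3 * (δ * (256 * X ^ 2))) := by
      have j1 : hsSq α (fun y => W v y - convolve P N W v y) ≤ p * p3 * (δ * (256 * X ^ 2)) := by
        have := hsSq_sub_convolve_le α hP hN hW.continuous hM hh v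
        simpa only [hP1, one_mul] using this
      -- Again a common bound for `W` and its convolution, now in `H^α`.
      refine (hsSq_cubic_sub_le (M := (1 + p ^ 2) * (4 * Q)) hα0 (hWv v) (hγv v) ?_ ?_).trans ?_
      · exact (hW.hsSq_le v).trans (le_mul_of_one_le_left' le_self_add)
      · refine (hsSq_convolve_le α hP N hW.continuous hM hW.hsSq_le v).trans ?_
        gcongr
        exact le_add_self
      · gcongr
    have i3 : hsSq α (fun y => (∫ s, B s) * W v y - convolve B N W v y)
        ≤ b * b3 * (δ * (256 * X ^ 2)) :=
      hsSq_sub_convolve_le α hB hN hW.continuous hM hh v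
    have ci : ∀ h : ℝ × Torus d → ℂ, Continuous h → Integrable fun y => h (v, y) := fun h hc =>
      Continuous.integrable_torus (hc.comp (Continuous.prodMk_right v))
    rw [eqE, hsSq_const_mul]
    have i4 := (hsSq_add_le α (ci _ c1) ((ci _ c2).add (ci _ c3))).trans
      (mul_le_mul_right (add_le_add_right (hsSq_add_le α (ci _ c2) (ci _ c3)) _) _)
    rw [hsSq_neg, hsSq_neg] at i4
    calc _ ≤ ‖(t : ℂ)⁻¹‖ₑ ^ 2 * (2 * (p * p3 * (δ * (10 * A ^ 2 * (4 * Q) ^ 2 * (256 * X ^ 2)))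
          + 2 * (10 * A ^ 2 * ((1 + p ^ 2) * (4 * Q)) ^ 2 * (p * p3 * (δ * (256 * X ^ 2)))
            + b * b3 * (δ * (256 * X ^ 2))))) := by
          gcongr
          exact i4.trans (by gcongr)
      _ = (2 * (p * p3 * (10 * A ^ 2 * 16 * 256)) * Q ^ 2
          + 4 * (10 * A ^ 2 * ((1 + p ^ 2) * 4) ^ 2 * (p * p3 * 256)) * Q ^ 2
            + 4 * (b * b3 * 256) * 1) * (‖(t : ℂ)⁻¹‖ₑ ^ 2 * δ * X ^ 2) := by ring
      _ ≤ (2 * (p * p3 * (10 * A ^ 2 * 16 * 256)) * (Q ^ 2 + 1)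
          + 4 * (10 * A ^ 2 * ((1 + p ^ 2) * 4) ^ 2 * (p * p3 * 256)) * (Q ^ 2 + 1)
            + 4 * (b * b3 * 256) * (Q ^ 2 + 1)) * (‖(t : ℂ)⁻¹‖ₑ ^ 2 * δ * X ^ 2) := by gcongr
      _ = C2 * (‖(t : ℂ)⁻¹‖ₑ ^ 2 * δ * (Q ^ 2 + 1) * X ^ 2) := by
          rw [hC2]
          ring
      _ ≤ _ := by
          gcongr
          exact le_add_self

end ErrorBounds

end NLSCylinder
end

/-! ### Rapidly decaying kernels and the commutator kernel. -/

noncomputable section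

namespace NLSCylinder

open Set
open scoped SchwartzMap FourierTransform

variable {d : ℕ}

/-- Continuous functions on the line with rapid decay. -/
structure RapidDecay (f : ℝ → ℂ) : Prop where
  continuous : Continuous f
  exists_le : ∀ n : ℕ, ∃ C : ℝ, ∀ z, ‖f z‖ * (1 + z ^ 2) ^ n ≤ C

theorem RapidDecay.add {f g : ℝ → ℂ} (hf : RapidDecay f) (hg : RapidDecay g) :
    RapidDecay fun z => f z + g z := by
  refine ⟨hf.continuous.add hg.continuous, fun n => ?_⟩
  obtain ⟨C, hC⟩ := hf.exists_le n
  obtain ⟨D, hD⟩ := hg.exists_le n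
  refine ⟨C + D, fun z => ?_⟩
  calc ‖f z + g z‖ * (1 + z ^ 2) ^ n ≤ (‖f z‖ + ‖g z‖) * (1 + z ^ 2) ^ n := by
        gcongr
        exact norm_add_le _ _
    _ ≤ C + D := by
        rw [add_mul]
        exact add_le_add (hC z) (hD z)

theorem RapidDecay.const_mul {f : ℝ → ℂ} (hf : RapidDecay f) (c : ℂ) :
    RapidDecay fun z => c * f z := by
  refine ⟨continuous_const.mul hf.continuous, fun n => ?_⟩
  obtain ⟨C, hC⟩ := hf.exists_le n
  refine ⟨‖c‖ * C, fun z => ?_⟩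
  rw [norm_mul, mul_assoc]
  exact mul_le_mul_of_nonneg_left (hC z) (norm_nonneg c)

theorem RapidDecay.id_mul {f : ℝ → ℂ} (hf : RapidDecay f) :
    RapidDecay fun z => (z : ℂ) * f z := by
  refine ⟨Complex.continuous_ofReal.mul hf.continuous, fun n => ?_⟩
  obtain ⟨C, hC⟩ := hf.exists_le (n + 1)
  refine ⟨C, fun z => ?_⟩
  refine le_trans ?_ (hC z)
  rw [norm_mul, Complex.norm_real, Real.norm_eq_abs, pow_succ]
  have h1 : |z| ≤ 1 + z ^ 2 := by
    rw [← sq_abs]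
    nlinarith [sq_nonneg (|z| - 1), abs_nonneg z]
  calc |z| * ‖f z‖ * (1 + z ^ 2) ^ n ≤ (1 + z ^ 2) * ‖f z‖ * (1 + z ^ 2) ^ n := by gcongr
    _ = _ := by ring

theorem RapidDecay.integrable_mul {f : ℝ → ℂ} (hf : RapidDecay f) {w : ℝ → ℝ} (hw : Continuous w)
    {C : ℝ} {n : ℕ} (hwC : ∀ z, |w z| ≤ C * (1 + z ^ 2) ^ n) : Integrable fun z => w z * ‖f z‖ := by
  obtain ⟨D, hD⟩ := hf.exists_le (n + 1)
  refine (integrable_inv_one_add_sq.const_mul (C * D)).mono'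
    (hw.mul hf.continuous.norm).aestronglyMeasurable (Eventually.of_forall fun z => ?_)
  have hp : 0 < 1 + z ^ 2 := by positivity
  have hC : 0 ≤ C := by
    have := (abs_nonneg (w 0)).trans (hwC 0)
    simpa using this
  rw [norm_mul, norm_norm, Real.norm_eq_abs, ← div_eq_mul_inv, le_div_iff₀ hp]
  calc |w z| * ‖f z‖ * (1 + z ^ 2) ≤ C * (1 + z ^ 2) ^ n * ‖f z‖ * (1 + z ^ 2) := by
        gcongr
        exact hwC z
    _ = C * (‖f z‖ * (1 + z ^ 2) ^ (n + 1)) := by ring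
    _ ≤ C * D := mul_le_mul_of_nonneg_left (hD z) hC

theorem RapidDecay.integrable {f : ℝ → ℂ} (hf : RapidDecay f) : Integrable f := by
  have := hf.integrable_mul (w := fun _ => 1) continuous_const (C := 1) (n := 0) (by simp)
  simp only [one_mul] at this
  exact (integrable_norm_iff hf.continuous.aestronglyMeasurable).mp this

theorem RapidDecay.memLp_two {f : ℝ → ℂ} (hf : RapidDecay f) : MemLp f 2 volume := by
  rw [memLp_two_iff_integrable_sq_norm hf.continuous.aestronglyMeasurable]
  obtain ⟨C, hC⟩ := hf.exists_le 0
  have := hf.integrable_mul (w := fun z => ‖f z‖) hf.continuous.norm (C := C) (n := 0) fun z => by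
    simpa using hC z
  simpa only [sq] using this

theorem RapidDecay.lintegral_ne_top {f : ℝ → ℂ} (hf : RapidDecay f) {w : ℝ → ℝ}
    (hw : Continuous w) (hw0 : ∀ z, 0 ≤ w z) {C : ℝ} {n : ℕ}
    (hwC : ∀ z, |w z| ≤ C * (1 + z ^ 2) ^ n) :
    ∫⁻ z, ‖f z‖ₑ * ENNReal.ofReal (w z) ≠ ⊤ := by
  have h := (hf.integrable_mul hw hwC).2
  have e : ∀ z, ‖f z‖ₑ * ENNReal.ofReal (w z) = ‖w z * ‖f z‖‖ₑ := fun z => by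
    rw [enorm_mul, enorm_norm, mul_comm, Real.enorm_of_nonneg (hw0 z)]
  simp only [e]
  exact h.ne

theorem RapidDecay.lintegral_sq_ne_top {f : ℝ → ℂ} (hf : RapidDecay f) :
    ∫⁻ z, ‖f z‖ₑ * ENNReal.ofReal (z ^ 2) ≠ ⊤ :=
  hf.lintegral_ne_top (by fun_prop) (fun z => sq_nonneg z) (C := 1) (n := 1) fun z => by
    rw [abs_of_nonneg (sq_nonneg z)]
    linarith

theorem RapidDecay.lintegral_rpow_ne_top {f : ℝ → ℂ} (hf : RapidDecay f) :
    ∫⁻ z, ‖f z‖ₑ * ENNReal.ofReal |z| ^ (1 / 3 : ℝ) ≠ ⊤ := by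
  have e : ∀ z : ℝ, ENNReal.ofReal |z| ^ (1 / 3 : ℝ) = ENNReal.ofReal (|z| ^ (1 / 3 : ℝ)) :=
    fun z => ENNReal.ofReal_rpow_of_nonneg (abs_nonneg z) (by norm_num)
  simp only [e]
  refine hf.lintegral_ne_top (continuous_abs.rpow_const fun _ => Or.inr (by norm_num))
    (fun z => by positivity) (C := 1) (n := 1) fun z => ?_
  rw [abs_of_nonneg (by positivity)]
  have h1 : |z| ≤ 1 + z ^ 2 := by
    rw [← sq_abs]
    nlinarith [sq_nonneg (|z| - 1), abs_nonneg z]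
  calc |z| ^ (1 / 3 : ℝ) ≤ (1 + z ^ 2) ^ (1 / 3 : ℝ) :=
        Real.rpow_le_rpow (abs_nonneg z) h1 (by norm_num)
    _ ≤ (1 + z ^ 2) ^ (1 : ℝ) :=
        Real.rpow_le_rpow_of_exponent_le (by nlinarith [sq_nonneg z]) (by norm_num)
    _ = _ := by simp

theorem rapidDecay_schwartz (f : 𝓢(ℝ, ℂ)) : RapidDecay f := by
  refine ⟨f.continuous, fun n => ?_⟩
  have h := SchwartzMap.one_add_le_sup_seminorm_apply (𝕜 := ℝ) (m := (2 * n, 0)) (k := 2 * n)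
    (n := 0) le_rfl le_rfl f
  refine ⟨_, fun z => le_trans ?_ (h z)⟩
  rw [norm_iteratedFDeriv_zero, mul_comm, pow_mul, Real.norm_eq_abs]
  gcongr
  nlinarith [abs_nonneg z, sq_abs z]

/-- The cutoff as a Schwartz function. -/
theorem exists_schwartz_cutoff {χ : ℝ → ℝ} (hχ : IsCutoff χ) :
    ∃ f : 𝓢(ℝ, ℂ), ∀ ξ, f ξ = χ ξ := by
  have hc : HasCompactSupport χ := by
    refine HasCompactSupport.intro (isCompact_Icc (a := -2) (b := 2)) fun ξ hξ => hχ.eq_zero ξ ?_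
    by_contra h
    exact hξ (abs_le.mp (not_le.mp h).le)
  exact ⟨(hc.comp_left Complex.ofReal_zero : HasCompactSupport fun ξ => (χ ξ : ℂ)).toSchwartzMap
    (Complex.ofRealCLM.contDiff.comp hχ.smooth), fun ξ => rfl⟩

/-- The kernel of `P_{≤ 1}` is a Schwartz function with integral one, and the other kernels are
obtained from it by scaling. -/
theorem exists_kernel {χ : ℝ → ℝ} (hχ : IsCutoff χ) :
    ∃ K : 𝓢(ℝ, ℂ), ∫ s, K s = 1 ∧ ∀ N : ℝ, 0 < N → ∀ z, lpKernel χ N z = N * K (N * z) := by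
  obtain ⟨f, hf⟩ := exists_schwartz_cutoff hχ
  have h2π : (2 * Real.pi)⁻¹ ≠ 0 := inv_ne_zero Real.two_pi_pos.ne'
  have hπc : (Real.pi : ℂ) ≠ 0 := by exact_mod_cast Real.pi_ne_zero
  -- The inverse Fourier transform `𝓕⁻` has phase `e^{2π i z ξ}`, whereas `lpKernel` uses `e^{i z
  -- ξ}`; hence the dilation by `(2π)⁻¹` and the prefactor.
  set K : 𝓢(ℝ, ℂ) := (1 / (2 * (Real.pi : ℂ))) • SchwartzMap.compCLMOfContinuousLinearEquiv ℂ
    (ContinuousLinearEquiv.unitsEquivAut ℝ (Units.mk0 _ h2π)) (𝓕⁻ f) with hK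
  have hKz : ∀ z, K z = 1 / (2 * (Real.pi : ℂ)) * (𝓕⁻ (f : ℝ → ℂ)) (z * (2 * Real.pi)⁻¹) := by
    intro z
    rw [← SchwartzMap.fourierInv_coe]
    rfl
  have hKi : ∀ z, K z = 1 / (2 * (Real.pi : ℂ)) *
      ∫ ξ : ℝ, (χ ξ : ℂ) * Complex.exp (Complex.I * z * ξ) := by
    intro z
    rw [hKz, Real.fourierInv_eq']
    congr 2
    ext ξ
    rw [hf, smul_eq_mul, mul_comm]
    congr 2
    simp only [RCLike.inner_apply, conj_trivial]
    push_cast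
    field_simp
  refine ⟨K, ?_, fun N hN z => ?_⟩
  -- The integral of an inverse Fourier transform is the value of the symbol at zero, here `χ(0) =
  -- 1`; the Jacobian `2π` cancels the prefactor.
  · have e1 : ∫ s, K s = 1 / (2 * (Real.pi : ℂ)) *
        ∫ s : ℝ, (𝓕⁻ (f : ℝ → ℂ)) (s * (2 * Real.pi)⁻¹) := by
      rw [← integral_const_mul]
      simp only [hKz]
    rw [e1, Measure.integral_comp_mul_right, inv_inv, abs_of_pos Real.two_pi_pos]
    have e2 : ∫ s : ℝ, (𝓕⁻ (f : ℝ → ℂ)) s = 𝓕 (𝓕⁻ (f : ℝ → ℂ)) 0 := by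
      rw [Real.fourier_eq']
      simp
    have e3 : 𝓕 (𝓕⁻ (f : ℝ → ℂ)) = f := by
      rw [← SchwartzMap.fourierInv_coe, ← SchwartzMap.fourier_coe, FourierTransform.fourier_fourierInv_eq]
    rw [e2, e3, hf, hχ.eq_one 0 (by simp)]
    rw [Complex.real_smul]
    push_cast
    field_simp
  · rw [hKi, lpKernel]
    have := Measure.integral_comp_div
      (fun ξ : ℝ => (χ ξ : ℂ) * Complex.exp (Complex.I * ((N * z : ℝ) : ℂ) * ξ)) N
    rw [abs_of_pos hN, Complex.real_smul] at this
    have e : (fun ξ : ℝ => (χ (ξ / N) : ℂ) * Complex.exp (Complex.I * z * ξ))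
        = fun ξ : ℝ => (χ (ξ / N) : ℂ)
          * Complex.exp (Complex.I * ((N * z : ℝ) : ℂ) * ((ξ / N : ℝ) : ℂ)) := by
      funext ξ
      congr 2
      have : (N : ℂ) ≠ 0 := by exact_mod_cast hN.ne'
      push_cast
      field_simp
    rw [e, this]
    ring

/-- The kernel `-½ K'' + (i/2) (z K)'`. -/
def commKernel (K : 𝓢(ℝ, ℂ)) (z : ℝ) : ℂ :=
  -1 / 2 * SchwartzMap.derivCLM ℂ ℂ (SchwartzMap.derivCLM ℂ ℂ K) z
    + Complex.I / 2 * (K z + z * SchwartzMap.derivCLM ℂ ℂ K z)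

theorem rapidDecay_commKernel (K : 𝓢(ℝ, ℂ)) : RapidDecay (commKernel K) :=
  ((rapidDecay_schwartz _).const_mul _).add
    (((rapidDecay_schwartz K).add (rapidDecay_schwartz _).id_mul).const_mul _)

/-- The kernel is the derivative of `-½ K' + (i/2) z K`, which is integrable. -/
theorem integral_commKernel (K : 𝓢(ℝ, ℂ)) : ∫ z, commKernel K z = 0 := by
  have h1 : RapidDecay fun z : ℝ => -1 / 2 * SchwartzMap.derivCLM ℂ ℂ K z
      + Complex.I / 2 * ((z : ℂ) * K z) :=
    ((rapidDecay_schwartz _).const_mul _).add ((rapidDecay_schwartz K).id_mul.const_mul _)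
  refine integral_eq_zero_of_hasDerivAt_of_integrable (fun z => ?_)
    (rapidDecay_commKernel K).integrable h1.integrable
  have hK := K.hasDerivAt z
  have hK' := (SchwartzMap.derivCLM ℂ ℂ K).hasDerivAt z
  have hz : HasDerivAt (fun z : ℝ => (z : ℂ)) 1 z := Complex.ofRealCLM.hasDerivAt
  refine ((hK'.const_mul (-1 / 2)).add ((hz.mul hK).const_mul (Complex.I / 2))).congr_deriv ?_
  rw [commKernel, one_mul]
  rfl

/-- The kernel `N κ(N (v - ·))`. -/
def scaledKernel (κ : ℝ → ℂ) (N v v' : ℝ) : ℂ := N * κ (N * (v - v'))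

theorem integral_scaledKernel_mul (κ : ℝ → ℂ) {N : ℝ} (hN : 0 < N) (v : ℝ) (g : ℝ → ℂ) :
    ∫ v', scaledKernel κ N v v' * g v' = ∫ s, κ s * g (v - s / N) := by
  have h1 := integral_sub_left_eq_self (fun v' => scaledKernel κ N v v' * g v') volume v
  have h2 := Measure.integral_comp_mul_left (fun s => κ s * g (v - s / N)) N
  rw [abs_of_pos (inv_pos.mpr hN), Complex.real_smul] at h2
  have hNc : (N : ℂ) ≠ 0 := by exact_mod_cast hN.ne'
  rw [← h1]
  simp only [scaledKernel, sub_sub_cancel]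
  have e : ∀ x, (N : ℂ) * κ (N * x) * g (v - x) = N * (κ (N * x) * g (v - N * x / N)) := fun x => by
    rw [mul_div_cancel_left₀ _ hN.ne', mul_assoc]
  simp only [e]
  rw [integral_const_mul, h2]
  push_cast
  rw [mul_inv_cancel_left₀ hNc]

theorem RapidDecay.memLp_scaledKernel {κ : ℝ → ℂ} (hκ : RapidDecay κ) {N : ℝ} (hN : 0 < N)
    (v : ℝ) : MemLp (scaledKernel κ N v) 2 volume := by
  have hc : Continuous (scaledKernel κ N v) :=
    continuous_const.mul (hκ.continuous.comp (by fun_prop))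
  rw [memLp_two_iff_integrable_sq_norm hc.aestronglyMeasurable]
  have h1 := (memLp_two_iff_integrable_sq_norm hκ.continuous.aestronglyMeasurable).mp hκ.memLp_two
  have h2 := ((h1.comp_mul_left' hN.ne').comp_sub_left v).const_mul (‖(N : ℂ)‖ ^ 2)
  refine h2.congr (Eventually.of_forall fun v' => ?_)
  simp only [scaledKernel, norm_mul, mul_pow]

/-- The pairing sees `f` only up to null sets, while the left side is defined at every `v` through
the continuous representative. This is what allows the equation to hold for every `v`. -/
theorem convolve_coeff {κ : ℝ → ℂ} (hκ : RapidDecay κ) {N : ℝ} (hN : 0 < N)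
    {f W : ℝ → Torus d → ℂ} (hf : InL2 f) (hW : Continuous fun p : ℝ × Torus d => W p.1 p.2)
    {M : ℝ} (hM : ∀ v y, ‖W v y‖ ≤ M)
    (hfW : (fun p : ℝ × Torus d => f p.1 p.2) =ᵐ[volume] fun p => W p.1 p.2) (v : ℝ)
    (k : Fin d → ℤ) :
    torusCoeff (convolve κ N W v) k
      = (torusConst d : ℂ) * pairing f (scaledKernel κ N v) k := by
  have hWL : InL2 W := (memLp_congr_ae hfW).mp hf
  have h1 : pairing f (scaledKernel κ N v) k = pairing W (scaledKernel κ N v) k := by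
    refine integral_congr_ae ?_
    filter_upwards [hfW] with p hp
    rw [hp]
  rw [h1, torusConst_mul_pairing hWL (hκ.memLp_scaledKernel hN v)]
  have h2 := torusCoeff_integral_kernel (H := fun s y => W (v - s / N) y) hκ.integrable
    (hW.comp (by fun_prop : Continuous fun p : ℝ × Torus d => (v - p.1 / N, p.2)))
    (fun s y => hM _ _) k
  refine h2.trans ?_
  rw [← integral_scaledKernel_mul κ hN v fun v' => torusCoeff (W v') k]
  simp only [mul_comm]

/-- The low-frequency profile agrees for almost every `y` with the convolution of a continuous
representative of the profile. -/
theorem lpProj_ae_eq {χ : ℝ → ℝ} {K : ℝ → ℂ} {N : ℝ} (hN : 0 < N)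
    (hK : ∀ z, lpKernel χ N z = N * K (N * z)) {f W : ℝ → Torus d → ℂ}
    (hfW : (fun p : ℝ × Torus d => f p.1 p.2) =ᵐ[volume] fun p => W p.1 p.2) :
    ∀ᵐ y : Torus d, ∀ v : ℝ, lpProj χ N f v y = convolve K N W v y := by
  -- With the factors exchanged, the exceptional null set of `y` does not depend on `v`: for the
  -- other `y`, the integrands agree for almost every `v'`.
  have h1 : ∀ᵐ q : Torus d × ℝ ∂(volume.prod volume), f q.2 q.1 = W q.2 q.1 :=
    (Measure.measurePreserving_swap (μ := (volume : Measure (Torus d)))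
      (ν := (volume : Measure ℝ))).quasiMeasurePreserving.ae hfW
  filter_upwards [Measure.ae_ae_of_ae_prod h1] with y hy v
  rw [convolve, ← integral_scaledKernel_mul K hN v fun v' => W v' y, lpProj]
  refine integral_congr_ae ?_
  filter_upwards [hy] with v' hv'
  rw [hv', hK, scaledKernel]

end NLSCylinder
end

/-! ### From compactly supported to decaying test functions. -/

noncomputable section

namespace NLSCylinder

open Set

variable {d : ℕ}

/-- The weight `(1 + x²)^{-1}`. -/
def lineWeight (x : ℝ) : ℝ := (1 + x ^ 2)⁻¹

theorem lineWeight_pos (x : ℝ) : 0 < lineWeight x := by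
  unfold lineWeight
  positivity

theorem continuous_lineWeight : Continuous lineWeight :=
  Continuous.inv₀ (by fun_prop) fun x => by positivity

theorem memLp_lineWeight : MemLp (fun x => (lineWeight x : ℂ)) 2 volume := by
  have hc : Continuous fun x => (lineWeight x : ℂ) :=
    Complex.continuous_ofReal.comp continuous_lineWeight
  rw [memLp_two_iff_integrable_sq_norm hc.aestronglyMeasurable]
  refine integrable_inv_one_add_sq.mono' (hc.norm.pow 2).aestronglyMeasurable (Eventually.of_forall fun x => ?_)
  rw [Complex.norm_real, norm_pow, norm_norm, Real.norm_of_nonneg (lineWeight_pos x).le, lineWeight,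
    sq]
  refine mul_le_of_le_one_left (by positivity) (inv_le_one_of_one_le₀ ?_)
  nlinarith [sq_nonneg x]

theorem memLp_of_le_lineWeight {φ : ℝ → ℂ} (hφ : Continuous φ) {C : ℝ}
    (hC : ∀ x, ‖φ x‖ ≤ C * lineWeight x) : MemLp φ 2 volume := by
  refine MemLp.of_le_mul (c := C) memLp_lineWeight hφ.aestronglyMeasurable
    (Eventually.of_forall fun x => ?_)
  rw [Complex.norm_real, Real.norm_of_nonneg (lineWeight_pos x).le]
  exact hC x

/-- The norm of the weight in `L²(ℝ × 𝕋^d)`. -/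
def weightNorm (d : ℕ) : ℝ :=
  (l2Norm fun (x : ℝ) (y : Torus d) => (lineWeight x : ℂ) * torusChar (-0) y).toReal

theorem weightNorm_nonneg (d : ℕ) : 0 ≤ weightNorm d := ENNReal.toReal_nonneg

/-- Cauchy–Schwarz against a fixed weight: only the constant `C` of the test function enters, so
that bounds are uniform over the truncations and linear in `|τ - t|` for increments of packets. -/
theorem norm_pairing_le {f : ℝ → Torus d → ℂ} (hf : InL2 f) {φ : ℝ → ℂ} {C : ℝ}
    (hC0 : 0 ≤ C) (hC : ∀ x, ‖φ x‖ ≤ C * lineWeight x) (k : Fin d → ℤ) :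
    ‖pairing f φ k‖ ≤ C * (weightNorm d * (l2Norm f).toReal) := by
  set g : ℝ → Torus d → ℂ := fun x y => (lineWeight x : ℂ) * torusChar (-0) y with hg
  have hgL : InL2 g := memLp_mul_torusChar memLp_lineWeight 0
  have h1 : ‖pairing f φ k‖ₑ ≤ ENNReal.ofReal C *
      ∫⁻ p : ℝ × Torus d, ‖f p.1 p.2‖ₑ * ‖g p.1 p.2‖ₑ := by
    rw [← lintegral_const_mul' _ _ ENNReal.ofReal_ne_top]
    refine (enorm_integral_le_lintegral_enorm _).trans (lintegral_mono fun p => ?_)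
    rw [enorm_mul, mul_left_comm]
    gcongr
    rw [← ofReal_norm, ← ofReal_norm, ← ENNReal.ofReal_mul hC0]
    apply ENNReal.ofReal_le_ofReal
    rw [norm_mul, norm_mul, norm_torusChar, norm_torusChar, mul_one, mul_one, Complex.norm_real,
      Real.norm_of_nonneg (lineWeight_pos _).le]
    exact hC _
  have h2 : ∫⁻ p : ℝ × Torus d, ‖f p.1 p.2‖ₑ * ‖g p.1 p.2‖ₑ ≤ l2Norm g * l2Norm f := by
    rw [← ENNReal.pow_le_pow_left_iff two_ne_zero, mul_pow, l2Norm_sq, l2Norm_sq,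
      mul_comm (l2Sq g)]
    exact lintegral_mul_sq_le hf.1.enorm hgL.1.enorm
  have h3 : ‖pairing f φ k‖ₑ ≤ ENNReal.ofReal C * (l2Norm g * l2Norm f) := h1.trans (by gcongr)
  have h4 := ENNReal.toReal_mono
    (ENNReal.mul_ne_top ENNReal.ofReal_ne_top (ENNReal.mul_ne_top hgL.2.ne hf.2.ne)) h3
  rw [toReal_enorm, ENNReal.toReal_mul, ENNReal.toReal_mul, ENNReal.toReal_ofReal hC0] at h4
  exact h4

/-- Smooth functions that decay like `(1 + x²)^{-1}`, with their first two derivatives. -/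
structure DecaysWith (C : ℝ) (φ : ℝ → ℂ) : Prop where
  smooth : ContDiff ℝ (⊤ : ℕ∞) φ
  le₀ : ∀ x, ‖φ x‖ ≤ C * lineWeight x
  le₁ : ∀ x, ‖deriv φ x‖ ≤ C * lineWeight x
  le₂ : ∀ x, ‖deriv (deriv φ) x‖ ≤ C * lineWeight x

theorem DecaysWith.nonneg {C : ℝ} {φ : ℝ → ℂ} (h : DecaysWith C φ) : 0 ≤ C := by
  have := (norm_nonneg _).trans (h.le₀ 0)
  exact nonneg_of_mul_nonneg_left this (lineWeight_pos 0)

theorem DecaysWith.continuous {C : ℝ} {φ : ℝ → ℂ} (h : DecaysWith C φ) : Continuous φ :=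
  h.smooth.continuous

theorem DecaysWith.continuous_deriv_deriv {C : ℝ} {φ : ℝ → ℂ} (h : DecaysWith C φ) :
    Continuous (deriv (deriv φ)) :=
  (contDiff_infty_iff_deriv.mp (contDiff_infty_iff_deriv.mp h.smooth).2).2.continuous

/-- Approximation of decaying functions by test functions. -/
theorem DecaysWith.exists_approx {C : ℝ} {φ : ℝ → ℂ} (h : DecaysWith C φ) :
    ∃ (D : ℝ) (ψ : ℕ → ℝ → ℂ), 0 ≤ D ∧ (∀ n, IsTest (ψ n)) ∧
      (∀ n x, ‖ψ n x‖ ≤ D * lineWeight x) ∧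
      (∀ n x, ‖deriv (deriv (ψ n)) x‖ ≤ D * lineWeight x) ∧
      ∀ x, ∀ᶠ n in atTop, ψ n x = φ x ∧ deriv (deriv (ψ n)) x = deriv (deriv φ) x := by
  let ρ₀ : ContDiffBump (0 : ℝ) := ⟨1, 2, one_pos, one_lt_two⟩
  set ρ : ℝ → ℂ := fun x => ((ρ₀ x : ℝ) : ℂ) with hρ
  have hρt : IsTest ρ := isTest_ofReal ρ₀.contDiff ρ₀.hasCompactSupport
  have hbd : ∀ f : ℝ → ℂ, IsTest f → ∃ M : ℝ, ∀ x, ‖f x‖ ≤ M := fun f hf =>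
    hf.continuous.bounded_above_of_compact_support hf.2
  obtain ⟨M0, hM0⟩ := hbd _ hρt
  obtain ⟨M1, hM1⟩ := hbd _ hρt.isTest_deriv
  obtain ⟨M2, hM2⟩ := hbd _ hρt.isTest_deriv.isTest_deriv
  have hM0' : 0 ≤ M0 := (norm_nonneg _).trans (hM0 0)
  have hM1' : 0 ≤ M1 := (norm_nonneg _).trans (hM1 0)
  have hM2' : 0 ≤ M2 := (norm_nonneg _).trans (hM2 0)
  have hC := h.nonneg
  have hφ1 : ∀ x, HasDerivAt φ (deriv φ x) x := fun x =>
    (h.smooth.differentiable (by simp) x).hasDerivAt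
  have hs1 : ContDiff ℝ (⊤ : ℕ∞) (deriv φ) := (contDiff_infty_iff_deriv.mp h.smooth).2
  have hφ2 : ∀ x, HasDerivAt (deriv φ) (deriv (deriv φ) x) x := fun x =>
    (hs1.differentiable (by simp) x).hasDerivAt
  have hscale : ∀ f : ℝ → ℂ, IsTest f → ∀ (n : ℕ) (x : ℝ),
      HasDerivAt (fun x : ℝ => f (x / (n + 1))) (((n : ℂ) + 1)⁻¹ * deriv f (x / (n + 1))) x := by
    intro f hf n x
    refine ((hf.hasDerivAt (x / (n + 1))).scomp x
      ((hasDerivAt_id x).div_const ((n : ℝ) + 1))).congr_deriv ?_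
    simp
  -- Truncation by `ρ(x / (n + 1))`. Each derivative of the cutoff brings a factor `(n + 1)⁻¹ ≤ 1`,
  -- so one constant serves all `n`, and on any bounded set the truncation is eventually invisible.
  set ψ : ℕ → ℝ → ℂ := fun n x => ρ (x / (n + 1)) * φ x with hψ
  have d1 : ∀ n, deriv (ψ n) = fun x => ((n : ℂ) + 1)⁻¹ * deriv ρ (x / (n + 1)) * φ x
      + ρ (x / (n + 1)) * deriv φ x := fun n => funext fun x =>
    ((hscale ρ hρt n x).mul (hφ1 x)).deriv
  have d2 : ∀ n, deriv (deriv (ψ n)) = fun x =>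
      ((n : ℂ) + 1)⁻¹ * (((n : ℂ) + 1)⁻¹ * deriv (deriv ρ) (x / (n + 1))) * φ x
        + ((n : ℂ) + 1)⁻¹ * deriv ρ (x / (n + 1)) * deriv φ x
        + (((n : ℂ) + 1)⁻¹ * deriv ρ (x / (n + 1)) * deriv φ x
          + ρ (x / (n + 1)) * deriv (deriv φ) x) := fun n => by
    rw [d1]
    funext x
    exact ((((hscale _ hρt.isTest_deriv n x).const_mul _).mul (hφ1 x)).add
      ((hscale ρ hρt n x).mul (hφ2 x))).deriv
  have hinv : ∀ n : ℕ, ‖((n : ℂ) + 1)⁻¹‖ ≤ 1 := fun n => by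
    rw [norm_inv]
    refine inv_le_one_of_one_le₀ ?_
    have : ((n : ℂ) + 1) = ((n + 1 : ℝ) : ℂ) := by push_cast; rfl
    rw [this, Complex.norm_real, Real.norm_of_nonneg (by positivity)]
    linarith [(Nat.cast_nonneg n : (0 : ℝ) ≤ n)]
  refine ⟨(M0 + 2 * M1 + M2) * C, ψ, by positivity, fun n => ?_, fun n x => ?_, fun n x => ?_,
    fun x => ?_⟩
  · refine ⟨(hρt.1.comp (contDiff_id.div_const _)).mul h.smooth, ?_⟩
    have hn : ((n : ℝ) + 1)⁻¹ ≠ 0 := by positivity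
    have h1 : HasCompactSupport fun x : ℝ => ρ (x / (n + 1)) :=
      hρt.2.comp_homeomorph (Homeomorph.mulRight₀ _ hn)
    exact h1.mul_right
  · rw [hψ, norm_mul]
    have := lineWeight_pos x
    calc ‖ρ (x / (n + 1))‖ * ‖φ x‖ ≤ M0 * (C * lineWeight x) :=
          mul_le_mul (hM0 _) (h.le₀ x) (norm_nonneg _) hM0'
      _ ≤ (M0 + 2 * M1 + M2) * C * lineWeight x := by
          rw [← mul_assoc]
          gcongr
          linarith
  · rw [d2]
    set r := ‖((n : ℂ) + 1)⁻¹‖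
    have hw := (lineWeight_pos x).le
    have hr0 : 0 ≤ r := norm_nonneg _
    have hr1 := hinv n
    calc _ ≤ r * (r * ‖deriv (deriv ρ) (x / (n + 1))‖) * ‖φ x‖
            + r * ‖deriv ρ (x / (n + 1))‖ * ‖deriv φ x‖
            + (r * ‖deriv ρ (x / (n + 1))‖ * ‖deriv φ x‖
              + ‖ρ (x / (n + 1))‖ * ‖deriv (deriv φ) x‖) := by
          refine (norm_add_le _ _).trans (add_le_add ((norm_add_le _ _).trans (le_of_eq ?_))
            ((norm_add_le _ _).trans (le_of_eq ?_)))
          · simp only [norm_mul, r]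
          · simp only [norm_mul, r]
      _ ≤ 1 * (1 * M2) * (C * lineWeight x) + 1 * M1 * (C * lineWeight x)
            + (1 * M1 * (C * lineWeight x) + M0 * (C * lineWeight x)) := by
          have a0 := h.le₀ x
          have a1 := h.le₁ x
          have a2 := h.le₂ x
          gcongr
          · exact hM2 _
          · exact hM1 _
          · exact hM1 _
          · exact hM0 _
      _ = _ := by ring
  · filter_upwards [eventually_gt_atTop ⌈|x|⌉₊] with n hn
    have hnx : |x| < n + 1 := by
      have h1 := Nat.le_ceil |x|
      have h2 : (⌈|x|⌉₊ : ℝ) < n := by exact_mod_cast hn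
      linarith
    have hev : ψ n =ᶠ[𝓝 x] φ := by
      filter_upwards [(isOpen_lt continuous_abs continuous_const).mem_nhds hnx] with z hz
      have hz' : |z| < n + 1 := hz
      have : ρ₀ (z / (n + 1)) = 1 := by
        refine ρ₀.one_of_mem_closedBall ?_
        rw [mem_closedBall_zero_iff, Real.norm_eq_abs, abs_div,
          abs_of_pos (by positivity : (0 : ℝ) < n + 1), div_le_one (by positivity)]
        exact hz'.le
      simp [hψ, hρ, this]
    exact ⟨hev.eq_of_nhds, hev.deriv.deriv.eq_of_nhds⟩

theorem tendsto_pairing {f : ℝ → Torus d → ℂ} (hf : InL2 f) {ψ : ℕ → ℝ → ℂ} {φ : ℝ → ℂ} {D : ℝ}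
    (hψ : ∀ n, Continuous (ψ n)) (hD : ∀ n x, ‖ψ n x‖ ≤ D * lineWeight x)
    (hlim : ∀ x, ∀ᶠ n in atTop, ψ n x = φ x) (k : Fin d → ℤ) :
    Tendsto (fun n => pairing f (ψ n) k) atTop (𝓝 (pairing f φ k)) := by
  have hw := (integrable_pairing hf (memLp_lineWeight.const_mul (D : ℂ)) k).norm
  refine tendsto_integral_of_dominated_convergence _ (fun n => ?_) hw
    (fun n => Eventually.of_forall fun p => ?_) (Eventually.of_forall fun p => ?_)
  · exact hf.1.mul (((hψ n).comp continuous_fst).mul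
      ((continuous_torusChar (-k)).comp continuous_snd)).aestronglyMeasurable
  · simp only [norm_mul, norm_torusChar, mul_one, Complex.norm_real]
    gcongr
    refine (hD n p.1).trans ?_
    rw [Real.norm_of_nonneg (lineWeight_pos _).le]
    exact mul_le_mul_of_nonneg_right (le_abs_self D) (lineWeight_pos _).le
  · refine tendsto_nhds_of_eventually_eq ?_
    filter_upwards [hlim p.1] with n hn
    rw [hn]

/-- The time derivative of the pairing of a solution `u` with `φ`, given by the equation. -/
def pairingDeriv (u : ℝ → Torus d → ℂ) (φ : ℝ → ℂ) (k : Fin d → ℤ) : ℂ :=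
  -Complex.I * (pairing (fun x y => cubic (u x y)) φ k - 1 / 2 * pairing u (deriv (deriv φ)) k
    + (freqSq k : ℂ) / 2 * pairing u φ k)

theorem pairing_sub {f g : ℝ → Torus d → ℂ} (hf : InL2 f) (hg : InL2 g) {φ : ℝ → ℂ}
    (hφ : MemLp φ 2 volume) (k : Fin d → ℤ) :
    pairing (fun x y => f x y - g x y) φ k = pairing f φ k - pairing g φ k := by
  rw [pairing, pairing, pairing, ← integral_sub (integrable_pairing hf hφ k)
    (integrable_pairing hg hφ k)]
  congr 1
  ext p
  ring

/-- The distributional equation tested against decaying functions. -/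
theorem hasDerivWithinAt_pairing {J : Set ℝ} (hJ : J.OrdConnected) {u : ℝ → ℝ → Torus d → ℂ}
    (hu : ∀ t ∈ J, InL2 (u t)) (hN : ∀ t ∈ J, InL2 fun x y => cubic (u t x y)) {k : Fin d → ℤ}
    (heq : ∀ φ : ℝ → ℂ, IsTest φ → ∀ t ∈ J,
      HasDerivWithinAt (fun τ => pairing (u τ) φ k) (pairingDeriv (u t) φ k) J t)
    {t : ℝ} (ht : t ∈ J)
    (hcu : Tendsto (fun τ => l2Norm (fun x y => u τ x y - u t x y)) (𝓝[J] t) (𝓝 0))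
    (hcN : Tendsto (fun τ => l2Norm (fun x y => cubic (u τ x y) - cubic (u t x y))) (𝓝[J] t) (𝓝 0))
    {C : ℝ} {φ : ℝ → ℂ} (hφ : DecaysWith C φ) :
    HasDerivWithinAt (fun τ => pairing (u τ) φ k) (pairingDeriv (u t) φ k) J t := by
  obtain ⟨D, ψ, hD0, hψt, hψ0, hψ2, hψlim⟩ := hφ.exists_approx
  -- A modulus of continuity at `t` for the time derivative of the pairings, independent of `n` up
  -- to the factor `D`.
  set e : ℝ → ℝ := fun τ => weightNorm d *
    ((l2Norm (fun x y => cubic (u τ x y) - cubic (u t x y))).toReal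
      + (1 + freqSq k) * (l2Norm (fun x y => u τ x y - u t x y)).toReal) with he
  have he0 : Tendsto e (𝓝[J] t) (𝓝 0) := by
    have h1 := (ENNReal.tendsto_toReal ENNReal.zero_ne_top).comp hcu
    have h2 := (ENNReal.tendsto_toReal ENNReal.zero_ne_top).comp hcN
    have := (h2.add (h1.const_mul (1 + freqSq k))).const_mul (weightNorm d)
    simpa using this
  have hdiff : ∀ τ ∈ J, ∀ n, ‖pairingDeriv (u τ) (ψ n) k - pairingDeriv (u t) (ψ n) k‖
      ≤ D * e τ := by
    intro τ hτ n
    have m0 : MemLp (ψ n) 2 volume := (hψt n).memLp 2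
    have m2 : MemLp (deriv (deriv (ψ n))) 2 volume := (hψt n).isTest_deriv.isTest_deriv.memLp 2
    have hsub : InL2 fun x y => u τ x y - u t x y := (hu τ hτ).sub (hu t ht)
    have hsubN : InL2 fun x y => cubic (u τ x y) - cubic (u t x y) := (hN τ hτ).sub (hN t ht)
    have b1 := norm_pairing_le hsubN hD0 (hψ0 n) k
    have b2 := norm_pairing_le hsub hD0 (hψ2 n) k
    have b3 := norm_pairing_le hsub hD0 (hψ0 n) k
    have eq1 : pairingDeriv (u τ) (ψ n) k - pairingDeriv (u t) (ψ n) k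
        = -Complex.I * (pairing (fun x y => cubic (u τ x y) - cubic (u t x y)) (ψ n) k
          - 1 / 2 * pairing (fun x y => u τ x y - u t x y) (deriv (deriv (ψ n))) k
          + (freqSq k : ℂ) / 2 * pairing (fun x y => u τ x y - u t x y) (ψ n) k) := by
      rw [pairing_sub (hN τ hτ) (hN t ht) m0, pairing_sub (hu τ hτ) (hu t ht) m0,
        pairing_sub (hu τ hτ) (hu t ht) m2, pairingDeriv, pairingDeriv]
      ring
    have hk := freqSq_nonneg k
    have nk : ‖(freqSq k : ℂ) / 2‖ = freqSq k / 2 := by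
      rw [norm_div, Complex.norm_real, Real.norm_of_nonneg hk]
      norm_num
    rw [eq1, norm_mul, norm_neg, Complex.norm_I, one_mul]
    set B := (l2Norm (fun x y => u τ x y - u t x y)).toReal
    have hB : 0 ≤ B := ENNReal.toReal_nonneg
    have hw := weightNorm_nonneg d
    have hDB : 0 ≤ D * (weightNorm d * B) := by positivity
    calc _ ≤ ‖pairing (fun x y => cubic (u τ x y) - cubic (u t x y)) (ψ n) k‖
          + 1 / 2 * ‖pairing (fun x y => u τ x y - u t x y) (deriv (deriv (ψ n))) k‖
          + freqSq k / 2 * ‖pairing (fun x y => u τ x y - u t x y) (ψ n) k‖ := by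
          refine (norm_add_le _ _).trans (add_le_add ((norm_sub_le _ _).trans (le_of_eq ?_))
            (le_of_eq ?_))
          · rw [norm_mul]
            norm_num
          · rw [norm_mul, nk]
      _ ≤ D * (weightNorm d * (l2Norm (fun x y => cubic (u τ x y) - cubic (u t x y))).toReal)
          + 1 / 2 * (D * (weightNorm d * B)) + freqSq k / 2 * (D * (weightNorm d * B)) := by
          gcongr
      _ ≤ D * e τ := by
          rw [he]
          nlinarith [mul_nonneg hk hDB]
  -- the quantitative estimate for test functions, and its limit
  have key : ∀ ε > 0, ∃ δ > 0, ∀ τ ∈ J, |τ - t| < δ →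
      ‖pairing (u τ) φ k - pairing (u t) φ k - (τ - t) * pairingDeriv (u t) φ k‖
        ≤ D * ε * |τ - t| := by
    intro ε hε
    have h1 : ∀ᶠ τ in 𝓝[J] t, e τ < ε := he0.eventually_lt_const hε
    rw [eventually_nhdsWithin_iff, Metric.eventually_nhds_iff] at h1
    obtain ⟨δ, hδ, h1⟩ := h1
    refine ⟨δ, hδ, fun τ hτ hτδ => ?_⟩
    have hn : ∀ n, ‖pairing (u τ) (ψ n) k - pairing (u t) (ψ n) k
        - (τ - t) * pairingDeriv (u t) (ψ n) k‖ ≤ D * ε * |τ - t| := by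
      intro n
      -- The mean value inequality on `J` near `t`, for the pairing minus its candidate linear part.
      -- Convexity of `J` is used here, and one-sided derivatives suffice.
      have hconv : Convex ℝ (J ∩ Metric.ball t δ) := hJ.convex.inter (convex_ball t δ)
      have hder : ∀ σ ∈ J ∩ Metric.ball t δ, HasDerivWithinAt
          (fun σ : ℝ => pairing (u σ) (ψ n) k - σ * pairingDeriv (u t) (ψ n) k)
          (pairingDeriv (u σ) (ψ n) k - pairingDeriv (u t) (ψ n) k) (J ∩ Metric.ball t δ) σ := by
        intro σ hσ
        have a1 := (heq (ψ n) (hψt n) σ hσ.1).mono (inter_subset_left (t := Metric.ball t δ))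
        have a2 : HasDerivWithinAt (fun σ : ℝ => (σ : ℂ)) 1 (J ∩ Metric.ball t δ) σ :=
          Complex.ofRealCLM.hasDerivAt.hasDerivWithinAt
        refine (a1.sub (a2.mul_const (pairingDeriv (u t) (ψ n) k))).congr_deriv ?_
        ring
      have hb := hconv.norm_image_sub_le_of_norm_hasDerivWithin_le (C := D * ε) hder
        (fun σ hσ => (hdiff σ hσ.1 n).trans
          (mul_le_mul_of_nonneg_left (h1 hσ.2 hσ.1).le hD0))
        ⟨ht, Metric.mem_ball_self hδ⟩ ⟨hτ, hτδ⟩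
      rw [Real.norm_eq_abs] at hb
      refine le_trans (le_of_eq ?_) hb
      congr 1
      ring
    have l0 : ∀ f : ℝ → Torus d → ℂ, InL2 f →
        Tendsto (fun n => pairing f (ψ n) k) atTop (𝓝 (pairing f φ k)) := fun f hf =>
      tendsto_pairing hf (fun n => (hψt n).continuous) hψ0 (fun x => (hψlim x).mono fun n h => h.1) k
    have l2 : Tendsto (fun n => pairing (u t) (deriv (deriv (ψ n))) k) atTop
        (𝓝 (pairing (u t) (deriv (deriv φ)) k)) :=
      tendsto_pairing (hu t ht) (fun n => (hψt n).isTest_deriv.isTest_deriv.continuous) hψ2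
        (fun x => (hψlim x).mono fun n h => h.2) k
    have l3 : Tendsto (fun n => pairingDeriv (u t) (ψ n) k) atTop (𝓝 (pairingDeriv (u t) φ k)) :=
      (((l0 _ (hN t ht)).sub (l2.const_mul _)).add ((l0 _ (hu t ht)).const_mul _)).const_mul _
    exact le_of_tendsto (((l0 _ (hu τ hτ)).sub (l0 _ (hu t ht))).sub (l3.const_mul _)).norm
      (Eventually.of_forall hn)
  rw [hasDerivWithinAt_iff_isLittleO, Asymptotics.isLittleO_iff]
  intro ε hε
  -- Division by `D + 1` rather than `D`, which may vanish.
  obtain ⟨δ, hδ, hk⟩ := key (ε / (D + 1)) (by positivity)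
  rw [eventually_nhdsWithin_iff, Metric.eventually_nhds_iff]
  refine ⟨δ, hδ, fun τ hτ hτJ => ?_⟩
  have h1 := hk τ hτJ hτ
  rw [Complex.real_smul, Real.norm_eq_abs]
  push_cast
  refine h1.trans ?_
  gcongr
  rw [mul_div_assoc', div_le_iff₀ (by positivity)]
  nlinarith

end NLSCylinder
end

/-! ### Wave packets and their commutator with the Schrödinger operator. -/

noncomputable section

namespace NLSCylinder

open Set
open scoped SchwartzMap

variable {d : ℕ}

/-- The wave packet `e^{-i x² / (2 τ)} κ(τ^{1/2} (v - x / τ))`. -/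
def wavePacket (κ : ℝ → ℂ) (v τ x : ℝ) : ℂ :=
  Complex.exp (-Complex.I * (x : ℂ) ^ 2 / (2 * τ)) * κ (Real.sqrt τ * (v - x / τ))

/-- The factor `τ^{-1/2}` of the dual profile cancels the factor `N = τ^{1/2}` of the scaled kernel.
-/
theorem dualProfile_scaledKernel (κ : ℝ → ℂ) (v : ℝ) {τ : ℝ} (hτ : 0 < τ) :
    dualProfile τ (scaledKernel κ (Real.sqrt τ) v) = wavePacket κ v τ := by
  have hs : (Real.sqrt τ : ℂ) ≠ 0 := by exact_mod_cast (Real.sqrt_pos.mpr hτ).ne'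
  ext x
  simp only [dualProfile, scaledKernel, wavePacket]
  field_simp

theorem norm_wavePacket (κ : ℝ → ℂ) (v τ x : ℝ) :
    ‖wavePacket κ v τ x‖ = ‖κ (Real.sqrt τ * (v - x / τ))‖ := by
  have : -Complex.I * (x : ℂ) ^ 2 / (2 * τ) = ((-x ^ 2 / (2 * τ) : ℝ) : ℂ) * Complex.I := by
    push_cast
    ring
  rw [wavePacket, norm_mul, this, Complex.norm_exp_ofReal_mul_I, one_mul]

theorem hasDerivAt_wavePacket (K : 𝓢(ℝ, ℂ)) (v : ℝ) {τ : ℝ} (hτ : 0 < τ) (x : ℝ) :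
    HasDerivAt (wavePacket K v τ) (-(Complex.I * x / τ) * wavePacket K v τ x
      - (Real.sqrt τ : ℂ)⁻¹ * wavePacket (SchwartzMap.derivCLM ℂ ℂ K) v τ x) x := by
  have hs : (Real.sqrt τ : ℂ) ≠ 0 := by exact_mod_cast (Real.sqrt_pos.mpr hτ).ne'
  -- Writing `τ` as the square of its root makes the final identity rational in a single variable.
  have hsq : (τ : ℂ) = (Real.sqrt τ : ℂ) ^ 2 := by
    rw [← Complex.ofReal_pow, Real.sq_sqrt hτ.le]
  have h1 : HasDerivAt (fun x : ℝ => -Complex.I * (x : ℂ) ^ 2 / (2 * τ))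
      (-(Complex.I * x / τ)) x := by
    have := (((hasDerivAt_id x).ofReal_comp.pow 2).const_mul (-Complex.I)).div_const (2 * (τ : ℂ))
    refine this.congr_deriv ?_
    simp
    field_simp
  have h2 : HasDerivAt (fun x : ℝ => Real.sqrt τ * (v - x / τ)) (Real.sqrt τ * (-(1 / τ))) x :=
    (((hasDerivAt_id x).div_const τ).const_sub v).const_mul _
  refine (h1.cexp.mul ((K.hasDerivAt _).scomp x h2)).congr_deriv ?_
  simp only [wavePacket, SchwartzMap.derivCLM_apply, Complex.real_smul, Function.comp_apply]
  push_cast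
  rw [hsq]
  field_simp
  ring

/-- The time derivative of the wave packet of `K`. -/
def wavePacketDeriv (K : 𝓢(ℝ, ℂ)) (v τ x : ℝ) : ℂ :=
  Complex.I * x ^ 2 / (2 * τ ^ 2) * wavePacket K v τ x
    + (v + x / τ) / (2 * Real.sqrt τ) * wavePacket (SchwartzMap.derivCLM ℂ ℂ K) v τ x

theorem hasDerivAt_wavePacket_time (K : 𝓢(ℝ, ℂ)) (v : ℝ) {τ : ℝ} (hτ : 0 < τ) (x : ℝ) :
    HasDerivAt (fun τ => wavePacket K v τ x) (wavePacketDeriv K v τ x) τ := by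
  have hs : (Real.sqrt τ : ℂ) ≠ 0 := by exact_mod_cast (Real.sqrt_pos.mpr hτ).ne'
  have hτc : (τ : ℂ) ≠ 0 := by exact_mod_cast hτ.ne'
  have hsq : (τ : ℂ) = (Real.sqrt τ : ℂ) ^ 2 := by
    rw [← Complex.ofReal_pow, Real.sq_sqrt hτ.le]
  have h1 : HasDerivAt (fun τ : ℝ => -Complex.I * (x : ℂ) ^ 2 / (2 * τ))
      (Complex.I * x ^ 2 / (2 * τ ^ 2)) τ := by
    have hd : HasDerivAt (fun τ : ℝ => 2 * (τ : ℂ)) 2 τ := by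
      simpa using (hasDerivAt_id τ).ofReal_comp.const_mul (2 : ℂ)
    have := (hasDerivAt_const τ (-Complex.I * (x : ℂ) ^ 2)).div hd (by simpa using hτ.ne')
    refine this.congr_deriv ?_
    field_simp
    ring
  have h2 : HasDerivAt (fun τ : ℝ => Real.sqrt τ * (v - x / τ))
      (1 / (2 * Real.sqrt τ) * (v - x / τ) + Real.sqrt τ * (x / τ ^ 2)) τ := by
    refine ((Real.hasDerivAt_sqrt hτ.ne').mul
      (((hasDerivAt_const τ x).div (hasDerivAt_id τ) hτ.ne').const_sub v)).congr_deriv ?_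
    simp
    ring
  refine (h1.cexp.mul ((K.hasDerivAt _).scomp τ h2)).congr_deriv ?_
  simp only [wavePacketDeriv, wavePacket, SchwartzMap.derivCLM_apply, Complex.real_smul,
    Function.comp_apply]
  generalize deriv K (Real.sqrt τ * (v - x / τ)) = k1
  generalize K (Real.sqrt τ * (v - x / τ)) = k0
  push_cast
  rw [hsq]
  field_simp
  ring

theorem deriv_wavePacket (K : 𝓢(ℝ, ℂ)) (v : ℝ) {τ : ℝ} (hτ : 0 < τ) :
    deriv (wavePacket K v τ) = fun x : ℝ => -(Complex.I * x / τ) * wavePacket K v τ x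
      - (Real.sqrt τ : ℂ)⁻¹ * wavePacket (SchwartzMap.derivCLM ℂ ℂ K) v τ x :=
  funext fun x => (hasDerivAt_wavePacket K v hτ x).deriv

theorem deriv_deriv_wavePacket (K : 𝓢(ℝ, ℂ)) (v : ℝ) {τ : ℝ} (hτ : 0 < τ) :
    deriv (deriv (wavePacket K v τ)) = fun x : ℝ =>
      -((x : ℂ) ^ 2 / τ ^ 2 + Complex.I / τ) * wavePacket K v τ x
      + 2 * Complex.I * x / (τ * Real.sqrt τ) * wavePacket (SchwartzMap.derivCLM ℂ ℂ K) v τ x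
      + (τ : ℂ)⁻¹ * wavePacket (SchwartzMap.derivCLM ℂ ℂ (SchwartzMap.derivCLM ℂ ℂ K)) v τ x := by
  have hs : (Real.sqrt τ : ℂ) ≠ 0 := by exact_mod_cast (Real.sqrt_pos.mpr hτ).ne'
  have hsq : (τ : ℂ) = (Real.sqrt τ : ℂ) ^ 2 := by
    rw [← Complex.ofReal_pow, Real.sq_sqrt hτ.le]
  rw [deriv_wavePacket K v hτ]
  ext x
  have h0 : HasDerivAt (fun x : ℝ => -(Complex.I * x / τ)) (-(Complex.I / τ)) x := by
    have := (((hasDerivAt_id x).ofReal_comp.const_mul Complex.I).div_const (τ : ℂ)).neg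
    refine this.congr_deriv ?_
    simp
  have h1 := (h0.mul (hasDerivAt_wavePacket K v hτ x)).sub
    ((hasDerivAt_wavePacket (SchwartzMap.derivCLM ℂ ℂ K) v hτ x).const_mul (Real.sqrt τ : ℂ)⁻¹)
  refine h1.deriv.trans ?_
  rw [hsq]
  field_simp
  linear_combination ((x : ℂ) ^ 2 * wavePacket K v τ x) * Complex.I_sq

/-- The commutator of the wave packets with the free Schrödinger equation. -/
theorem wavePacket_identity (K : 𝓢(ℝ, ℂ)) (v : ℝ) {τ : ℝ} (hτ : 0 < τ) (x : ℝ) :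
    Complex.I * wavePacketDeriv K v τ x - 1 / 2 * deriv (deriv (wavePacket K v τ)) x
      = (τ : ℂ)⁻¹ * wavePacket (commKernel K) v τ x := by
  have hs : (Real.sqrt τ : ℂ) ≠ 0 := by exact_mod_cast (Real.sqrt_pos.mpr hτ).ne'
  have hsq : (τ : ℂ) = (Real.sqrt τ : ℂ) ^ 2 := by
    rw [← Complex.ofReal_pow, Real.sq_sqrt hτ.le]
  rw [deriv_deriv_wavePacket K v hτ]
  simp only [wavePacketDeriv, wavePacket, commKernel]
  generalize SchwartzMap.derivCLM ℂ ℂ (SchwartzMap.derivCLM ℂ ℂ K) (Real.sqrt τ * (v - x / τ)) = k2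
  generalize SchwartzMap.derivCLM ℂ ℂ K (Real.sqrt τ * (v - x / τ)) = k1
  generalize K (Real.sqrt τ * (v - x / τ)) = k0
  generalize Complex.exp (-Complex.I * (x : ℂ) ^ 2 / (2 * τ)) = e
  push_cast
  rw [hsq]
  field_simp
  linear_combination (e * (x : ℂ) ^ 2 * k0) * Complex.I_sq

/-- With `z = √τ (v - x / τ)` one has `x = τ v - √τ z`, so `1 + x²` is controlled by `1 + z²`
uniformly for `0 < τ ≤ b`. Of the two powers of `1 + x²`, one gives the weight and the other absorbs
the polynomial factors created by derivatives. -/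
theorem RapidDecay.exists_wavePacket_le {κ : ℝ → ℂ} (hκ : RapidDecay κ) (v b : ℝ) :
    ∃ C : ℝ, 0 ≤ C ∧ ∀ τ, 0 < τ → τ ≤ b → ∀ x,
      (1 + x ^ 2) * ‖wavePacket κ v τ x‖ ≤ C * lineWeight x := by
  obtain ⟨C, hC⟩ := hκ.exists_le 2
  have hC0 : 0 ≤ C := le_trans (by positivity) (hC 0)
  -- From `x² ≤ 2 (τ v)² + 2 (√τ z)² ≤ 2 b² v² + 2 b z²`, squared.
  refine ⟨(1 + 2 * b ^ 2 * v ^ 2 + 2 * b) ^ 2 * C, by positivity, fun τ hτ hb x => ?_⟩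
  have hb0 : 0 < b := hτ.trans_le hb
  rw [norm_wavePacket]
  set z := Real.sqrt τ * (v - x / τ) with hz
  have hs := Real.sq_sqrt hτ.le
  have hx : x = τ * v - Real.sqrt τ * z := by
    rw [hz]
    have : Real.sqrt τ * (Real.sqrt τ * (v - x / τ)) = Real.sqrt τ ^ 2 * (v - x / τ) := by ring
    rw [this, hs]
    field_simp
    ring
  have hsz : (Real.sqrt τ * z) ^ 2 ≤ b * z ^ 2 := by
    rw [mul_pow, hs]
    gcongr
  have htv : (τ * v) ^ 2 ≤ b ^ 2 * v ^ 2 := by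
    rw [mul_pow]
    gcongr
  have h1 : 1 + x ^ 2 ≤ (1 + 2 * b ^ 2 * v ^ 2 + 2 * b) * (1 + z ^ 2) := by
    have : x ^ 2 ≤ 2 * (τ * v) ^ 2 + 2 * (Real.sqrt τ * z) ^ 2 := by
      rw [hx]
      nlinarith [sq_nonneg (τ * v + Real.sqrt τ * z)]
    have h3 : 0 ≤ b ^ 2 * v ^ 2 * z ^ 2 := by positivity
    nlinarith [sq_nonneg z]
  rw [lineWeight, ← div_eq_mul_inv, le_div_iff₀ (by positivity)]
  calc (1 + x ^ 2) * ‖κ z‖ * (1 + x ^ 2) = (1 + x ^ 2) ^ 2 * ‖κ z‖ := by ring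
    _ ≤ ((1 + 2 * b ^ 2 * v ^ 2 + 2 * b) * (1 + z ^ 2)) ^ 2 * ‖κ z‖ := by gcongr
    _ = (1 + 2 * b ^ 2 * v ^ 2 + 2 * b) ^ 2 * (‖κ z‖ * (1 + z ^ 2) ^ 2) := by ring
    _ ≤ _ := by
        gcongr
        exact hC z

theorem abs_le_one_add_sq (x : ℝ) : |x| ≤ 1 + x ^ 2 := by
  nlinarith [sq_abs x, sq_nonneg (|x| - 1), abs_nonneg x]

theorem contDiff_wavePacket (K : 𝓢(ℝ, ℂ)) (v τ : ℝ) :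
    ContDiff ℝ (⊤ : ℕ∞) (wavePacket K v τ) := by
  unfold wavePacket
  refine ContDiff.mul (ContDiff.cexp ?_) ((K.smooth ⊤).comp
    (contDiff_const.mul (contDiff_const.sub (contDiff_id.div_const τ))))
  exact (contDiff_const.mul (Complex.ofRealCLM.contDiff.pow 2)).div_const _

/-- Two derivatives in `x` produce at most the factor `x²`, with packets of `K`, `K'` and `K''`;
`exists_wavePacket_le` absorbs it. -/
theorem exists_decaysWith_wavePacket (K : 𝓢(ℝ, ℂ)) (v : ℝ) {τ : ℝ} (hτ : 0 < τ) :
    ∃ C, DecaysWith C (wavePacket K v τ) := by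
  obtain ⟨C0, h0, hC0⟩ := (rapidDecay_schwartz K).exists_wavePacket_le v τ
  obtain ⟨C1, h1, hC1⟩ := (rapidDecay_schwartz
    (SchwartzMap.derivCLM ℂ ℂ K)).exists_wavePacket_le v τ
  obtain ⟨C2, h2, hC2⟩ := (rapidDecay_schwartz
    (SchwartzMap.derivCLM ℂ ℂ (SchwartzMap.derivCLM ℂ ℂ K))).exists_wavePacket_le v τ
  set r := Real.sqrt τ with hr
  have hr0 : 0 < r := Real.sqrt_pos.mpr hτ
  have hnr : ‖((r : ℝ) : ℂ)‖ = r := by rw [Complex.norm_real, Real.norm_of_nonneg hr0.le]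
  have hnτ : ‖((τ : ℝ) : ℂ)‖ = τ := by rw [Complex.norm_real, Real.norm_of_nonneg hτ.le]
  refine ⟨C0 + (τ⁻¹ * C0 + r⁻¹ * C1) + ((τ ^ 2)⁻¹ * C0 + τ⁻¹ * C0 + 2 * (τ * r)⁻¹ * C1 + τ⁻¹ * C2),
    contDiff_wavePacket K v τ, fun x => ?_, fun x => ?_, fun x => ?_⟩
  all_goals
    have hw := (lineWeight_pos x).le
    have hx := abs_le_one_add_sq x
    have b0 := hC0 τ hτ le_rfl x
    have b1 := hC1 τ hτ le_rfl x
    have b2 := hC2 τ hτ le_rfl x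
    have n0 := norm_nonneg (wavePacket K v τ x)
    have n1 := norm_nonneg (wavePacket (SchwartzMap.derivCLM ℂ ℂ K) v τ x)
    have n2 := norm_nonneg (wavePacket (SchwartzMap.derivCLM ℂ ℂ (SchwartzMap.derivCLM ℂ ℂ K)) v τ x)
    have one_le : 1 ≤ 1 + x ^ 2 := by nlinarith [sq_nonneg x]
    have sq_le : x ^ 2 ≤ 1 + x ^ 2 := by linarith
    have a0 := (mul_le_mul_of_nonneg_right one_le n0).trans b0
    have a1 := (mul_le_mul_of_nonneg_right one_le n1).trans b1
    have a2 := (mul_le_mul_of_nonneg_right one_le n2).trans b2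
    have c0 := (mul_le_mul_of_nonneg_right hx n0).trans b0
    have c1 := (mul_le_mul_of_nonneg_right hx n1).trans b1
    have e0 := (mul_le_mul_of_nonneg_right sq_le n0).trans b0
    rw [one_mul] at a0 a1 a2
  · refine a0.trans ?_
    gcongr
    have : 0 ≤ τ⁻¹ * C0 + r⁻¹ * C1 + ((τ ^ 2)⁻¹ * C0 + τ⁻¹ * C0 + 2 * (τ * r)⁻¹ * C1 + τ⁻¹ * C2) := by
      positivity
    linarith
  · rw [deriv_wavePacket K v hτ]
    calc _ ≤ τ⁻¹ * (|x| * ‖wavePacket K v τ x‖)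
          + r⁻¹ * ‖wavePacket (SchwartzMap.derivCLM ℂ ℂ K) v τ x‖ := by
          refine (norm_sub_le _ _).trans (le_of_eq ?_)
          rw [norm_mul, norm_mul, norm_neg, norm_div, norm_mul, Complex.norm_I, norm_inv, ← hr, hnr,
            hnτ, Complex.norm_real, Real.norm_eq_abs]
          ring
      _ ≤ τ⁻¹ * (C0 * lineWeight x) + r⁻¹ * (C1 * lineWeight x) := by gcongr
      _ = (τ⁻¹ * C0 + r⁻¹ * C1) * lineWeight x := by ring
      _ ≤ _ := by
          refine mul_le_mul_of_nonneg_right ?_ hw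
          have : 0 ≤ (τ ^ 2)⁻¹ * C0 + τ⁻¹ * C0 + 2 * (τ * r)⁻¹ * C1 + τ⁻¹ * C2 := by positivity
          linarith
  · rw [deriv_deriv_wavePacket K v hτ]
    calc _ ≤ ((τ ^ 2)⁻¹ * (x ^ 2 * ‖wavePacket K v τ x‖) + τ⁻¹ * ‖wavePacket K v τ x‖)
          + 2 * (τ * r)⁻¹ * (|x| * ‖wavePacket (SchwartzMap.derivCLM ℂ ℂ K) v τ x‖)
          + τ⁻¹ * ‖wavePacket (SchwartzMap.derivCLM ℂ ℂ (SchwartzMap.derivCLM ℂ ℂ K)) v τ x‖ := by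
          refine (norm_add₃_le).trans (add_le_add_three ?_ (le_of_eq ?_) (le_of_eq ?_))
          · rw [norm_mul, norm_neg, ← mul_assoc, ← add_mul]
            refine mul_le_mul_of_nonneg_right ((norm_add_le _ _).trans (le_of_eq ?_)) n0
            rw [norm_div, norm_div, norm_pow, norm_pow, Complex.norm_I, hnτ, Complex.norm_real,
              Real.norm_eq_abs, sq_abs]
            ring
          · rw [norm_mul, norm_div, norm_mul, norm_mul, norm_mul, Complex.norm_I, hnτ, ← hr, hnr,
              Complex.norm_real, Real.norm_eq_abs, Complex.norm_ofNat]
            ring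
          · rw [norm_mul, norm_inv, hnτ]
      _ ≤ ((τ ^ 2)⁻¹ * (C0 * lineWeight x) + τ⁻¹ * (C0 * lineWeight x))
          + 2 * (τ * r)⁻¹ * (C1 * lineWeight x) + τ⁻¹ * (C2 * lineWeight x) := by gcongr
      _ = ((τ ^ 2)⁻¹ * C0 + τ⁻¹ * C0 + 2 * (τ * r)⁻¹ * C1 + τ⁻¹ * C2) * lineWeight x := by ring
      _ ≤ _ := by
          refine mul_le_mul_of_nonneg_right ?_ hw
          have : 0 ≤ C0 + (τ⁻¹ * C0 + r⁻¹ * C1) := by positivity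
          linarith

/-- The bound is uniform for `τ` near `t`. It provides the dominating function for differentiation
under the integral and the Lipschitz bound in time. -/
theorem exists_wavePacketDeriv_le (K : 𝓢(ℝ, ℂ)) (v : ℝ) {t : ℝ} (ht : 0 < t) :
    ∃ C : ℝ, 0 ≤ C ∧ ∀ τ ∈ Ioo (t / 2) (2 * t), ∀ x,
      ‖wavePacketDeriv K v τ x‖ ≤ C * lineWeight x := by
  obtain ⟨C0, h0, hC0⟩ := (rapidDecay_schwartz K).exists_wavePacket_le v (2 * t)
  obtain ⟨C1, h1, hC1⟩ := (rapidDecay_schwartz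
    (SchwartzMap.derivCLM ℂ ℂ K)).exists_wavePacket_le v (2 * t)
  set a := t / 2 with ha
  have ha0 : 0 < a := by positivity
  have hsa : 0 < Real.sqrt a := Real.sqrt_pos.mpr ha0
  refine ⟨(2 * a ^ 2)⁻¹ * C0 + (|v| + a⁻¹) * (2 * Real.sqrt a)⁻¹ * C1, by positivity,
    fun τ hτ x => ?_⟩
  have hτ0 : 0 < τ := ha0.trans hτ.1
  have hr0 : 0 < Real.sqrt τ := Real.sqrt_pos.mpr hτ0
  have hra : Real.sqrt a ≤ Real.sqrt τ := Real.sqrt_le_sqrt hτ.1.le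
  have haτ := hτ.1.le
  have b0 := hC0 τ hτ0 hτ.2.le x
  have b1 := hC1 τ hτ0 hτ.2.le x
  have hx := abs_le_one_add_sq x
  have n0 := norm_nonneg (wavePacket K v τ x)
  have n1 := norm_nonneg (wavePacket (SchwartzMap.derivCLM ℂ ℂ K) v τ x)
  have e0 := (mul_le_mul_of_nonneg_right (by linarith : x ^ 2 ≤ 1 + x ^ 2) n0).trans b0
  have hw := (lineWeight_pos x).le
  have hcoef : ‖((v : ℂ) + x / τ)‖ ≤ (|v| + a⁻¹) * (1 + x ^ 2) := by
    refine (norm_add_le _ _).trans ?_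
    rw [norm_div, Complex.norm_real, Complex.norm_real, Complex.norm_real, Real.norm_eq_abs,
      Real.norm_eq_abs, Real.norm_of_nonneg hτ0.le, div_eq_mul_inv, add_mul]
    have i1 : τ⁻¹ ≤ a⁻¹ := inv_anti₀ ha0 haτ
    refine add_le_add ?_ ?_
    · nlinarith [abs_nonneg v, sq_nonneg x]
    · rw [mul_comm]
      gcongr
  calc _ ≤ (2 * τ ^ 2)⁻¹ * (x ^ 2 * ‖wavePacket K v τ x‖)
        + ‖((v : ℂ) + x / τ)‖ * (2 * Real.sqrt τ)⁻¹
          * ‖wavePacket (SchwartzMap.derivCLM ℂ ℂ K) v τ x‖ := by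
        refine (norm_add_le _ _).trans (le_of_eq ?_)
        congr 1
        · rw [norm_mul, norm_div, norm_mul, norm_mul, norm_pow, norm_pow, Complex.norm_I,
            Complex.norm_real, Complex.norm_real, Real.norm_eq_abs, sq_abs, Complex.norm_ofNat,
            Real.norm_of_nonneg hτ0.le]
          ring
        · rw [norm_mul, norm_div, norm_mul, Complex.norm_ofNat, Complex.norm_real (Real.sqrt τ),
            Real.norm_of_nonneg hr0.le]
          ring
    _ ≤ (2 * a ^ 2)⁻¹ * (C0 * lineWeight x)
        + ((|v| + a⁻¹) * (1 + x ^ 2)) * (2 * Real.sqrt a)⁻¹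
          * ‖wavePacket (SchwartzMap.derivCLM ℂ ℂ K) v τ x‖ := by
        gcongr
    _ = (2 * a ^ 2)⁻¹ * (C0 * lineWeight x)
        + ((|v| + a⁻¹) * (2 * Real.sqrt a)⁻¹)
          * ((1 + x ^ 2) * ‖wavePacket (SchwartzMap.derivCLM ℂ ℂ K) v τ x‖) := by ring
    _ ≤ (2 * a ^ 2)⁻¹ * (C0 * lineWeight x)
        + ((|v| + a⁻¹) * (2 * Real.sqrt a)⁻¹) * (C1 * lineWeight x) := by gcongr
    _ = _ := by ring

theorem exists_wavePacket_sub_le (K : 𝓢(ℝ, ℂ)) (v : ℝ) {t : ℝ} (ht : 0 < t) :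
    ∃ C : ℝ, 0 ≤ C ∧ ∀ τ ∈ Ioo (t / 2) (2 * t), ∀ x,
      ‖wavePacket K v τ x - wavePacket K v t x‖ ≤ C * |τ - t| * lineWeight x := by
  obtain ⟨C, hC0, hC⟩ := exists_wavePacketDeriv_le K v ht
  refine ⟨C, hC0, fun τ hτ x => ?_⟩
  have h := (convex_Ioo (t / 2) (2 * t)).norm_image_sub_le_of_norm_hasDerivWithin_le
    (f := fun τ => wavePacket K v τ x) (f' := fun τ => wavePacketDeriv K v τ x)
    (C := C * lineWeight x) (x := t) (y := τ)
    (fun σ hσ => (hasDerivAt_wavePacket_time K v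
      (lt_trans (by positivity) hσ.1) x).hasDerivWithinAt)
    (fun σ hσ => hC σ hσ x) ⟨by linarith, by linarith⟩ hτ
  rw [Real.norm_eq_abs] at h
  linarith [h, mul_right_comm C |τ - t| (lineWeight x)]

theorem memLp_wavePacket (K : 𝓢(ℝ, ℂ)) (v : ℝ) {τ : ℝ} (hτ : 0 < τ) :
    MemLp (wavePacket K v τ) 2 volume := by
  obtain ⟨C, hC⟩ := exists_decaysWith_wavePacket K v hτ
  exact memLp_of_le_lineWeight hC.continuous hC.le₀

theorem continuous_wavePacketDeriv (K : 𝓢(ℝ, ℂ)) (v t : ℝ) :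
    Continuous (wavePacketDeriv K v t) := by
  have c0 := (contDiff_wavePacket K v t).continuous
  have c1 := (contDiff_wavePacket (SchwartzMap.derivCLM ℂ ℂ K) v t).continuous
  unfold wavePacketDeriv
  exact (Continuous.mul (by fun_prop) c0).add (Continuous.mul (by fun_prop) c1)

/-- Differentiation of the pairing of a fixed function with the wave packets. -/
theorem hasDerivAt_pairing_wavePacket {f : ℝ → Torus d → ℂ} (hf : InL2 f) (K : 𝓢(ℝ, ℂ)) (v : ℝ)
    {t : ℝ} (ht : 0 < t) (k : Fin d → ℤ) :
    HasDerivAt (fun τ => pairing f (wavePacket K v τ) k) (pairing f (wavePacketDeriv K v t) k) t := by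
  obtain ⟨C, hC0, hC⟩ := exists_wavePacketDeriv_le K v ht
  have hpos : ∀ τ ∈ Ioo (t / 2) (2 * t), 0 < τ := fun τ hτ => lt_trans (by positivity) hτ.1
  have hbound := (integrable_pairing hf (memLp_lineWeight.const_mul (C : ℂ)) k).norm
  refine (hasDerivAt_integral_of_dominated_loc_of_deriv_le
    (F := fun τ (p : ℝ × Torus d) => f p.1 p.2 * (wavePacket K v τ p.1 * torusChar (-k) p.2))
    (F' := fun τ (p : ℝ × Torus d) => f p.1 p.2 * (wavePacketDeriv K v τ p.1 * torusChar (-k) p.2))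
    (Ioo_mem_nhds (by linarith : t / 2 < t) (by linarith : t < 2 * t)) ?_
    (integrable_pairing hf (memLp_wavePacket K v ht) k) ?_ ?_ hbound ?_).2
  · filter_upwards [Ioo_mem_nhds (by linarith : t / 2 < t) (by linarith : t < 2 * t)] with τ hτ
    exact (integrable_pairing hf (memLp_wavePacket K v (hpos τ hτ)) k).1
  · exact hf.1.mul (((continuous_wavePacketDeriv K v t).comp continuous_fst).mul
      ((continuous_torusChar (-k)).comp continuous_snd)).aestronglyMeasurable
  · refine Eventually.of_forall fun p τ hτ => ?_
    simp only [norm_mul, norm_torusChar, mul_one, Complex.norm_real]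
    gcongr
    rw [Real.norm_of_nonneg hC0, Real.norm_of_nonneg (lineWeight_pos _).le]
    exact hC τ hτ p.1
  · exact Eventually.of_forall fun p τ hτ =>
      (((hasDerivAt_wavePacket_time K v (hpos τ hτ) p.1).mul_const _).const_mul _)

end NLSCylinder
end

/-! ### Time differentiation of a solution tested against moving wave packets. -/

noncomputable section

namespace NLSCylinder

open Set
open scoped SchwartzMap

variable {d : ℕ}

theorem InL2.sub {f g : ℝ → Torus d → ℂ} (hf : InL2 f) (hg : InL2 g) :
    InL2 fun x y => f x y - g x y :=
  MemLp.sub hf hg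

theorem pairing_sub_right {f : ℝ → Torus d → ℂ} (hf : InL2 f) {φ ψ : ℝ → ℂ}
    (hφ : MemLp φ 2 volume) (hψ : MemLp ψ 2 volume) (k : Fin d → ℤ) :
    pairing f (fun x => φ x - ψ x) k = pairing f φ k - pairing f ψ k := by
  rw [pairing, pairing, pairing, ← integral_sub (integrable_pairing hf hφ k)
    (integrable_pairing hf hψ k)]
  congr 1
  ext p
  ring

theorem l2HsNorm_sq_le {f g : ℝ → Torus d → ℂ} (hf : InL2 f) (hg : InL2 g) (s : ℝ) :
    l2HsNorm s f ^ 2 ≤ 2 * (l2HsNorm s (fun x y => f x y - g x y) ^ 2 + l2HsNorm s g ^ 2) := by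
  have hfg : InL2 fun x y => f x y - g x y := hf.sub hg
  rw [l2HsNorm_sq hf.1, l2HsNorm_sq hg.1, l2HsNorm_sq hfg.1, ← ENNReal.tsum_add,
    ← ENNReal.tsum_mul_left]
  refine ENNReal.tsum_le_tsum fun k => ?_
  rw [← mul_add, mul_left_comm, ← lintegral_add_right' _ ((memLp_torusCoeff hg k).1.enorm.pow_const 2),
    ← lintegral_const_mul' _ _ ENNReal.ofNat_ne_top]
  refine mul_le_mul_right (lintegral_mono_ae ?_) _
  filter_upwards [hf.ae_memLp, hg.ae_memLp] with x hfx hgx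
  rw [torusCoeff_sub (hfx.integrable one_le_two) (hgx.integrable one_le_two)]
  refine le_trans (le_of_eq ?_) (enorm_add_sq_le _ _)
  rw [sub_add_cancel]

theorem l2Norm_cubic_sub_le {f g : ℝ → Torus d → ℂ} {A : ℝ≥0∞} (hA : A ≠ ⊤)
    (hf : ∀ᵐ p : ℝ × Torus d, ‖f p.1 p.2‖ₑ ^ 2 ≤ A) (hg : ∀ᵐ p : ℝ × Torus d, ‖g p.1 p.2‖ₑ ^ 2 ≤ A) :
    l2Norm (fun x y => cubic (f x y) - cubic (g x y)) ≤ 3 * A * l2Norm fun x y => f x y - g x y := by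
  rw [← ENNReal.pow_le_pow_left_iff two_ne_zero, mul_pow, l2Norm_sq, l2Norm_sq, l2Sq, l2Sq,
    ← lintegral_const_mul' _ _ (ENNReal.pow_ne_top (ENNReal.mul_ne_top (by norm_num) hA))]
  refine lintegral_mono_ae ?_
  filter_upwards [hf, hg] with p hfp hgp
  refine (enorm_cubic_sub_sq_le hA hfp hgp).trans (le_of_eq ?_)
  rw [mul_pow]
  norm_num

theorem InL2.cubic {f : ℝ → Torus d → ℂ} (hf : InL2 f) {A : ℝ≥0∞} (hA : A ≠ ⊤)
    (hfA : ∀ᵐ p : ℝ × Torus d, ‖f p.1 p.2‖ₑ ^ 2 ≤ A) : InL2 fun x y => cubic (f x y) := by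
  refine ⟨continuous_cubic.comp_aestronglyMeasurable hf.1, ?_⟩
  have h := l2Norm_cubic_sub_le hA hfA (g := fun _ _ => 0) (Eventually.of_forall fun p => by simp)
  simp only [NLSCylinder.cubic, mul_zero, sub_zero] at h
  exact h.trans_lt (ENNReal.mul_lt_top (ENNReal.mul_lt_top (by norm_num) hA.lt_top) hf.2)

section

variable {α : ℝ} {J : Set ℝ} {u : ℝ → ℝ → Torus d → ℂ}

theorem IsSolution.exists_isLx {s : ℝ} (h : IsSolution s J u) {t : ℝ} (ht : t ∈ J) :
    ∃ g, IsLx t (u t) g :=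
  h.continuousLx.elim fun Lu hLu => ⟨Lu t, hLu.1 t ht⟩

/-- Solutions are bounded, locally uniformly in time. -/
theorem IsSolution.exists_eventually_le (hd : 1 ≤ d) (hα : (d : ℝ) / 2 < α) (hJ : J ⊆ Ioi 0)
    (h : IsSolution (3 * α) J u) {t : ℝ} (ht : t ∈ J) :
    ∃ A : ℝ≥0∞, A ≠ ⊤ ∧ ∀ᶠ τ in 𝓝[J] t, ∀ᵐ p : ℝ × Torus d, ‖u τ p.1 p.2‖ₑ ^ 2 ≤ A := by
  have hα0 : 0 ≤ 3 * α := by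
    have : (0 : ℝ) ≤ d / 2 := by positivity
    linarith
  have ht0 : 0 < t := hJ ht
  obtain ⟨Lu, hLu, hLc⟩ := h.continuousLx
  -- The bound holds as soon as `τ > t / 2` and the differences of `L_x u` and of `u` from time `t`
  -- have norm at most one.
  refine ⟨ENNReal.ofReal (t / 2)⁻¹ * (supConst d α *
    (2 * (1 + l2Norm (Lu t) ^ 2) + 2 * (1 + l2HsNorm (3 * α) (u t) ^ 2))),
    ENNReal.mul_ne_top ENNReal.ofReal_ne_top (ENNReal.mul_ne_top (supConst_ne_top hd hα) ?_), ?_⟩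
  · have h1 : l2Norm (Lu t) ^ 2 ≠ ⊤ := ENNReal.pow_ne_top (hLu t ht).1.2.ne
    have h2 : l2HsNorm (3 * α) (u t) ^ 2 ≠ ⊤ := ENNReal.pow_ne_top (h.memL2Hs t ht).ne
    finiteness
  · have e1 := (hLc t ht).eventually_le_const one_pos
    have e2 := (h.continuousL2Hs t ht).eventually_le_const one_pos
    have e3 : ∀ᶠ τ in 𝓝[J] t, t / 2 < τ :=
      mem_nhdsWithin_of_mem_nhds (Ioi_mem_nhds (by linarith))
    filter_upwards [e1, e2, e3, self_mem_nhdsWithin] with τ h1 h2 h3 hτ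
    have hX : xPlusNorm (3 * α) τ (u τ) ^ 2
        ≤ 2 * (1 + l2Norm (Lu t) ^ 2) + 2 * (1 + l2HsNorm (3 * α) (u t) ^ 2) := by
      rw [(hLu τ hτ).xPlusNorm_sq]
      refine add_le_add ?_ ((l2HsNorm_sq_le (h.memL2 τ hτ) (h.memL2 t ht) _).trans ?_)
      · have h4 := l2Sq_add_le (f := fun x y => Lu τ x y - Lu t x y) (g := Lu t)
          ((hLu τ hτ).1.sub (hLu t ht).1).1
        simp only [sub_add_cancel] at h4
        rw [← l2Norm_sq, ← l2Norm_sq, ← l2Norm_sq] at h4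
        refine h4.trans ?_
        gcongr
        exact pow_le_one₀ zero_le h1
      · gcongr
        exact pow_le_one₀ zero_le h2
    filter_upwards [(hLu τ hτ).ae_enorm_sq_le hd hα (hJ hτ) (h.memL2 τ hτ) (h.memL2Hs τ hτ)]
      with p hp
    refine hp.trans ?_
    have hU : l2Norm (u τ) ≤ xPlusNorm (3 * α) τ (u τ) :=
      (l2Norm_le_l2HsNorm (h.memL2 τ hτ) hα0).trans ((hLu τ hτ).l2HsNorm_le_xPlusNorm _)
    -- Only a bound locally uniform in time is needed, so the `L²` norm is replaced by the larger
    -- `X⁺` norm.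
    have hQ : l2Norm (u τ) ^ (1 / 3 : ℝ) * xPlusNorm (3 * α) τ (u τ) ^ (5 / 3 : ℝ)
        ≤ xPlusNorm (3 * α) τ (u τ) ^ 2 := by
      calc _ ≤ xPlusNorm (3 * α) τ (u τ) ^ (1 / 3 : ℝ) * xPlusNorm (3 * α) τ (u τ) ^ (5 / 3 : ℝ) := by
            gcongr
        _ = _ := by
            rw [← ENNReal.rpow_add_of_nonneg _ _ (by norm_num) (by norm_num), ← ENNReal.rpow_natCast]
            norm_num
    gcongr
    exact hQ.trans hX

theorem IsSolution.inL2_cubic (hd : 1 ≤ d) (hα : (d : ℝ) / 2 < α) (hJ : J ⊆ Ioi 0)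
    (h : IsSolution (3 * α) J u) {t : ℝ} (ht : t ∈ J) : InL2 fun x y => cubic (u t x y) := by
  obtain ⟨A, hA, hev⟩ := h.exists_eventually_le hd hα hJ ht
  exact (h.memL2 t ht).cubic hA (hev.self_of_nhdsWithin ht)

theorem IsSolution.tendsto_l2Norm_sub (hα : 0 ≤ α) (h : IsSolution (3 * α) J u) {t : ℝ}
    (ht : t ∈ J) : Tendsto (fun τ => l2Norm (fun x y => u τ x y - u t x y)) (𝓝[J] t) (𝓝 0) := by
  refine tendsto_of_tendsto_of_tendsto_of_le_of_le' tendsto_const_nhds (h.continuousL2Hs t ht)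
    (Eventually.of_forall fun _ => zero_le) ?_
  filter_upwards [self_mem_nhdsWithin] with τ hτ
  exact l2Norm_le_l2HsNorm (InL2.sub (h.memL2 τ hτ) (h.memL2 t ht)) (by positivity)

theorem IsSolution.tendsto_l2Norm_cubic_sub (hd : 1 ≤ d) (hα : (d : ℝ) / 2 < α) (hJ : J ⊆ Ioi 0)
    (h : IsSolution (3 * α) J u) {t : ℝ} (ht : t ∈ J) :
    Tendsto (fun τ => l2Norm (fun x y => cubic (u τ x y) - cubic (u t x y))) (𝓝[J] t) (𝓝 0) := by
  obtain ⟨A, hA, hev⟩ := h.exists_eventually_le hd hα hJ ht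
  have hα0 : 0 ≤ α := le_trans (by positivity) hα.le
  have h1 := ENNReal.Tendsto.const_mul (a := 3 * A) (h.tendsto_l2Norm_sub hα0 ht)
    (Or.inr (ENNReal.mul_ne_top (by norm_num) hA))
  rw [mul_zero] at h1
  refine tendsto_of_tendsto_of_tendsto_of_le_of_le' tendsto_const_nhds h1
    (Eventually.of_forall fun _ => zero_le) ?_
  filter_upwards [hev] with τ hτ
  exact l2Norm_cubic_sub_le hA hτ (hev.self_of_nhdsWithin ht)

theorem IsSolution.hasDerivWithinAt_pairing {s : ℝ} (h : IsSolution s J u) {φ : ℝ → ℂ}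
    (hφ : IsTest φ) (k : Fin d → ℤ) {t : ℝ} (ht : t ∈ J) :
    HasDerivWithinAt (fun τ => pairing (u τ) φ k) (pairingDeriv (u t) φ k) J t := by
  obtain ⟨D, hD, hDe⟩ := h.equation φ hφ k t ht
  refine hD.congr_deriv ?_
  rw [pairingDeriv, ← hDe]
  linear_combination D * Complex.I_sq

/-- Differentiation of the pairing of a solution with the wave packets. -/
theorem IsSolution.hasDerivWithinAt_pairing_wavePacket (hd : 1 ≤ d) (hα : (d : ℝ) / 2 < α)
    (hJc : J.OrdConnected) (hJ : J ⊆ Ioi 0) (h : IsSolution (3 * α) J u) (K : 𝓢(ℝ, ℂ)) (v : ℝ)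
    (k : Fin d → ℤ) {t : ℝ} (ht : t ∈ J) :
    HasDerivWithinAt (fun τ => pairing (u τ) (wavePacket K v τ) k)
      (pairingDeriv (u t) (wavePacket K v t) k + pairing (u t) (wavePacketDeriv K v t) k) J t := by
  have hα0 : 0 ≤ α := le_trans (by positivity) hα.le
  have ht0 : 0 < t := hJ ht
  obtain ⟨C, hφ⟩ := exists_decaysWith_wavePacket K v ht0
  have hcu := h.tendsto_l2Norm_sub hα0 ht
  have h1 := NLSCylinder.hasDerivWithinAt_pairing hJc h.memL2
    (fun t ht => h.inL2_cubic hd hα hJ ht) (k := k)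
    (fun φ hφ t ht => h.hasDerivWithinAt_pairing hφ k ht) ht hcu
    (h.tendsto_l2Norm_cubic_sub hd hα hJ ht) hφ
  have h2 := (hasDerivAt_pairing_wavePacket (h.memL2 t ht) K v ht0 k).hasDerivWithinAt (s := J)
  -- The cross term of the product rule: the packet moves by `O(|τ - t|)` in the weighted norm while
  -- `u(τ) - u(t)` tends to zero in `L²`, so the pairing is `o(|τ - t|)`.
  have h3 : HasDerivWithinAt (fun τ => pairing (fun x y => u τ x y - u t x y)
      (fun x => wavePacket K v τ x - wavePacket K v t x) k) 0 J t := by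
    obtain ⟨D, hD0, hD⟩ := exists_wavePacket_sub_le K v ht0
    rw [hasDerivWithinAt_iff_isLittleO, Asymptotics.isLittleO_iff]
    intro ε hε
    have h4 := ((ENNReal.tendsto_toReal ENNReal.zero_ne_top).comp hcu).const_mul
      (D * weightNorm d)
    rw [ENNReal.toReal_zero, mul_zero] at h4
    filter_upwards [h4.eventually_lt_const hε, self_mem_nhdsWithin, mem_nhdsWithin_of_mem_nhds
      (Ioo_mem_nhds (by linarith : t / 2 < t) (by linarith : t < 2 * t))] with τ hτ hτJ hτI
    have h5 := norm_pairing_le (InL2.sub (h.memL2 τ hτJ) (h.memL2 t ht)) (by positivity)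
      (hD τ hτI) k
    simp only [Function.comp_apply] at hτ
    have h6 : pairing (fun x y => u t x y - u t x y)
        (fun x => wavePacket K v t x - wavePacket K v t x) k = 0 := by simp [pairing]
    rw [h6, smul_zero, sub_zero, sub_zero, Real.norm_eq_abs]
    refine h5.trans ?_
    calc _ = D * weightNorm d * (l2Norm fun x y => u τ x y - u t x y).toReal * |τ - t| := by ring
      _ ≤ _ := by gcongr
  -- Product rule in the form `u(τ) ψ(τ) = u(τ) ψ(t) + (u(t) ψ(τ) - u(t) ψ(t)) + (u(τ) - u(t)) (ψ(τ)
  -- - ψ(t))`.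
  have h4 := (h1.add (h2.sub (hasDerivWithinAt_const t J
    (pairing (u t) (wavePacket K v t) k)))).add h3
  rw [sub_zero, add_zero] at h4
  refine h4.congr_of_eventuallyEq ?_ ?_
  · filter_upwards [self_mem_nhdsWithin] with τ hτ
    have m1 := memLp_wavePacket K v (hJ hτ)
    have m2 := memLp_wavePacket K v ht0
    have m3 : MemLp (fun x => wavePacket K v τ x - wavePacket K v t x) 2 volume := m1.sub m2
    simp only [Pi.add_apply, Pi.sub_apply]
    rw [pairing_sub (h.memL2 τ hτ) (h.memL2 t ht) m3, pairing_sub_right (h.memL2 τ hτ) m1 m2,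
      pairing_sub_right (h.memL2 t ht) m1 m2]
    ring
  · simp [pairing]

theorem memLp_wavePacketDeriv (K : 𝓢(ℝ, ℂ)) (v : ℝ) {t : ℝ} (ht : 0 < t) :
    MemLp (wavePacketDeriv K v t) 2 volume := by
  obtain ⟨C, hC0, hC⟩ := exists_wavePacketDeriv_le K v ht
  exact memLp_of_le_lineWeight (continuous_wavePacketDeriv K v t) (hC t ⟨by linarith, by linarith⟩)

/-- The equation satisfied by the pairing of a solution with the wave packets. -/
theorem IsSolution.wavePacket_equation (hJ : J ⊆ Ioi 0) {s : ℝ} (h : IsSolution s J u)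
    (K : 𝓢(ℝ, ℂ)) (v : ℝ) (k : Fin d → ℤ) {t : ℝ} (ht : t ∈ J) :
    Complex.I * (pairingDeriv (u t) (wavePacket K v t) k + pairing (u t) (wavePacketDeriv K v t) k)
      - (freqSq k : ℂ) / 2 * pairing (u t) (wavePacket K v t) k
      = pairing (fun x y => cubic (u t x y)) (wavePacket K v t) k
        + (t : ℂ)⁻¹ * pairing (u t) (wavePacket (commKernel K) v t) k := by
  have ht0 : 0 < t := hJ ht
  obtain ⟨C, hφ⟩ := exists_decaysWith_wavePacket K v ht0
  have i1 := integrable_pairing (h.memL2 t ht) (memLp_wavePacketDeriv K v ht0) k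
  have i2 := integrable_pairing (h.memL2 t ht)
    (memLp_of_le_lineWeight hφ.continuous_deriv_deriv hφ.le₂) k
  have h1 : (t : ℂ)⁻¹ * pairing (u t) (wavePacket (commKernel K) v t) k
      = Complex.I * pairing (u t) (wavePacketDeriv K v t) k
        - 1 / 2 * pairing (u t) (deriv (deriv (wavePacket K v t))) k := by
    rw [← pairing_const_mul, pairing, pairing, pairing, ← integral_const_mul, ← integral_const_mul,
      ← integral_sub (i1.const_mul _) (i2.const_mul _)]
    congr 1
    ext p
    linear_combination (-u t p.1 p.2 * torusChar (-k) p.2) * wavePacket_identity K v ht0 p.1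
  rw [h1, pairingDeriv]
  linear_combination (-(pairing (fun x y => cubic (u t x y)) (wavePacket K v t) k
    - 1 / 2 * pairing (u t) (deriv (deriv (wavePacket K v t))) k
    + (freqSq k : ℂ) / 2 * pairing (u t) (wavePacket K v t) k)) * Complex.I_sq

end

end NLSCylinder
end

/-! ### The equation for the low-frequency profile and the final exponents. -/

noncomputable section

namespace NLSCylinder

open Set
open scoped SchwartzMap

variable {d : ℕ}

/-- The phase passes through the gauge invariant cubic, and the modulus contributes one extra factor
`(t^{1/2})² = t`. This is the origin of the coefficient `1 / t` in the limiting equation. -/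
theorem cubic_profileAt {t : ℝ} (ht : 0 < t) (f : ℝ → Torus d → ℂ) (v : ℝ) (y : Torus d) :
    cubic (profileAt t f v y) = t * profileAt t (fun x y => cubic (f x y)) v y := by
  have h : ‖profileAt t f v y‖ ^ 2 = t * ‖f (t * v) y‖ ^ 2 := by
    rw [profileAt, norm_mul, norm_mul, norm_exp_profile, mul_one, Complex.norm_real,
      Real.norm_of_nonneg (Real.sqrt_nonneg t), mul_pow, Real.sq_sqrt ht.le]
  rw [cubic, h]
  simp only [profileAt, cubic]
  push_cast
  ring

section

variable {α : ℝ} {J : Set ℝ} {u : ℝ → ℝ → Torus d → ℂ} {χ : ℝ → ℝ} {K : 𝓢(ℝ, ℂ)}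

theorem torusCoeff_convolve_profile {κ : ℝ → ℂ} (hκ : RapidDecay κ) {t : ℝ} (ht : 0 < t)
    {f W : ℝ → Torus d → ℂ} (hf : InL2 f) (hW : Continuous fun p : ℝ × Torus d => W p.1 p.2)
    (hM : ∃ M : ℝ, ∀ v y, ‖W v y‖ ≤ M)
    (hfW : (fun p : ℝ × Torus d => profileAt t f p.1 p.2) =ᵐ[volume] fun p => W p.1 p.2) (v : ℝ)
    (k : Fin d → ℤ) : torusCoeff (convolve κ (Real.sqrt t) W v) k
      = (torusConst d : ℂ) * pairing f (wavePacket κ v t) k := by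
  obtain ⟨M, hM⟩ := hM
  rw [convolve_coeff hκ (Real.sqrt_pos.mpr ht) (hf.profileAt ht) hW hM hfW, pairing_profileAt ht,
    dualProfile_scaledKernel κ v ht]

theorem torusCoeff_convolve_cubic_profile {κ : ℝ → ℂ} (hκ : RapidDecay κ) {t : ℝ} (ht : 0 < t)
    {f W : ℝ → Torus d → ℂ} (hf : InL2 fun x y => cubic (f x y))
    (hW : Continuous fun p : ℝ × Torus d => W p.1 p.2) (hM : ∃ M : ℝ, ∀ v y, ‖W v y‖ ≤ M)
    (hfW : (fun p : ℝ × Torus d => profileAt t f p.1 p.2) =ᵐ[volume] fun p => W p.1 p.2) (v : ℝ)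
    (k : Fin d → ℤ) : torusCoeff (convolve κ (Real.sqrt t) (fun v y => cubic (W v y)) v) k
      = t * ((torusConst d : ℂ) * pairing (fun x y => cubic (f x y)) (wavePacket κ v t) k) := by
  obtain ⟨M, hM⟩ := exists_norm_cubic_le hM
  have e : ∀ v y, cubic (profileAt t f v y) = t * profileAt t (fun x y => cubic (f x y)) v y :=
    cubic_profileAt ht f
  have hL : InL2 fun v y => cubic (profileAt t f v y) := by
    simp only [e]
    exact (hf.profileAt ht).const_mul _
  have hae : (fun p : ℝ × Torus d => cubic (profileAt t f p.1 p.2)) =ᵐ[volume]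
      fun p => cubic (W p.1 p.2) := by
    filter_upwards [hfW] with p hp
    rw [hp]
  rw [convolve_coeff hκ (Real.sqrt_pos.mpr ht) (f := fun v y => cubic (profileAt t f v y)) hL
    (W := fun v y => cubic (W v y)) (continuous_cubic.comp hW) hM hae]
  simp only [e]
  rw [pairing_const_mul_left, pairing_profileAt ht, dualProfile_scaledKernel κ v ht]
  ring

theorem lowProfile_ae_eq (hK : ∀ N : ℝ, 0 < N → ∀ z, lpKernel χ N z = N * K (N * z)) {t : ℝ}
    (ht : 0 < t) {W : ℝ → Torus d → ℂ}
    (hfW : (fun p : ℝ × Torus d => profileAt t (u t) p.1 p.2) =ᵐ[volume] fun p => W p.1 p.2)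
    (v : ℝ) : lowProfile χ u t v =ᵐ[volume] convolve K (Real.sqrt t) W v := by
  have hs := Real.sqrt_pos.mpr ht
  filter_upwards [lpProj_ae_eq hs (hK _ hs) hfW] with y hy
  exact hy v

/-- The bridge between `γ` and the wave packets, valid at every `v` and every `t ∈ J`, so that
differentiating `γ` in time is differentiating a pairing. -/
theorem IsSolution.torusCoeff_lowProfile (hd : 1 ≤ d) (hα : (d : ℝ) / 2 < α) (hJ : J ⊆ Ioi 0)
    (h : IsSolution (3 * α) J u) (hK : ∀ N : ℝ, 0 < N → ∀ z, lpKernel χ N z = N * K (N * z))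
    (v : ℝ) (k : Fin d → ℤ) {t : ℝ} (ht : t ∈ J) :
    torusCoeff (lowProfile χ u t v) k
      = (torusConst d : ℂ) * pairing (u t) (wavePacket K v t) k := by
  have ht0 : 0 < t := hJ ht
  obtain ⟨g, hg⟩ := h.exists_isLx ht
  obtain ⟨W, hW, hfW⟩ := hg.exists_profileBounds hd hα ht0 (h.memL2 t ht) (h.memL2Hs t ht)
  rw [torusCoeff_congr_ae (lowProfile_ae_eq hK ht0 hfW v),
    torusCoeff_convolve_profile (rapidDecay_schwartz K) ht0 (h.memL2 t ht) hW.continuous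
      (hW.exists_norm_le hd hα (h.memL2 t ht).2.ne (hg.xPlusNorm_ne_top (h.memL2Hs t ht))) hfW]

/-- The equation for the low-frequency profile. -/
theorem IsSolution.solvesOnTorus (hd : 1 ≤ d) (hα : (d : ℝ) / 2 < α) (hJc : J.OrdConnected)
    (hJ : J ⊆ Ioi 0) (h : IsSolution (3 * α) J u)
    (hK : ∀ N : ℝ, 0 < N → ∀ z, lpKernel χ N z = N * K (N * z)) {W E : ℝ → ℝ → Torus d → ℂ}
    (hW : ∀ t ∈ J, ProfileBounds α (l2Norm (u t)) (xPlusNorm (3 * α) t (u t)) (W t))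
    (hfW : ∀ t ∈ J, (fun p : ℝ × Torus d => profileAt t (u t) p.1 p.2) =ᵐ[volume]
      fun p => W t p.1 p.2)
    (hE : ∀ t ∈ J, E t = errorTerm K (commKernel K) t (W t)) (v : ℝ) :
    SolvesOnTorus J (fun t y => lowProfile χ u t v y)
      (fun t y => (1 / t : ℂ) * cubic (lowProfile χ u t v y) + E t v y) := by
  intro t ht
  have ht0 : 0 < t := hJ ht
  have htc : (t : ℂ) ≠ 0 := by exact_mod_cast ht0.ne'
  obtain ⟨g, hg⟩ := h.exists_isLx ht
  have hKi := (rapidDecay_schwartz K).integrable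
  have hBi := (rapidDecay_commKernel K).integrable
  have hWc := (hW t ht).continuous
  have hM : ∃ M : ℝ, ∀ v y, ‖W t v y‖ ≤ M := (hW t ht).exists_norm_le hd hα (h.memL2 t ht).2.ne
    (hg.xPlusNorm_ne_top (h.memL2Hs t ht))
  obtain ⟨M', hM'⟩ := exists_norm_cubic_le hM
  obtain ⟨M, hM0⟩ := id hM
  set N := Real.sqrt t
  have sect : ∀ {F : ℝ → Torus d → ℂ}, (Continuous fun p : ℝ × Torus d => F p.1 p.2) →
      Integrable (F v) := fun {F} hF =>
    Continuous.integrable_torus (hF.comp (by fun_prop : Continuous fun y : Torus d => (v, y)))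
  have i1 : Integrable (convolve K N (W t) v) := sect (continuous_convolve hKi N hWc hM0)
  have i2 : Integrable (convolve K N (fun v y => cubic (W t v y)) v) :=
    sect (continuous_convolve hKi N (continuous_cubic.comp hWc) hM')
  have i3 : Integrable (convolve (commKernel K) N (W t) v) :=
    sect (continuous_convolve hBi N hWc hM0)
  have hlow := lowProfile_ae_eq (u := u) hK ht0 (hfW t ht) v
  -- The term `-|γ|² γ` in the error cancels the nonlinearity, leaving linear convolutions whose
  -- coefficients are pairings.
  have hF : (fun y => (1 / t : ℂ) * cubic (lowProfile χ u t v y) + E t v y) =ᵐ[volume] fun y =>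
      (t : ℂ)⁻¹ * (convolve K N (fun v y => cubic (W t v y)) v y
        + convolve (commKernel K) N (W t) v y) := by
    filter_upwards [hlow] with y hy
    rw [hE t ht, hy, errorTerm]
    ring
  refine ⟨i1.congr hlow.symm, ((i2.add i3).const_mul _).congr hF.symm, fun k => ?_⟩
  have hd' := (h.hasDerivWithinAt_pairing_wavePacket hd hα hJc hJ K v k ht).const_mul
    (torusConst d : ℂ)
  refine ⟨_, hd'.congr (fun τ hτ => h.torusCoeff_lowProfile hd hα hJ hK v k hτ)
    (h.torusCoeff_lowProfile hd hα hJ hK v k ht), ?_⟩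
  rw [torusCoeff_congr_ae hF, torusCoeff_const_mul, torusCoeff_add i2 i3,
    torusCoeff_convolve_cubic_profile (rapidDecay_schwartz K) ht0
      (h.inL2_cubic hd hα hJ ht) hWc hM (hfW t ht),
    torusCoeff_convolve_profile (rapidDecay_commKernel K) ht0 (h.memL2 t ht) hWc hM (hfW t ht)]
  have hlow' := h.torusCoeff_lowProfile hd hα hJ hK v k ht
  change _ - _ * torusCoeff (lowProfile χ u t v) k = _
  rw [hlow']
  linear_combination (torusConst d : ℂ) * h.wavePacket_equation hJ K v k ht
    - ((torusConst d : ℂ) * pairing (fun x y => cubic (u t x y)) (wavePacket K v t) k)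
      * inv_mul_cancel₀ htc

end

/-- Passage from squared norms to norms, with `Q² + 1 ≤ (Q + 1)²`. -/
theorem sq_add_one_mul_le {C Q X a : ℝ≥0∞} {c b : ℝ} (hC : C ≤ ENNReal.ofReal (c ^ 2))
    (hc : 0 ≤ c) (hb : 0 ≤ b) (ha : a = ENNReal.ofReal (b ^ 2)) :
    C * (a * (Q ^ 2 + 1) * X ^ 2) ≤ (ENNReal.ofReal (c * b) * ((Q + 1) * X)) ^ 2 := by
  have h1 : Q ^ 2 + 1 ≤ (Q + 1) ^ 2 := by
    have : (Q + 1) ^ 2 = Q ^ 2 + 1 + 2 * Q := by ring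
    rw [this]
    exact le_self_add
  calc C * (a * (Q ^ 2 + 1) * X ^ 2)
      ≤ ENNReal.ofReal (c ^ 2) * (ENNReal.ofReal (b ^ 2) * (Q + 1) ^ 2 * X ^ 2) := by
        rw [ha]
        gcongr
    _ = _ := by
        rw [ENNReal.ofReal_mul hc, ENNReal.ofReal_pow hc, ENNReal.ofReal_pow hb]
        ring

theorem enorm_inv_sq {t : ℝ} (ht : 0 < t) : ‖(t : ℂ)⁻¹‖ₑ ^ 2 = ENNReal.ofReal (t ^ (-2 : ℝ)) := by
  rw [← ofReal_norm, norm_inv, Complex.norm_real, Real.norm_of_nonneg ht.le,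
    ← ENNReal.ofReal_pow (by positivity), Real.rpow_neg ht.le, Real.rpow_two, inv_pow]

theorem enorm_inv_sq_mul_inv_sqrt_sq {t : ℝ} (ht : 0 < t) :
    ‖(t : ℂ)⁻¹‖ₑ ^ 2 * ENNReal.ofReal ((Real.sqrt t)⁻¹ ^ 2)
      = ENNReal.ofReal ((t ^ (-(3 / 2) : ℝ)) ^ 2) := by
  rw [enorm_inv_sq ht, ← ENNReal.ofReal_mul (by positivity), inv_pow, Real.sq_sqrt ht.le,
    ← Real.rpow_neg_one, ← Real.rpow_add ht, ← Real.rpow_natCast, ← Real.rpow_mul ht.le]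
  norm_num

/-- Exponents: `-2 - 1/6 = -13/6`, twice `-13/12`. -/
theorem enorm_inv_sq_mul_inv_sqrt_rpow {t : ℝ} (ht : 0 < t) :
    ‖(t : ℂ)⁻¹‖ₑ ^ 2 * ENNReal.ofReal (Real.sqrt t)⁻¹ ^ (1 / 3 : ℝ)
      = ENNReal.ofReal ((t ^ (-(13 / 12) : ℝ)) ^ 2) := by
  have hs := Real.sqrt_pos.mpr ht
  rw [enorm_inv_sq ht, ENNReal.ofReal_rpow_of_pos (by positivity),
    ← ENNReal.ofReal_mul (by positivity), Real.sqrt_eq_rpow, ← Real.rpow_neg ht.le,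
    ← Real.rpow_mul ht.le, ← Real.rpow_add ht, ← Real.rpow_natCast, ← Real.rpow_mul ht.le]
  norm_num

end NLSCylinder
end

open NLSCylinder

theorem mainTheorem6 (d : ℕ) (hd1 : 1 ≤ d) (hd4 : d ≤ 4) (α : ℝ) (hα : (d : ℝ) / 2 < α)
    (χ : ℝ → ℝ) (hχ : NLSCylinder.IsCutoff χ) :
    ∃ C : ℝ, 0 < C ∧
      ∀ (J : Set ℝ), J.OrdConnected → J ⊆ Set.Ioi 0 →
      ∀ (u : ℝ → ℝ → NLSCylinder.Torus d → ℂ), NLSCylinder.IsSolution (3 * α) J u →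
      ∃ E : ℝ → ℝ → NLSCylinder.Torus d → ℂ,
        (∀ v : ℝ, NLSCylinder.SolvesOnTorus J
          (fun t y => NLSCylinder.lowProfile χ u t v y)
          (fun t y => (1 / t : ℂ) * NLSCylinder.cubic (NLSCylinder.lowProfile χ u t v y)
            + E t v y)) ∧
        ∀ t ∈ J,
          NLSCylinder.InL2 (E t) ∧ (∀ v : ℝ, MemLp (E t v) 2 volume) ∧
          NLSCylinder.l2Norm (E t) ≤ ENNReal.ofReal (C * t ^ (-(3 / 2) : ℝ)) *
            ((NLSCylinder.l2Norm (u t) ^ (1 / 3 : ℝ) *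
              NLSCylinder.xPlusNorm (3 * α) t (u t) ^ (5 / 3 : ℝ) + 1) *
              NLSCylinder.xPlusNorm (3 * α) t (u t)) ∧
          NLSCylinder.lInftyHsNorm α (E t) ≤ ENNReal.ofReal (C * t ^ (-(13 / 12) : ℝ)) *
            ((NLSCylinder.l2Norm (u t) ^ (1 / 3 : ℝ) *
              NLSCylinder.xPlusNorm (3 * α) t (u t) ^ (5 / 3 : ℝ) + 1) *
              NLSCylinder.xPlusNorm (3 * α) t (u t)) := by

  obtain ⟨K, hK1, hK⟩ := exists_kernel hχ
  have hP := rapidDecay_schwartz K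
  have hB := rapidDecay_commKernel K
  obtain ⟨C, hC, hbounds⟩ := exists_errorTerm_bounds hd1 hα hP.integrable hB.integrable hK1
    (integral_commKernel K) hP.lintegral_sq_ne_top hB.lintegral_sq_ne_top
    hP.lintegral_rpow_ne_top hB.lintegral_rpow_ne_top
  -- The added `1` makes the constant positive even when `C` vanishes.
  set c := Real.sqrt C.toReal + 1 with hc
  have hc0 : 0 < c := by positivity
  have hCc : C ≤ ENNReal.ofReal (c ^ 2) := by
    rw [← ENNReal.ofReal_toReal hC]
    apply ENNReal.ofReal_le_ofReal
    nlinarith [Real.sq_sqrt (ENNReal.toReal_nonneg (a := C)), Real.sqrt_nonneg C.toReal]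
  refine ⟨c, hc0, fun J hJc hJ u hu => ?_⟩
  -- Membership in `J` is placed inside the existential so that `W` can be chosen for all real `t`;
  -- outside `J` its value is zero and plays no role.
  have hex : ∀ t : ℝ, ∃ W : ℝ → Torus d → ℂ, t ∈ J →
      ProfileBounds α (l2Norm (u t)) (xPlusNorm (3 * α) t (u t)) W ∧
      (fun p : ℝ × Torus d => profileAt t (u t) p.1 p.2) =ᵐ[volume] fun p => W p.1 p.2 := by
    intro t
    by_cases ht : t ∈ J
    · obtain ⟨g, hg⟩ := hu.exists_isLx ht
      obtain ⟨W, hW⟩ := hg.exists_profileBounds hd1 hα (hJ ht) (hu.memL2 t ht) (hu.memL2Hs t ht)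
      exact ⟨W, fun _ => hW⟩
    · exact ⟨fun _ _ => 0, fun h => absurd h ht⟩
  choose W hW using hex
  refine ⟨fun t => errorTerm K (commKernel K) t (W t), fun v => hu.solvesOnTorus hd1 hα hJc hJ hK
    (fun t ht => (hW t ht).1) (fun t ht => (hW t ht).2) (fun _ _ => rfl) v, fun t ht => ?_⟩
  have ht0 : 0 < t := hJ ht
  obtain ⟨g, hg⟩ := hu.exists_isLx ht
  have hU : l2Norm (u t) ≠ ⊤ := (hu.memL2 t ht).2.ne
  have hX := hg.xPlusNorm_ne_top (hu.memL2Hs t ht)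
  have hcont := continuous_errorTerm hP.integrable hB.integrable t (hW t ht).1.continuous
    ((hW t ht).1.exists_norm_le hd1 hα hU hX)
  obtain ⟨hl2, hhs⟩ := hbounds t ht0 _ _ hU hX _ (hW t ht).1
  have hl2' : l2Norm (errorTerm K (commKernel K) t (W t)) ≤ ENNReal.ofReal (c * t ^ (-(3 / 2) : ℝ)) *
      ((l2Norm (u t) ^ (1 / 3 : ℝ) * xPlusNorm (3 * α) t (u t) ^ (5 / 3 : ℝ) + 1) *
        xPlusNorm (3 * α) t (u t)) := by
    rw [← ENNReal.pow_le_pow_left_iff two_ne_zero, l2Norm_sq]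
    exact hl2.trans (sq_add_one_mul_le hCc hc0.le (by positivity)
      (enorm_inv_sq_mul_inv_sqrt_sq ht0))
  refine ⟨⟨hcont.aestronglyMeasurable, hl2'.trans_lt (ENNReal.mul_lt_top ENNReal.ofReal_lt_top
    (ENNReal.mul_lt_top (ENNReal.add_lt_top.mpr ⟨ENNReal.mul_lt_top
      (ENNReal.rpow_lt_top_of_nonneg (by norm_num) hU)
      (ENNReal.rpow_lt_top_of_nonneg (by norm_num) hX), ENNReal.one_lt_top⟩) hX.lt_top))⟩,
    fun v => NLSCylinder.Continuous.memLp_torus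
      (hcont.comp (by fun_prop : Continuous fun y : Torus d => (v, y))) 2, hl2',
    essSup_le_of_ae_le _ (Eventually.of_forall fun v => ?_)⟩
  rw [← ENNReal.pow_le_pow_left_iff two_ne_zero, ← ENNReal.rpow_two, hsNorm_sq]
  exact (hhs v).trans (sq_add_one_mul_le hCc hc0.le (by positivity)
    (enorm_inv_sq_mul_inv_sqrt_rpow ht0))
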